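/- \textbf{Theorem (2-Separation Theorem).} All graphs are simple and may be finite or infinite. A graph is \emph{$k$-connected} if it has more than $k$ vertices and deleting fewer than $k$ vertices does not disconnect it. A \emph{mixed separation} of a graph $G$ is an ordered pair $(A,B)$ with $A\cup B=V(G)$ and $A\setminus B\neq\emptyset\neq B\setminus A$. Its \emph{separator} $S(A,B)$ is the disjoint union of the vertex set $A\cap B$ and the edge set $E(A\setminus B,B\setminus A)$. A \emph{mixed 2-separation} is a mixed separation with $|S(A,B)|=2$, and a \emph{2-separation} is a mixed 2-separation whose separator contains no edges. Two mixed separations $(A,B)$ and $(C,D)$ are \emph{nested} if, after possibly switching the name $A$ with $B$ or the name $C$ with $D$, we have $A\subseteq C$ and $B\supseteq D$; otherwise they \emph{cross}. A 2-separation of $G$ is \emph{totally nested} if it is nested with every 2-separation of $G$. For mixed separations $(A,B)$ and $(C,D)$, the \emph{corner} for $\{X,Y\}$, where $\{X,X'\}=\{A,B\}$ and $\{Y,Y'\}=\{C,D\}$, is $(X\setminus X')\cap(Y\setminus Y')$, and the corner for $\{X',Y'\}$ is \emph{opposite} to it. An edge is \emph{diagonal} if its endvertices lie in opposite corners, and the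 \emph{centre} consists of the diagonal edges and the vertices in $A\cap B\cap C\cap D$. The \emph{link} for $C$ consists of the vertices in $(A\cap B)\setminus D$ and of the non-diagonal edges of $S(A,B)$ with an endvertex in one of the corners for $\{A,C\}$ and $\{B,C\}$; the links for $D$, $A$ and $B$ are defined analogously. A \emph{tree-decomposition} of $G$ is a pair $(T,(V_t)_{t\in T})$ of a tree $T$ and sets $V_t\subseteq V(G)$ such that $G=\bigcup_{t}G[V_t]$ and for every $v\in V(G)$ the set $\{t : v\in V_t\}$ is connected in $T$. Its \emph{adhesion sets} are the sets $V_s\cap V_t$ for edges $st$ of $T$. The \emph{torso} at $t$ is obtained from $G[V_t]$ by making $V_s\cap V_t$ complete for every neighbour $s$ of $t$ in $T$. A directed edge $(t_1,t_2)$ of $T$ is mapped to the pair $(X_1,X_2)$, where $X_i$ is the union of all $V_t$ with $t$ in the component of $T-t_1t_2$ containing $t_i$. A set $N$ of separations \emph{induces} $(T,(V_t)_{t\in T})$ if this map is a bijection from the directed edges of $T$ to $N$. Let $G$ be a 2-connected graph. Then the set of all totally-nested 2-separations of $G$ induces a tree-decomposition $(T,(V_t)_{t\in T})$ of $G$ such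 that every torso is a minor of $G$ and is 3-connected, a cycle, or a $K_2$. Moreover, it has the following two properties: \begin{enumerate} \item If $(A,B)$ and $(C,D)$ are two mixed 2-separations of $G$ that cross so that all four links have size one (and the centre is empty), then there exists a unique node $t\in T$ such that the torso at $t$ is a cycle which alternates between $S(A,B)$ and $S(C,D)$; that is, the elements of $S(A,B)$ and $S(C,D)$ are four distinct vertices or edges of this cycle, and in the cyclic sequence of its vertices and edges they belong alternately to $S(A,B)$ and $S(C,D)$. \item If the torso at a node $t\in T$ is a cycle, then the adhesion sets $V_s\cap V_t$ for the edges $st\in E(T)$ are pairwise distinct. \end{enumerate} -/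

import Mathlib

universe u

namespace TwoSep

open SimpleGraph

variable {V : Type u}

/-- A graph is `k`-connected if it has more than `k` vertices and deleting fewer than `k`
vertices never disconnects it.  Graphs may be infinite. -/
def IsKConnected (G : SimpleGraph V) (k : ℕ) : Prop :=
  (k : ℕ∞) < ENat.card V ∧ ∀ S : Set V, S.encard < (k : ℕ∞) → (G.induce Sᶜ).Connected

/-- `H` is a minor of `G`: there are disjoint nonempty connected branch sets in `G`, one for each
vertex of `H`, such that `G` has an edge between any two branch sets of adjacent vertices. -/
def IsMinor {W : Type u} (H : SimpleGraph W) (G : SimpleGraph V) : Prop :=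
  ∃ β : W → Set V,
    (∀ w, (G.induce (β w)).Connected) ∧
    (∀ w w', w ≠ w' → Disjoint (β w) (β w')) ∧
    (∀ w w', H.Adj w w' → ∃ x ∈ β w, ∃ y ∈ β w', G.Adj x y)

/-- A graph that is a cycle (of length at least three). -/
def IsCycleGraph {W : Type u} (H : SimpleGraph W) : Prop :=
  ∃ m : ℕ, Nonempty (cycleGraph (m + 3) ≃g H)

/-- A graph that is a `K₂`. -/
def IsK2 {W : Type u} (H : SimpleGraph W) : Prop :=
  Nonempty ((⊤ : SimpleGraph (Fin 2)) ≃g H)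

/-! ### Mixed separations -/

/-- `(A, B)` is an (oriented) mixed separation with sides `A = p.1` and `B = p.2`. -/
def IsMixedSep (p : Set V × Set V) : Prop :=
  p.1 ∪ p.2 = Set.univ ∧ (p.1 \ p.2).Nonempty ∧ (p.2 \ p.1).Nonempty

/-- The edges of `G` with one end in `X` and the other in `Y`. -/
def edgesBetween (G : SimpleGraph V) (X Y : Set V) : Set (Sym2 V) :=
  {e | ∃ x ∈ X, ∃ y ∈ Y, G.Adj x y ∧ e = s(x, y)}

/-- The separator `S(A, B)`: the disjoint union of the vertex set `A ∩ B` and the set of the edges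
between `A \ B` and `B \ A`. -/
def separator (G : SimpleGraph V) (p : Set V × Set V) : Set (V ⊕ Sym2 V) :=
  Sum.inl '' (p.1 ∩ p.2) ∪ Sum.inr '' edgesBetween G (p.1 \ p.2) (p.2 \ p.1)

/-- Mixed `k`-separations: mixed separations whose separator has size `k`. -/
def IsMixedKSep (G : SimpleGraph V) (k : ℕ) (p : Set V × Set V) : Prop :=
  IsMixedSep p ∧ (separator G p).encard = (k : ℕ∞)

/-- `k`-separations: mixed `k`-separations with no edges in their separator. -/
def IsKSep (G : SimpleGraph V) (k : ℕ) (p : Set V × Set V) : Prop :=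
  IsMixedKSep G k p ∧ edgesBetween G (p.1 \ p.2) (p.2 \ p.1) = ∅

/-- `(A, B) ≤ (C, D)` if `A ⊆ C` and `B ⊇ D`. -/
def SepLE (p q : Set V × Set V) : Prop := p.1 ⊆ q.1 ∧ q.2 ⊆ p.2

/-- Nested: comparable after possibly switching the sides of one or both separations. -/
def Nested (p q : Set V × Set V) : Prop :=
  SepLE p q ∨ SepLE p q.swap ∨ SepLE p.swap q ∨ SepLE p.swap q.swap

/-- Two mixed separations cross if they are not nested. -/
def Cross (p q : Set V × Set V) : Prop := ¬ Nested p q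

/-- The set of all totally-nested 2-separations: those 2-separations that are nested with every
2-separation. -/
def totallyNested2Seps (G : SimpleGraph V) : Set (Set V × Set V) :=
  {p | IsKSep G 2 p ∧ ∀ q, IsKSep G 2 q → Nested p q}

/-! ### Corners, centre and links of two mixed separations -/

/-- The corner for the pair of the first sides of `p` and `q`; the other three corners arise
by swapping sides. -/
def corner (p q : Set V × Set V) : Set V := (p.1 \ p.2) ∩ (q.1 \ q.2)

/-- Diagonal edges: edges whose ends lie in opposite corners. -/
def diagonalEdges (G : SimpleGraph V) (p q : Set V × Set V) : Set (Sym2 V) :=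
  edgesBetween G (corner p q) (corner p.swap q.swap) ∪
    edgesBetween G (corner p q.swap) (corner p.swap q)

/-- The centre: the diagonal edges together with the vertices in `A ∩ B ∩ C ∩ D`. -/
def centre (G : SimpleGraph V) (p q : Set V × Set V) : Set (V ⊕ Sym2 V) :=
  Sum.inl '' ((p.1 ∩ p.2) ∩ (q.1 ∩ q.2)) ∪ Sum.inr '' diagonalEdges G p q

/-- For `p = (A, B)` and `q = (C, D)`, this is the link for the side `C`: the vertices in
`(A ∩ B) \ D` together with the non-diagonal edges in the separator of `(A, B)` that have an end
in one of the two corners for `C`. The links for `D`, `A` and `B` are `link G p q.swap`,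
`link G q p` and `link G q p.swap`. -/
def link (G : SimpleGraph V) (p q : Set V × Set V) : Set (V ⊕ Sym2 V) :=
  Sum.inl '' ((p.1 ∩ p.2) \ q.2) ∪
    Sum.inr '' {e | e ∈ edgesBetween G (p.1 \ p.2) (p.2 \ p.1) ∧ e ∉ diagonalEdges G p q ∧
      ∃ v ∈ e, v ∈ corner p q ∪ corner p.swap q}

/-- `p` and `q` cross so that all four links have size one and the centre is empty. -/
def CrossWithSingletonLinks (G : SimpleGraph V) (p q : Set V × Set V) : Prop :=
  Cross p q ∧
    (link G p q).encard = 1 ∧ (link G p q.swap).encard = 1 ∧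
    (link G q p).encard = 1 ∧ (link G q p.swap).encard = 1 ∧
    centre G p q = ∅

/-! ### Tree-decompositions -/

section TreeDecomposition

variable {ι : Type u}

/-- `(T, bag)` is a tree-decomposition of `G`. -/
structure IsTreeDecomposition (G : SimpleGraph V) (T : SimpleGraph ι) (bag : ι → Set V) :
    Prop where
  isTree : T.IsTree
  vertex_mem : ∀ v : V, ∃ t, v ∈ bag t
  edge_mem : ∀ v w : V, G.Adj v w → ∃ t, v ∈ bag t ∧ w ∈ bag t
  connected : ∀ v : V, (T.induce {t | v ∈ bag t}).Connected

/-- The union of the bags in the component of `T - t₁t₂` that contains `t₁`. -/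
def edgeSide (T : SimpleGraph ι) (bag : ι → Set V) (t₁ t₂ : ι) : Set V :=
  ⋃ r ∈ {r | (T.deleteEdges {s(t₁, t₂)}).Reachable t₁ r}, bag r

/-- The pair of vertex sets induced by the edge `t₁t₂` of `T` directed from `t₁` to `t₂`. -/
def inducedSep (T : SimpleGraph ι) (bag : ι → Set V) (d : T.Dart) : Set V × Set V :=
  (edgeSide T bag d.fst d.snd, edgeSide T bag d.snd d.fst)

/-- A set `N` of separations induces `(T, bag)` if mapping each directed edge of `T` to the
separation that it induces is a bijection from the directed edges of `T` to `N`. -/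
def Induces (N : Set (Set V × Set V)) (T : SimpleGraph ι) (bag : ι → Set V) : Prop :=
  Set.BijOn (inducedSep T bag) Set.univ N

/-- The torso of the bag at `t`: the graph on that bag obtained from the subgraph of `G` induced
on it by making each adhesion set at `t` into a clique. -/
def torso (G : SimpleGraph V) (T : SimpleGraph ι) (bag : ι → Set V) (t : ι) :
    SimpleGraph (bag t) where
  Adj x y := x ≠ y ∧ (G.Adj x y ∨ ∃ s, T.Adj t s ∧ (x : V) ∈ bag t ∩ bag s ∧ (y : V) ∈ bag t ∩ bag s)
  symm := ⟨by
    rintro x y ⟨hne, h | ⟨s, hs, hx, hy⟩⟩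
    · exact ⟨hne.symm, Or.inl h.symm⟩
    · exact ⟨hne.symm, Or.inr ⟨s, hs, hy, hx⟩⟩⟩
  loopless := ⟨fun _ h => h.1 rfl⟩

end TreeDecomposition

/-! ### Cycles that alternate between two separators -/

/-- The `k`-th entry of the cyclic sequence `c₀, c₀c₁, c₁, c₁c₂, c₂, …` of the vertices and edges
of the cycle with cyclically ordered vertices `c₀, c₁, …, cₙ₋₁`. -/
def cycleItem {n : ℕ} [NeZero n] (c : Fin n → V) (k : ℕ) : V ⊕ Sym2 V :=
  if Even k then Sum.inl (c (Fin.ofNat n (k / 2)))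
  else Sum.inr s(c (Fin.ofNat n (k / 2)), c (Fin.ofNat n (k / 2 + 1)))

/-- `H`, a graph on a set `U` of vertices, is a cycle that alternates between `X` and `Y`:
each of `X` and `Y` consists of two vertices or edges of the cycle, and these four
vertices or edges alternate between `X` and `Y` along the cycle. -/
def IsCycleAlternating {U : Set V} (H : SimpleGraph U) (X Y : Set (V ⊕ Sym2 V)) : Prop :=
  ∃ (m : ℕ) (φ : cycleGraph (m + 3) ≃g H) (i j k l : ℕ),
    i < j ∧ j < k ∧ k < l ∧ l < 2 * (m + 3) ∧
    let a := cycleItem (fun r : Fin (m + 3) => (φ r : V))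
    (({a i, a k} = X ∧ {a j, a l} = Y) ∨ ({a i, a k} = Y ∧ {a j, a l} = X))

end TwoSep

namespace TwoSep

open SimpleGraph

variable {V : Type u}

/-! ### Connectivity through closed sets -/

/-! Crossing. In a 2-connected graph, the strict side of a 2-separation together with either
separator vertex is connected. Hence two crossing 2-separations either have the same separator or
each strictly separates the two separator vertices of the other (`Is2Sep.cross_cases`). In the first
case the common separator leaves at least four parts, and cutting off a single component gives a
totally-nested separation (`Is2Sep.mem_totallyNested_of_component`). So only the second kind of
crossing can occur inside a bag, and it is what produces cycles.

Tree. Let `N` be the set of totally-nested 2-separations. Only finitely many members of `N` separate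
two given vertices: their separators meet fixed walks, and at most two of them share a separator,
because the middle one of a chain of three is crossed. The nodes of the tree are the consistent
orientations `O` of `N` with finitely many members above any given separation; this finiteness
excludes orientations towards the ends of an infinite tree. A member `s` of `O` says that the bag
lies in `s.2`. Tree edges reverse one maximal member, and its separator is the adhesion set.

Torsos. Contracting what hangs behind each adhesion set onto one of its two vertices yields the
torso as a minor, and cuts of a torso lift to cuts of `G`. If a torso with at least four vertices is
not 3-connected, a lifted 2-cut `p` has bag vertices strictly on both sides. Then `p` is not totally
nested, so it is crossed by some `q` whose separator is another pair of bag vertices. Subdividing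
each side of `p` again and again in this way shows that it is a path (`Splits.mem_edges`), so the
torso is a cycle.

Property (1). Any two distinct nonadjacent ends of the four links form the separator of a
2-separation (`Quad.exists_is2Sep`). Hence no totally-nested separation separates them strictly, and
all ends lie in one common bag. A mixed 2-separation restricts to the torso there, which is
therefore not 3-connected; it has too many vertices for a `K₂`, so it is a cycle. The separator of
one mixed separation cuts this cycle into two segments, one for each of the other two links.

Property (2). Two neighbours with the same adhesion set, together with a further bag vertex, give
three parts behind one separator. Cutting off the component of that vertex is then totally nested,
which contradicts maximality. -/

theorem subset_of_adj_closed {G : SimpleGraph V} {K X : Set V} (hK : (G.induce K).Connected)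
    (hX : ∀ v ∈ K, v ∈ X → ∀ w ∈ K, G.Adj v w → w ∈ X) {a : V} (haK : a ∈ K) (haX : a ∈ X) :
    K ⊆ X := by
  have key : ∀ (u v : K) (_ : (G.induce K).Walk u v), (u : V) ∈ X → (v : V) ∈ X := by
    intro u v w
    induction w with
    | nil => exact id
    | cons h _ ih => exact fun hu => ih (hX _ (Subtype.prop _) hu _ (Subtype.prop _) h)
  intro b hb
  obtain ⟨w⟩ := hK.preconnected ⟨a, haK⟩ ⟨b, hb⟩
  exact key _ _ w haX

/-- The hypothesis is applied to the set of vertices reachable from `a`. Together with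
`subset_of_adj_closed` this reduces most connectivity arguments below to checking that a set is
closed under adjacency. -/
theorem connected_induce_of_closed {G : SimpleGraph V} {K : Set V} {a : V} (ha : a ∈ K)
    (h : ∀ X ⊆ K, a ∈ X → (∀ v ∈ X, ∀ w ∈ K, G.Adj v w → w ∈ X) → K ⊆ X) :
    (G.induce K).Connected := by
  have hX := h {v | ∃ hv : v ∈ K, (G.induce K).Reachable ⟨a, ha⟩ ⟨v, hv⟩}
    (fun v hv => hv.1) ⟨ha, Reachable.refl _⟩ (by
      rintro v ⟨hv, hr⟩ w hw hvw
      exact ⟨hw, hr.trans (Adj.reachable (by simpa using hvw))⟩)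
  have : Nonempty K := ⟨⟨a, ha⟩⟩
  refine ⟨fun u v => ?_⟩
  exact (hX u.2).2.symm.trans (hX v.2).2

theorem exists_cut_of_not_connected {G : SimpleGraph V} {K : Set V} (hne : K.Nonempty)
    (h : ¬ (G.induce K).Connected) :
    ∃ X ⊆ K, X.Nonempty ∧ (K \ X).Nonempty ∧ ∀ v ∈ X, ∀ w ∈ K \ X, ¬ G.Adj v w := by
  obtain ⟨a, ha⟩ := hne
  by_contra hcon
  push Not at hcon
  refine h (connected_induce_of_closed ha fun X hXK haX hcl => ?_)
  by_contra hKX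
  obtain ⟨v, hv, w, hw, hvw⟩ := hcon X hXK ⟨a, haX⟩ (Set.sdiff_nonempty.2 hKX)
  exact hw.2 (hcl v hv w hw.1 hvw)

namespace IsKConnected

variable {G : SimpleGraph V}

theorem connected_compl_singleton (hG : IsKConnected G 2) (y : V) :
    (G.induce ({y}ᶜ : Set V)).Connected :=
  hG.2 {y} (by rw [Set.encard_singleton]; norm_num)

theorem exists_notMem_pair (hG : IsKConnected G 2) (x y : V) : ∃ z, z ≠ x ∧ z ≠ y := by
  by_contra! h
  have h1 : (Set.univ : Set V) ⊆ {x, y} := fun z _ => by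
    by_cases hz : z = x
    · exact Or.inl hz
    · exact Or.inr (h z hz)
  have h2 := Set.encard_le_encard h1
  have h3 : ({x, y} : Set V).encard ≤ 2 := by
    refine (Set.encard_insert_le _ _).trans ?_
    rw [Set.encard_singleton]
    norm_num
  rw [Set.encard_univ] at h2
  exact absurd hG.1 (not_lt.2 (h2.trans h3))

/-- Minimum degree two: otherwise `{v}` is closed in the connected graph `G - w`, which also
contains a third vertex. -/
theorem exists_adj_ne (hG : IsKConnected G 2) {v w : V} (h : v ≠ w) :
    ∃ z, z ≠ w ∧ G.Adj v z := by
  by_contra! hcon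
  obtain ⟨z, hzv, hzw⟩ := hG.exists_notMem_pair v w
  have := subset_of_adj_closed (X := {v}) (hG.connected_compl_singleton w)
    (by rintro a - rfl b hb hab; exact absurd hab (hcon b hb)) (a := v) h rfl
  exact hzv (this hzw)

end IsKConnected

/-! ### Genuine 2-separations -/

/-- `p` is a 2-separation with separator `{x, y}`. -/
structure Is2Sep (G : SimpleGraph V) (p : Set V × Set V) (x y : V) : Prop where
  cover : ∀ v, v ∈ p.1 ∨ v ∈ p.2
  mem_iff : ∀ v, (v ∈ p.1 ∧ v ∈ p.2) ↔ v = x ∨ v = y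
  ne : x ≠ y
  left : ∃ v, v ∉ p.2
  right : ∃ v, v ∉ p.1
  not_adj : ∀ v w, v ∉ p.2 → w ∉ p.1 → ¬ G.Adj v w

theorem edgesBetween_eq_empty {G : SimpleGraph V} {X Y : Set V} :
    edgesBetween G X Y = ∅ ↔ ∀ v ∈ X, ∀ w ∈ Y, ¬ G.Adj v w := by
  constructor
  · intro h v hv w hw hvw
    have : s(v, w) ∈ edgesBetween G X Y := ⟨v, hv, w, hw, hvw, rfl⟩
    simp [h] at this
  · intro h
    rw [Set.eq_empty_iff_forall_notMem]
    rintro e ⟨v, hv, w, hw, hvw, -⟩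
    exact h v hv w hw hvw

theorem isKSep_two_iff {G : SimpleGraph V} {p : Set V × Set V} :
    IsKSep G 2 p ↔ ∃ x y, Is2Sep G p x y := by
  constructor
  · rintro ⟨⟨⟨h1, h2, h3⟩, h4⟩, h5⟩
    rw [separator, h5, Set.image_empty, Set.union_empty,
      Function.Injective.encard_image Sum.inl_injective] at h4
    obtain ⟨x, y, hxy, h⟩ := Set.encard_eq_two.1 h4
    rw [edgesBetween_eq_empty] at h5
    have hc : ∀ v, v ∈ p.1 ∨ v ∈ p.2 := fun v => (Set.ext_iff.1 h1 v).2 trivial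
    refine ⟨x, y, hc, fun v => Set.ext_iff.1 h v, hxy, h2.imp fun v hv => hv.2,
      h3.imp fun v hv => hv.2, fun v w hv hw => h5 v ⟨?_, hv⟩ w ⟨?_, hw⟩⟩
    · exact (hc v).resolve_right hv
    · exact (hc w).resolve_left hw
  · rintro ⟨x, y, h⟩
    have h5 : edgesBetween G (p.1 \ p.2) (p.2 \ p.1) = ∅ :=
      edgesBetween_eq_empty.2 fun v hv w hw => h.not_adj v w hv.2 hw.2
    refine ⟨⟨⟨Set.eq_univ_of_forall h.cover, ?_, ?_⟩, ?_⟩, h5⟩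
    · obtain ⟨v, hv⟩ := h.left
      exact ⟨v, (h.cover v).resolve_right hv, hv⟩
    · obtain ⟨v, hv⟩ := h.right
      exact ⟨v, (h.cover v).resolve_left hv, hv⟩
    · rw [separator, h5, Set.image_empty, Set.union_empty,
        Function.Injective.encard_image Sum.inl_injective]
      exact Set.encard_eq_two.2 ⟨x, y, h.ne, Set.ext h.mem_iff⟩

namespace Is2Sep

variable {G : SimpleGraph V} {p q : Set V × Set V} {x y u v : V}

theorem swap (h : Is2Sep G p x y) : Is2Sep G p.swap x y where
  cover v := (h.cover v).symm
  mem_iff v := and_comm.trans (h.mem_iff v)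
  ne := h.ne
  left := h.right
  right := h.left
  not_adj v w hv hw hvw := h.not_adj w v hw hv hvw.symm

theorem comm (h : Is2Sep G p x y) : Is2Sep G p y x where
  cover := h.cover
  mem_iff v := (h.mem_iff v).trans or_comm
  ne := h.ne.symm
  left := h.left
  right := h.right
  not_adj := h.not_adj

theorem isKSep (h : Is2Sep G p x y) : IsKSep G 2 p := isKSep_two_iff.2 ⟨x, y, h⟩

theorem x_mem (h : Is2Sep G p x y) : x ∈ p.1 ∧ x ∈ p.2 := (h.mem_iff x).2 (Or.inl rfl)

theorem y_mem (h : Is2Sep G p x y) : y ∈ p.1 ∧ y ∈ p.2 := (h.mem_iff y).2 (Or.inr rfl)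

/-- The strict side of a 2-separation is connected together with one vertex of the separator. -/
theorem connected_insert (hG : IsKConnected G 2) (h : Is2Sep G p x y) :
    (G.induce (insert x (p.2ᶜ))).Connected := by
  refine connected_induce_of_closed (a := x) (Or.inl rfl) fun X hXK hx hcl => ?_
  -- In the connected graph `G - y`, the closed set `X` can be enlarged by all of `p.2` except `y`:
  -- from there the strict left side is reachable only through `x`, which already lies in `X`.
  have hsub : ({y}ᶜ : Set V) ⊆ X ∪ p.2 \ {y} := by
    refine subset_of_adj_closed (hG.connected_compl_singleton y) ?_ (a := x) h.ne (Or.inl hx)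
    intro v hv hvX w hw hvw
    by_cases hw2 : w ∈ p.2
    · exact Or.inr ⟨hw2, hw⟩
    · left
      rcases hvX with hvX | hvX
      · exact hcl v hvX w (Or.inr hw2) hvw
      · have : v ∈ p.1 := by
          by_contra hv1
          exact h.not_adj w v hw2 hv1 hvw.symm
        rcases (h.mem_iff v).1 ⟨this, hvX.1⟩ with rfl | rfl
        · exact hcl v hx w (Or.inr hw2) hvw
        · exact absurd rfl hv
  intro k hk
  rcases hk with rfl | hk
  · exact hx
  · have hky : k ≠ y := by
      rintro rfl
      exact hk h.y_mem.2
    exact (hsub hky).resolve_right fun hk' => hk hk'.1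

/-- A connected set that avoids the separator lies strictly on one side. -/
theorem subset_side (h : Is2Sep G p x y) {K : Set V} (hK : (G.induce K).Connected)
    (hx : x ∉ K) (hy : y ∉ K) : K ⊆ p.2ᶜ ∨ K ⊆ p.1ᶜ := by
  obtain ⟨⟨a, ha⟩⟩ := hK.nonempty
  have hav : ∀ w ∈ K, w ∉ p.1 ∨ w ∉ p.2 := by
    intro w hw
    by_contra! hcon
    rcases (h.mem_iff w).1 hcon with rfl | rfl
    · exact hx hw
    · exact hy hw
  rcases hav a ha with ha1 | ha2
  · right
    refine subset_of_adj_closed hK (fun v _ hv' w hw hvw => ?_) ha ha1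
    exact (hav w hw).resolve_right fun hw2 => h.not_adj w v hw2 hv' hvw.symm
  · left
    refine subset_of_adj_closed hK (fun v _ hv' w hw hvw => ?_) ha ha2
    exact (hav w hw).resolve_left fun hw1 => h.not_adj v w hv' hw1 hvw

theorem nested_of_subset_compl (hq : Is2Sep G q u v) (hp : Is2Sep G p x y)
    (h : p.2ᶜ ⊆ q.2ᶜ) (hx : x ∈ q.1) (hy : y ∈ q.1) : SepLE p q := by
  refine ⟨fun w hw => ?_, Set.compl_subset_compl.1 h⟩
  by_cases hw2 : w ∈ p.2
  · rcases (hp.mem_iff w).1 ⟨hw, hw2⟩ with rfl | rfl <;> assumption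
  · exact (hq.cover w).resolve_right (h hw2)

/-- The strict left side of `p` together with `x` is connected and avoids `u` and `v`, so it lies
strictly on one side of `q`. The vertex `y` either lies in the separator of `q` or is tied to the
same side through the strict left side of `p`. -/
theorem nested_of_avoid (hG : IsKConnected G 2) (hp : Is2Sep G p x y) (hq : Is2Sep G q u v)
    (hu : u ∈ p.2) (hv : v ∈ p.2) (hx : x ≠ u) (hx' : x ≠ v) : SepLE p q ∨ SepLE p q.swap := by
  have key : ∀ r : Set V × Set V, Is2Sep G r u v → insert x p.2ᶜ ⊆ r.2ᶜ → SepLE p r := by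
    intro r hr hsub
    refine nested_of_subset_compl hr hp (fun w hw => hsub (Or.inr hw))
      ((hr.cover x).resolve_right (hsub (Or.inl rfl))) ?_
    by_cases hyr : y = u ∨ y = v
    · exact ((hr.mem_iff y).2 hyr).1
    · push Not at hyr
      obtain ⟨b, hb⟩ := hp.left
      have hb' := hsub (Or.inr hb)
      rcases hr.subset_side (hp.comm.connected_insert hG)
        (by rintro (h | h); exacts [hyr.1 h.symm, h hu])
        (by rintro (h | h); exacts [hyr.2 h.symm, h hv]) with h | h
      · exact (hr.cover y).resolve_right (h (Or.inl rfl))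
      · exact absurd ((hr.cover b).resolve_right hb') (h (Or.inr hb))
  rcases hq.subset_side (hp.connected_insert hG) (K := insert x p.2ᶜ)
    (by rintro (h | h); exacts [hx h.symm, h hu])
    (by rintro (h | h); exacts [hx' h.symm, h hv]) with h | h
  · exact Or.inl (key q hq h)
  · exact Or.inr (key q.swap hq.swap h)

end Is2Sep

/-! ### Nestedness under switching sides, and the two kinds of crossing -/

theorem Nested.swap_left {p q : Set V × Set V} (h : Nested p q) : Nested p.swap q := by
  rcases h with h | h | h | h
  · exact Or.inr (Or.inr (Or.inl h))
  · exact Or.inr (Or.inr (Or.inr h))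
  · exact Or.inl h
  · exact Or.inr (Or.inl h)

theorem SepLE.swap {p q : Set V × Set V} (h : SepLE p q) : SepLE q.swap p.swap := ⟨h.2, h.1⟩

theorem Nested.symm {p q : Set V × Set V} (h : Nested p q) : Nested q p := by
  rcases h with h | h | h | h
  · exact Or.inr (Or.inr (Or.inr h.swap))
  · exact Or.inr (Or.inl h.swap)
  · exact Or.inr (Or.inr (Or.inl h.swap))
  · exact Or.inl h.swap

theorem Nested.swap_right {p q : Set V × Set V} (h : Nested p q) : Nested p q.swap :=
  h.symm.swap_left.symm

namespace Is2Sep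

variable {G : SimpleGraph V} {p q : Set V × Set V} {x y u v : V}

theorem exists_mem_of_cross (hG : IsKConnected G 2) (hp : Is2Sep G p x y) (hq : Is2Sep G q u v)
    (hc : ¬ Nested p q) (hx : x ≠ u) (hx' : x ≠ v) : (u ∉ p.1 ∧ v ∉ p.2) ∨ (u ∉ p.2 ∧ v ∉ p.1) := by
  have h1 : ¬ (u ∈ p.2 ∧ v ∈ p.2) := fun h =>
    hc ((hp.nested_of_avoid hG hq h.1 h.2 hx hx').elim Or.inl fun h => Or.inr (Or.inl h))
  have h2 : ¬ (u ∈ p.1 ∧ v ∈ p.1) := fun h =>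
    hc ((hp.swap.nested_of_avoid hG hq h.1 h.2 hx hx').elim
      (fun h => Or.inr (Or.inr (Or.inl h))) fun h => Or.inr (Or.inr (Or.inr h)))
  have := hp.cover u
  have := hp.cover v
  tauto

/-- Two crossing 2-separations have the same separator, or each separates the two vertices in
the separator of the other. -/
theorem cross_cases (hG : IsKConnected G 2) (hp : Is2Sep G p x y) (hq : Is2Sep G q u v)
    (hc : ¬ Nested p q) :
    Is2Sep G q x y ∨
      (((u ∉ p.1 ∧ v ∉ p.2) ∨ (u ∉ p.2 ∧ v ∉ p.1)) ∧
        ((x ∉ q.1 ∧ y ∉ q.2) ∨ (x ∉ q.2 ∧ y ∉ q.1))) := by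
  -- Once `p` strictly separates `u` from `v`, the vertex `u` differs from `x` and `y`, so the same
  -- lemma applies with the roles of `p` and `q` exchanged.
  have main : ((u ∉ p.1 ∧ v ∉ p.2) ∨ (u ∉ p.2 ∧ v ∉ p.1)) →
      ((u ∉ p.1 ∧ v ∉ p.2) ∨ (u ∉ p.2 ∧ v ∉ p.1)) ∧
        ((x ∉ q.1 ∧ y ∉ q.2) ∨ (x ∉ q.2 ∧ y ∉ q.1)) := by
    intro h
    refine ⟨h, hq.exists_mem_of_cross hG hp (fun h' => hc h'.symm) ?_ ?_⟩
    · rintro rfl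
      have := hp.x_mem
      tauto
    · rintro rfl
      have := hp.y_mem
      tauto
  by_cases hx : x = u ∨ x = v
  · by_cases hy : y = u ∨ y = v
    · left
      rcases hx with rfl | rfl
      · rcases hy with rfl | rfl
        · exact absurd rfl hp.ne
        · exact hq
      · rcases hy with rfl | rfl
        · exact hq.comm
        · exact absurd rfl hp.ne
    · push Not at hy
      exact Or.inr (main (hp.comm.exists_mem_of_cross hG hq hc hy.1 hy.2))
  · push Not at hx
    exact Or.inr (main (hp.exists_mem_of_cross hG hq hc hx.1 hx.2))

end Is2Sep

theorem exists_is2Sep_of_not_connected {G : SimpleGraph V} (hG : IsKConnected G 2) {x y : V}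
    (hxy : x ≠ y) (h : ¬ (G.induce ({x, y}ᶜ : Set V)).Connected) : ∃ p, Is2Sep G p x y := by
  obtain ⟨z, hzx, hzy⟩ := hG.exists_notMem_pair x y
  obtain ⟨X, hXK, ⟨a, ha⟩, ⟨b, hb, hbX⟩, hno⟩ :=
    exists_cut_of_not_connected ⟨z, by simp [hzx, hzy]⟩ h
  have hX : ∀ v ∈ X, v ≠ x ∧ v ≠ y := fun v hv => by simpa using hXK hv
  refine ⟨(X ∪ {x, y}, Xᶜ), fun v => ?_, fun v => ?_, hxy, ⟨a, ?_⟩, ⟨b, ?_⟩, fun v w hv hw => ?_⟩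
  · by_cases hv : v ∈ X <;> simp [hv]
  · by_cases hv : v ∈ X
    · simp [hv, hX v hv]
    · simp [hv]
  · simpa using ha
  · simp only [Set.mem_union, not_or]
    exact ⟨hbX, hb⟩
  · simp only [Set.mem_union, not_or] at hw
    exact hno v (by simpa using hv) w ⟨hw.2, hw.1⟩

section

/-! ### Finiteness of the set of totally-nested 2-separations between two vertices -/

theorem SepLE.refl (p : Set V × Set V) : SepLE p p := ⟨Set.Subset.rfl, Set.Subset.rfl⟩

theorem SepLE.trans {p q r : Set V × Set V} (h : SepLE p q) (h' : SepLE q r) : SepLE p r :=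
  ⟨h.1.trans h'.1, h'.2.trans h.2⟩

theorem SepLE.antisymm {p q : Set V × Set V} (h : SepLE p q) (h' : SepLE q p) : p = q :=
  Prod.ext (h.1.antisymm h'.1) (h'.2.antisymm h.2)

namespace Is2Sep

variable {G : SimpleGraph V} {p q s s₁ s₂ s₃ : Set V × Set V} {x y u v a b : V}

theorem eq_of_subset (h₁ : Is2Sep G s₁ a b) (h₂ : Is2Sep G s₂ a b) (hle : SepLE s₁ s₂)
    (h : s₂.1 ⊆ s₁.1) : s₁ = s₂ := by
  refine hle.antisymm ⟨h, fun z hz => ?_⟩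
  by_contra hz2
  have h3 := h ((h₂.cover z).resolve_right hz2)
  exact hz2 ((h₂.mem_iff z).2 ((h₁.mem_iff z).1 ⟨h3, hz⟩)).2

/-- The middle one of three comparable 2-separations with the same separator is crossed. -/
theorem exists_cross_of_chain (h₁ : Is2Sep G s₁ a b) (h₂ : Is2Sep G s₂ a b)
    (h₃ : Is2Sep G s₃ a b) (h₁₂ : SepLE s₁ s₂) (h₂₃ : SepLE s₂ s₃) (hne : s₁ ≠ s₂)
    (hne' : s₂ ≠ s₃) : ∃ r, Is2Sep G r a b ∧ ¬ Nested s₂ r := by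
  obtain ⟨e₁, he₁⟩ := h₁.left
  obtain ⟨e₂, he₂, he₂'⟩ := Set.not_subset.1 fun h => hne (h₁.eq_of_subset h₂ h₁₂ h)
  obtain ⟨e₃, he₃, he₃'⟩ := Set.not_subset.1 fun h => hne' (h₂.eq_of_subset h₃ h₂₃ h)
  obtain ⟨e₄, he₄⟩ := h₃.right
  have A := h₁.mem_iff
  have B := h₂.mem_iff
  have C := h₃.mem_iff
  have A' := h₁.cover
  have B' := h₂.cover
  have C' := h₃.cover
  have M1 := fun z => @h₁₂.1 z
  have M2 := fun z => @h₁₂.2 z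
  have M3 := fun z => @h₂₃.1 z
  have M4 := fun z => @h₂₃.2 z
  -- The chain cuts the graph into four nonempty parts, represented by `e₁`, `e₂`, `e₃`, `e₄`.
  -- Grouping the first with the third and the second with the fourth crosses `s₂`, which groups the
  -- first two against the last two.
  refine ⟨(s₁.1 ∪ s₃.1 ∩ s₂.2, s₁.2 ∩ (s₂.1 ∪ s₃.2)), ⟨fun v => ?_, fun v => ?_, h₁.ne,
    ⟨e₁, fun h => he₁ h.1⟩, ⟨e₄, ?_⟩, ?_⟩, ?_⟩
  · simp only [Set.mem_union, Set.mem_inter_iff]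
    grind
  · simp only [Set.mem_union, Set.mem_inter_iff]
    grind
  · simp only [Set.mem_union, Set.mem_inter_iff]
    grind
  · intro v w hv hw hvw
    simp only [Set.mem_union, Set.mem_inter_iff] at hv hw
    have D1 := h₁.not_adj v w
    have D2 := h₂.not_adj v w
    have D3 := h₃.not_adj v w
    have D2' := h₂.not_adj w v
    have D3' := h₃.not_adj w v
    have := hvw.symm
    grind
  · intro h
    rcases h with h | h | h | h
    · have := @h.1 e₂
      simp only [Set.mem_union, Set.mem_inter_iff] at this
      grind
    · have := @h.1 e₁
      simp only [Prod.swap, Set.mem_union, Set.mem_inter_iff] at this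
      grind
    · have := @h.1 e₄
      simp only [Prod.swap, Set.mem_union, Set.mem_inter_iff] at this
      grind
    · have := @h.1 e₃
      simp only [Prod.swap, Set.mem_union, Set.mem_inter_iff] at this
      grind

theorem le_or_le_of_nested (hcov : ∀ z, z ∈ s₂.1 ∨ z ∈ s₂.2) (hn : Nested s₁ s₂) (hv₁ : v ∉ s₁.2) (hv₂ : v ∉ s₂.2)
    (hw₁ : u ∉ s₁.1) (hw₂ : u ∉ s₂.1) : SepLE s₁ s₂ ∨ SepLE s₂ s₁ := by
  have hc₁ := hcov v
  have hc₂ := hcov u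
  rcases hn with h | h | h | h
  · exact Or.inl h
  · exact absurd (h.2 (hc₁.resolve_right hv₂)) hv₁
  · exact absurd (h.2 (hc₂.resolve_left hw₂)) hw₁
  · exact Or.inr h.swap

theorem exists_mem_support (h : Is2Sep G s a b) {K : Set V} {v w : K}
    (P : (G.induce K).Walk v w) (hv : (v : V) ∉ s.2) (hw : (w : V) ∉ s.1) :
    ∃ z ∈ P.support, (z : V) = a ∨ (z : V) = b := by
  induction P with
  | nil => exact absurd (h.cover _) (by tauto)
  | @cons v c w hvc P ih =>
    by_cases hc : (c : V) ∈ s.2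
    · by_cases hc' : (c : V) ∈ s.1
      · exact ⟨c, by simp, (h.mem_iff c).1 ⟨hc', hc⟩⟩
      · exact absurd hvc (h.not_adj _ _ hv hc')
    · obtain ⟨z, hz, hz'⟩ := ih hc hw
      exact ⟨z, by simp [hz], hz'⟩

end Is2Sep

/-- The support of a single walk from `v` to `w` inside `K` meets all these separators. The
inclusion `F ⊆ K` matters when `K` omits one separator vertex: then the other one is hit. -/
theorem exists_finite_hitting {G : SimpleGraph V} {K : Set V} (hK : (G.induce K).Connected)
    {v w : V} (hv : v ∈ K) (hw : w ∈ K) : ∃ F : Set V, F.Finite ∧ F ⊆ K ∧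
      ∀ s a b, Is2Sep G s a b → v ∉ s.2 → w ∉ s.1 → a ∈ F ∨ b ∈ F := by
  obtain ⟨P⟩ := hK.preconnected ⟨v, hv⟩ ⟨w, hw⟩
  refine ⟨Subtype.val '' {z | z ∈ P.support}, (List.finite_toSet _).image _, ?_, ?_⟩
  · rintro _ ⟨z, -, rfl⟩
    exact z.2
  · intro s a b hs hvs hws
    obtain ⟨z, hz, rfl | rfl⟩ := hs.exists_mem_support P hvs hws
    · exact Or.inl ⟨z, hz, rfl⟩
    · exact Or.inr ⟨z, hz, rfl⟩

theorem exists_is2Sep_of_mem {G : SimpleGraph V} {s : Set V × Set V}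
    (hs : s ∈ totallyNested2Seps G) : ∃ x y, Is2Sep G s x y := isKSep_two_iff.1 hs.1

theorem nested_of_mem {G : SimpleGraph V} {s r : Set V × Set V} {x y : V}
    (hs : s ∈ totallyNested2Seps G) (hr : Is2Sep G r x y) : Nested s r := hs.2 r hr.isKSep

theorem swap_mem_totallyNested {G : SimpleGraph V} {s : Set V × Set V}
    (hs : s ∈ totallyNested2Seps G) : s.swap ∈ totallyNested2Seps G := by
  obtain ⟨x, y, h⟩ := exists_is2Sep_of_mem hs
  exact ⟨h.swap.isKSep, fun q hq => (hs.2 q hq).swap_left⟩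

/-- There are at most two of them: any two are comparable, since both have `v` strictly on the left
and `w` strictly on the right, and in a chain of three the middle one would be crossed. -/
theorem finite_totallyNested_same_separator {G : SimpleGraph V} (a b v w : V) :
    {s ∈ totallyNested2Seps G | Is2Sep G s a b ∧ v ∉ s.2 ∧ w ∉ s.1}.Finite := by
  by_contra hinf
  obtain ⟨t, ht, hc⟩ := Set.Infinite.exists_subset_card_eq hinf 3
  obtain ⟨s₁, s₂, s₃, h12, h13, h23, rfl⟩ := Finset.card_eq_three.1 hc
  have m1 := @ht s₁ (by simp)
  have m2 := @ht s₂ (by simp)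
  have m3 := @ht s₃ (by simp)
  have comp : ∀ s s' : Set V × Set V,
      s ∈ {s ∈ totallyNested2Seps G | Is2Sep G s a b ∧ v ∉ s.2 ∧ w ∉ s.1} →
      s' ∈ {s ∈ totallyNested2Seps G | Is2Sep G s a b ∧ v ∉ s.2 ∧ w ∉ s.1} →
      SepLE s s' ∨ SepLE s' s := fun s s' h h' =>
    Is2Sep.le_or_le_of_nested h'.2.1.cover (nested_of_mem h.1 h'.2.1) h.2.2.1 h'.2.2.1 h.2.2.2 h'.2.2.2
  have ch : ∀ s s' s'' : Set V × Set V,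
      s ∈ {s ∈ totallyNested2Seps G | Is2Sep G s a b ∧ v ∉ s.2 ∧ w ∉ s.1} →
      s' ∈ {s ∈ totallyNested2Seps G | Is2Sep G s a b ∧ v ∉ s.2 ∧ w ∉ s.1} →
      s'' ∈ {s ∈ totallyNested2Seps G | Is2Sep G s a b ∧ v ∉ s.2 ∧ w ∉ s.1} →
      SepLE s s' → SepLE s' s'' → s ≠ s' → s' ≠ s'' → False := by
    intro s s' s'' h h' h'' hl hl' hne hne'
    obtain ⟨r, hr, hn⟩ := h.2.1.exists_cross_of_chain h'.2.1 h''.2.1 hl hl' hne hne'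
    exact hn (nested_of_mem h'.1 hr)
  rcases comp s₁ s₂ m1 m2 with a1 | a1 <;> rcases comp s₂ s₃ m2 m3 with a2 | a2 <;>
    rcases comp s₁ s₃ m1 m3 with a3 | a3
  · exact ch _ _ _ m1 m2 m3 a1 a2 h12 h23
  · exact ch _ _ _ m1 m2 m3 a1 a2 h12 h23
  · exact ch _ _ _ m1 m3 m2 a3 a2 h13 h23.symm
  · exact ch _ _ _ m3 m1 m2 a3 a1 h13.symm h12
  · exact ch _ _ _ m2 m1 m3 a1 a3 h12.symm h13
  · exact ch _ _ _ m2 m3 m1 a2 a3 h23 h13.symm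
  · exact ch _ _ _ m3 m2 m1 a2 a1 h23.symm h12.symm
  · exact ch _ _ _ m3 m2 m1 a2 a1 h23.symm h12.symm

/-- Only finitely many totally-nested 2-separations below a given separation separate a given
vertex. -/
theorem finite_totallyNested_below {G : SimpleGraph V} (hG : IsKConnected G 2)
    {m : Set V × Set V} (hm : m ∈ totallyNested2Seps G) (v : V) :
    {s ∈ totallyNested2Seps G | SepLE s m ∧ v ∉ s.2}.Finite := by
  obtain ⟨x, y, hm2⟩ := exists_is2Sep_of_mem hm
  obtain ⟨w, hw⟩ := hm2.right
  -- Finitely many pairs can be separators: one vertex lies on a fixed walk from `v` to `w`, and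
  -- once it is chosen as `a`, the other lies on a fixed walk in `G - a`. If `a` is `v` or `w`, it
  -- belongs to no such separator, and the empty set serves.
  have hpair : ∃ P : Set (V × V), P.Finite ∧ ∀ s a b, Is2Sep G s a b → v ∉ s.2 → w ∉ s.1 →
      (a, b) ∈ P ∨ (b, a) ∈ P := by
    obtain ⟨F, hF, -, hF'⟩ := exists_finite_hitting (K := ∅ᶜ) (v := v) (w := w)
      (hG.2 ∅ (by simp)) (by simp) (by simp)
    have : ∀ a : V, ∃ Fa : Set V, Fa.Finite ∧ a ∉ Fa ∧ ∀ s b, Is2Sep G s a b → v ∉ s.2 →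
        w ∉ s.1 → b ∈ Fa := by
      intro a
      by_cases hav : v = a ∨ w = a
      · refine ⟨∅, Set.finite_empty, by simp, fun s b hs hv hw => ?_⟩
        rcases hav with rfl | rfl
        · exact absurd hs.x_mem.2 hv
        · exact absurd hs.x_mem.1 hw
      · push Not at hav
        obtain ⟨Fa, h1, h2, h3⟩ := exists_finite_hitting (hG.connected_compl_singleton a)
          hav.1 hav.2
        have haF : a ∉ Fa := fun h => h2 h rfl
        exact ⟨Fa, h1, haF, fun s b hs hv hw => (h3 s a b hs hv hw).resolve_left haF⟩
    choose Fa h1 h2 h3 using this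
    refine ⟨⋃ a ∈ F, (fun b => (a, b)) '' Fa a, hF.biUnion fun a _ => (h1 a).image _, ?_⟩
    intro s a b hs hv hw
    simp only [Set.mem_iUnion, Set.mem_image, Prod.mk.injEq, exists_prop]
    rcases hF' s a b hs hv hw with h | h
    · exact Or.inl ⟨a, h, b, h3 a s b hs hv hw, rfl, rfl⟩
    · exact Or.inr ⟨b, h, a, h3 b s a hs.comm hv hw, rfl, rfl⟩
  obtain ⟨P, hP, hP'⟩ := hpair
  refine (hP.biUnion fun ab _ =>
    finite_totallyNested_same_separator (G := G) ab.1 ab.2 v w).subset ?_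
  rintro s ⟨hs, hsm, hv⟩
  obtain ⟨a, b, h⟩ := exists_is2Sep_of_mem hs
  have hws : w ∉ s.1 := fun h => hw (hsm.1 h)
  simp only [Set.mem_iUnion]
  rcases hP' s a b h hv hws with h' | h'
  · exact ⟨(a, b), h', hs, h, hv, hws⟩
  · exact ⟨(b, a), h', hs, h.comm, hv, hws⟩

/-! ### Cutting off a component by a totally-nested 2-separation -/

namespace Is2Sep

variable {G : SimpleGraph V} {p q s : Set V × Set V} {x y u v a b : V}

/-- A crossing separation with the same separator would have to split the connected strict left side
of `s`. Any other crossing separation has its separator vertices `u`, `v` on different sides of `s`;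
`hz`, applied to the one on the right, yields a part behind `x`, `y` that avoids both. This part
links `x` to `y`, although they should be strictly separated. -/
theorem mem_totallyNested_of_component (hG : IsKConnected G 2) (hs : Is2Sep G s x y)
    (hK : (G.induce s.2ᶜ).Connected)
    (hz : ∀ v, v ∉ s.1 → ∃ z, Is2Sep G z x y ∧ v ∈ z.2 ∧ s.1 ⊆ z.2) :
    s ∈ totallyNested2Seps G := by
  refine ⟨hs.isKSep, fun r hr => ?_⟩
  obtain ⟨u, v, hr⟩ := isKSep_two_iff.1 hr
  by_contra hc
  rcases hs.cross_cases hG hr hc with h | ⟨h1, h2⟩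
  · rcases h.subset_side hK (fun hx => hx hs.x_mem.2) (fun hy => hy hs.y_mem.2) with h' | h'
    · exact hc (Or.inl (nested_of_subset_compl h hs h' h.x_mem.1 h.y_mem.1))
    · exact hc (Or.inr (Or.inl (nested_of_subset_compl h.swap hs h' h.x_mem.2 h.y_mem.2)))
  · have hcov := hs.cover
    obtain ⟨z, hz, hu, hv⟩ : ∃ z, Is2Sep G z x y ∧ u ∈ z.2 ∧ v ∈ z.2 := by
      rcases h1 with ⟨hu, hv⟩ | ⟨hu, hv⟩
      · obtain ⟨z, h3, h4, h5⟩ := hz u hu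
        exact ⟨z, h3, h4, h5 ((hcov v).resolve_right hv)⟩
      · obtain ⟨z, h3, h4, h5⟩ := hz v hv
        exact ⟨z, h3, h5 ((hcov u).resolve_right hu), h4⟩
    have hx := hs.x_mem
    have hy := hs.y_mem
    obtain ⟨b, hb⟩ := hz.left
    have hbr := hr.cover b
    have e1 := hr.subset_side (hz.connected_insert hG)
      (by rintro (h | h); exacts [by subst h; tauto, h hu])
      (by rintro (h | h); exacts [by subst h; tauto, h hv])
    have e2 := hr.subset_side (hz.comm.connected_insert hG)
      (by rintro (h | h); exacts [by subst h; tauto, h hu])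
      (by rintro (h | h); exacts [by subst h; tauto, h hv])
    have f1 : ∀ c : Set V, insert x z.2ᶜ ⊆ c → x ∈ c ∧ b ∈ c := fun c h =>
      ⟨h (Or.inl rfl), h (Or.inr hb)⟩
    have f2 : ∀ c : Set V, insert y z.2ᶜ ⊆ c → y ∈ c ∧ b ∈ c := fun c h =>
      ⟨h (Or.inl rfl), h (Or.inr hb)⟩
    have e1' := e1.imp (f1 _) (f1 _)
    have e2' := e2.imp (f2 _) (f2 _)
    simp only [Set.mem_compl_iff] at e1' e2'
    have := hr.cover x
    have := hr.cover y
    clear f1 f2 e1 e2 hz hc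
    grind

/-- The separation that cuts off the component of a vertex on the left of `p`. -/
theorem exists_component (hp : Is2Sep G p x y) (ha : a ∉ p.2) :
    ∃ s, Is2Sep G s x y ∧ a ∉ s.2 ∧ (G.induce s.2ᶜ).Connected ∧ SepLE s p := by
  -- The component of `a` in `G - {x, y}`, written as the union of all connected sets that contain
  -- `a` and avoid `x` and `y`.
  set K : Set V := {v | ∃ C : Set V, x ∉ C ∧ y ∉ C ∧ (G.induce C).Connected ∧ a ∈ C ∧ v ∈ C}
    with hKdef
  have hax : a ≠ x := by
    rintro rfl
    exact ha hp.x_mem.2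
  have hay : a ≠ y := by
    rintro rfl
    exact ha hp.y_mem.2
  have haK : a ∈ K := by
    refine ⟨{a}, fun h => hax h.symm, fun h => hay h.symm, ?_, rfl, rfl⟩
    refine connected_induce_of_closed (a := a) rfl fun X _ h _ => ?_
    simpa using h
  have hKc : (G.induce K).Connected := by
    refine connected_induce_of_closed haK fun X _ h hcl => ?_
    rintro v ⟨C, h1, h2, h3, h4, h5⟩
    exact subset_of_adj_closed h3 (fun b _ hbX w hw hbw =>
      hcl b hbX w ⟨C, h1, h2, h3, h4, hw⟩ hbw) h4 h h5
  have hKx : x ∉ K := fun ⟨C, h1, h2, h3, h4, h5⟩ => h1 h5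
  have hKy : y ∉ K := fun ⟨C, h1, h2, h3, h4, h5⟩ => h2 h5
  have hKp : K ⊆ p.2ᶜ := by
    rcases hp.subset_side hKc hKx hKy with h | h
    · exact h
    · exact absurd ((hp.cover a).resolve_right ha) (h haK)
  have hsep : Is2Sep G (K ∪ {x, y}, Kᶜ) x y := by
    refine ⟨fun v => ?_, fun v => ?_, hp.ne, ⟨a, fun h => h haK⟩, ?_, ?_⟩
    · by_cases hv : v ∈ K <;> simp [hv]
    · by_cases hv : v ∈ K
      · have : v ≠ x := fun h => hKx (h ▸ hv)
        have : v ≠ y := fun h => hKy (h ▸ hv)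
        simp [*]
      · simp [hv]
    · obtain ⟨b, hb⟩ := hp.right
      refine ⟨b, ?_⟩
      rintro (h | rfl | h)
      · exact hb ((hp.cover b).resolve_right (hKp h))
      · exact hb hp.x_mem.1
      · exact hb (by rw [Set.mem_singleton_iff.1 h]; exact hp.y_mem.1)
    · intro v w hv hw hvw
      simp only [Set.mem_compl_iff, not_not] at hv
      simp only [Set.mem_union, Set.mem_insert_iff, Set.mem_singleton_iff, not_or] at hw
      obtain ⟨C, h1, h2, h3, h4, h5⟩ := hv
      refine hw.1 ⟨insert w C, ?_, ?_, ?_, Or.inr h4, Or.inl rfl⟩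
      · rintro (h | h)
        exacts [hw.2.1 h.symm, h1 h]
      · rintro (h | h)
        exacts [hw.2.2 h.symm, h2 h]
      · refine connected_induce_of_closed (a := a) (Or.inr h4) fun X _ haX hcl => ?_
        have hCX : C ⊆ X := subset_of_adj_closed h3
          (fun b _ hbX c hc hbc => hcl b hbX c (Or.inr hc) hbc) h4 haX
        exact Set.insert_subset (hcl v (hCX h5) w (Or.inl rfl) hvw) hCX
  refine ⟨_, hsep, fun h => h haK, by rwa [compl_compl], ?_⟩
  refine nested_of_subset_compl hp hsep (by simpa using hKp) hp.x_mem.1 hp.y_mem.1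

end Is2Sep

end

section

/-! ### The tree of a nested set of separations -/

theorem exists_sepLE_maximal {T : Set (Set V × Set V)} (hT : T.Finite) (hne : T.Nonempty) :
    ∃ m ∈ T, ∀ r ∈ T, SepLE m r → r = m := by
  obtain ⟨m, hm, hmax⟩ := Set.Finite.exists_maximalFor
    (fun p : Set V × Set V => (p.1, OrderDual.toDual p.2)) T hT hne
  exact ⟨m, hm, fun r hr h => SepLE.antisymm (hmax hr h) h⟩

/-- A nested set of separations in which every separation has only finitely many others below
it that separate a given vertex. -/
structure IsTreeSet (N : Set (Set V × Set V)) : Prop where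
  swap_mem : ∀ s ∈ N, s.swap ∈ N
  nested : ∀ s ∈ N, ∀ r ∈ N, Nested s r
  cover : ∀ s ∈ N, ∀ v, v ∈ s.1 ∨ v ∈ s.2
  left : ∀ s ∈ N, ∃ v, v ∉ s.2
  fin : ∀ m ∈ N, ∀ v, {s ∈ N | SepLE s m ∧ v ∉ s.2}.Finite

/-- The consistent orientations of `N` that become nodes of the tree. -/
structure IsNode (N O : Set (Set V × Set V)) : Prop where
  sub : O ⊆ N
  total : ∀ s ∈ N, s ∈ O ∨ s.swap ∈ O
  anti : ∀ s ∈ O, s.swap ∉ O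
  down : ∀ r ∈ N, ∀ s ∈ O, SepLE r s → r ∈ O
  fin : ∀ r ∈ N, {s ∈ O | SepLE r s}.Finite

/-- `m` is a maximal element of `O`. -/
def IsMaxIn (O : Set (Set V × Set V)) (m : Set V × Set V) : Prop :=
  m ∈ O ∧ ∀ r ∈ O, SepLE m r → r = m

namespace IsTreeSet

variable {N O O' : Set (Set V × Set V)} {s r m : Set V × Set V}

theorem not_sepLE_both (hN : IsTreeSet N) (hs : s ∈ N) (hr : r ∈ N) (h : SepLE s r) :
    ¬ SepLE s r.swap := by
  intro h'
  obtain ⟨v, hv⟩ := hN.left s hs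
  have hv1 := (hN.cover s hs v).resolve_right hv
  rcases hN.cover r hr v with h1 | h1
  · exact hv (h'.2 h1)
  · exact hv (h.2 h1)

theorem not_sepLE_swap (hN : IsTreeSet N) (hs : s ∈ N) : ¬ SepLE s s.swap :=
  hN.not_sepLE_both hs hs (SepLE.refl s)

theorem ne_swap (hN : IsTreeSet N) (hs : s ∈ N) : s ≠ s.swap := fun h =>
  hN.not_sepLE_swap hs (by rw [← h]; exact SepLE.refl s)

/-- The fourth case of nestedness, `s.swap ≤ r`, is excluded by consistency: it would put `s.swap`
into `O` as well. -/
theorem node_cases (hN : IsTreeSet N) (hO : IsNode N O) (hs : s ∈ O) (hr : r ∈ O) :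
    SepLE s r ∨ SepLE r s ∨ SepLE s r.swap := by
  rcases hN.nested s (hO.sub hs) r (hO.sub hr) with h | h | h | h
  · exact Or.inl h
  · exact Or.inr (Or.inr h)
  · exact absurd (hO.down _ (hN.swap_mem s (hO.sub hs)) r hr h) (hO.anti s hs)
  · exact Or.inr (Or.inl h.swap)

theorem finite_interval (hN : IsTreeSet N) (hr : r ∈ N) (hm : m ∈ N) :
    {s ∈ N | SepLE r s ∧ SepLE s m}.Finite := by
  obtain ⟨v, hv⟩ := hN.left r hr
  exact (hN.fin m hm v).subset fun s hs => ⟨hs.1, hs.2.2, fun h => hv (hs.2.1.2 h)⟩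

theorem exists_isMaxIn (hO : IsNode N O) (hs : s ∈ O) : ∃ m, IsMaxIn O m ∧ SepLE s m := by
  obtain ⟨m, hm, hmax⟩ := exists_sepLE_maximal (hO.fin s (hO.sub hs)) ⟨s, hs, SepLE.refl s⟩
  exact ⟨m, ⟨hm.1, fun r hr h => hmax r ⟨hr, hm.2.trans h⟩ h⟩, hm.2⟩

/-- This is the end of the tree edge belonging to `m` at which `m` is maximal. By nestedness every
separation has an orientation below `m` or below `m.swap`; only `m.swap` itself is left out. -/
theorem isNode_of_mem (hN : IsTreeSet N) (hm : m ∈ N) :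
    IsNode N {r ∈ N | SepLE r m ∨ (SepLE r m.swap ∧ r ≠ m.swap)} := by
  have hms := hN.swap_mem m hm
  refine ⟨fun r hr => hr.1, fun s hs => ?_, ?_, ?_, fun r hr => ?_⟩
  · have hss := hN.swap_mem s hs
    rcases hN.nested s hs m hm with h | h | h | h
    · exact Or.inl ⟨hs, Or.inl h⟩
    · by_cases he : s = m.swap
      · right
        subst he
        exact ⟨hss, Or.inl (SepLE.refl m)⟩
      · exact Or.inl ⟨hs, Or.inr ⟨h, he⟩⟩
    · exact Or.inr ⟨hss, Or.inl h⟩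
    · by_cases he : s.swap = m.swap
      · left
        rw [Prod.swap_injective he]
        exact ⟨hm, Or.inl (SepLE.refl m)⟩
      · exact Or.inr ⟨hss, Or.inr ⟨h, he⟩⟩
  · rintro s ⟨hs, h⟩ ⟨hs', h'⟩
    rcases h with h | ⟨h, hne⟩ <;> rcases h' with h' | ⟨h', hne'⟩
    · exact hN.not_sepLE_swap hms (h'.swap.trans h)
    · exact hne' (by rw [h.antisymm h'.swap])
    · refine hne (h.antisymm ?_)
      exact h'.swap
    · exact hN.not_sepLE_swap hm (h'.swap.trans h)
  · rintro r hr s ⟨hs, h | ⟨h, hne⟩⟩ hrs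
    · exact ⟨hr, Or.inl (hrs.trans h)⟩
    · refine ⟨hr, Or.inr ⟨hrs.trans h, ?_⟩⟩
      rintro rfl
      exact hne (h.antisymm hrs)
  · refine ((hN.finite_interval hr hm).union (hN.finite_interval hr hms)).subset ?_
    rintro s ⟨⟨hs, h | h⟩, hrs⟩
    · exact Or.inl ⟨hs, hrs, h⟩
    · exact Or.inr ⟨hs, hrs, h.1⟩

theorem isMaxIn_of_mem (hN : IsTreeSet N) (hm : m ∈ N) :
    IsMaxIn {r ∈ N | SepLE r m ∨ (SepLE r m.swap ∧ r ≠ m.swap)} m := by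
  refine ⟨⟨hm, Or.inl (SepLE.refl m)⟩, ?_⟩
  rintro r ⟨hr, h | h⟩ hmr
  · exact h.antisymm hmr
  · exact absurd (hmr.trans h.1) (hN.not_sepLE_swap hm)

theorem exists_node (hN : IsTreeSet N) : ∃ O, IsNode N O := by
  rcases N.eq_empty_or_nonempty with rfl | ⟨m, hm⟩
  · exact ⟨∅, by constructor <;> simp⟩
  · exact ⟨_, hN.isNode_of_mem hm⟩

/-- A node is determined by any one of its maximal members: each other member lies below `m` or
below `m.swap`, and maximality of `m` in `O'` forces the same orientation there. -/
theorem subset_of_isMaxIn (hN : IsTreeSet N) (hO : IsNode N O) (hO' : IsNode N O')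
    (h : IsMaxIn O m) (h' : IsMaxIn O' m) : O ⊆ O' := by
  intro r hr
  have hrN := hO.sub hr
  rcases hN.node_cases hO hr h.1 with h1 | h1 | h1
  · exact hO'.down r hrN m h'.1 h1
  · rw [h.2 r hr h1]
    exact h'.1
  · refine (hO'.total r hrN).resolve_right fun h2 => ?_
    refine hO.anti r hr ?_
    rw [h'.2 _ h2 h1.swap]
    exact h.1

/-- `hup` and `hch` keep the new orientation consistent, and finiteness of `F` keeps the finiteness
condition. Reversing one maximal member gives the tree edges; reversing all members that point away
from a finite vertex set gives a bag containing it. -/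
theorem isNode_flip (hN : IsTreeSet N) (hO : IsNode N O) {F : Set (Set V × Set V)} (hF : F.Finite)
    (hFO : F ⊆ O) (hup : ∀ s ∈ F, ∀ r ∈ O, SepLE s r → r ∈ F)
    (hch : ∀ s ∈ F, ∀ r ∈ F, ¬ SepLE s r.swap) :
    IsNode N {s ∈ N | (s ∈ O ∧ s ∉ F) ∨ s.swap ∈ F} := by
  refine ⟨fun s hs => hs.1, fun s hs => ?_, ?_, ?_, fun r hr => ?_⟩
  · have hss := hN.swap_mem s hs
    by_cases h1 : s ∈ F
    · exact Or.inr ⟨hss, Or.inr h1⟩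
    by_cases h2 : s.swap ∈ F
    · exact Or.inl ⟨hs, Or.inr h2⟩
    · exact (hO.total s hs).imp (fun h => ⟨hs, Or.inl ⟨h, h1⟩⟩) fun h => ⟨hss, Or.inl ⟨h, h2⟩⟩
  · rintro s ⟨hs, h⟩ ⟨hs', h'⟩
    rw [Prod.swap_swap] at h'
    rcases h with h | h <;> rcases h' with h' | h'
    · exact hO.anti s h.1 h'.1
    · exact h.2 h'
    · exact h'.2 h
    · exact hO.anti s (hFO h') (hFO h)
  · rintro r hr s ⟨hs, h | h⟩ hrs
    · exact ⟨hr, Or.inl ⟨hO.down r hr s h.1 hrs, fun hrF => h.2 (hup r hrF s h.1 hrs)⟩⟩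
    · refine ⟨hr, ?_⟩
      rcases hO.total r hr with h1 | h1
      · exact Or.inl ⟨h1, fun hrF => hch r hrF _ h hrs⟩
      · exact Or.inr (hup _ h _ h1 hrs.swap)
  · refine ((hO.fin r hr).union (hF.image Prod.swap)).subset ?_
    rintro s ⟨⟨hs, h | h⟩, hrs⟩
    · exact Or.inl ⟨h.1, hrs⟩
    · exact Or.inr ⟨_, h, rfl⟩

theorem exists_flip (hN : IsTreeSet N) (hO : IsNode N O) (hm : IsMaxIn O m) :
    ∃ O', IsNode N O' ∧ O \ O' = {m} ∧ ∀ s ∈ O', s = m.swap ∨ s ∈ O := by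
  have hmN := hO.sub hm.1
  refine ⟨_, hN.isNode_flip (F := {m}) hO (Set.finite_singleton m)
    (Set.singleton_subset_iff.2 hm.1) ?_ ?_, ?_, ?_⟩
  · rintro s rfl r hr h
    exact hm.2 r hr h
  · rintro s rfl r rfl
    exact hN.not_sepLE_swap hmN
  · ext s
    simp only [Set.mem_sdiff, Set.mem_ofPred_eq, Set.mem_singleton_iff, not_and]
    constructor
    · rintro ⟨h1, h2⟩
      by_contra hne
      exact h2 (hO.sub h1) (Or.inl ⟨h1, hne⟩)
    · rintro rfl
      refine ⟨hm.1, fun _ h => ?_⟩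
      rcases h with h | h
      · exact h.2 rfl
      · exact hN.ne_swap hmN h.symm
  · rintro s ⟨hs, h | h⟩
    · exact Or.inr h.1
    · left
      rw [← Set.mem_singleton_iff.1 h, Prod.swap_swap]

theorem swap_mem_of_diff (hO : IsNode N O) (hO' : IsNode N O') (h : s ∈ O \ O') :
    s.swap ∈ O' \ O :=
  ⟨(hO'.total s (hO.sub h.1)).resolve_left h.2, hO.anti s h.1⟩

theorem diff_swap (hO : IsNode N O) (hO' : IsNode N O') (h : O \ O' = {m}) :
    O' \ O = {m.swap} := by
  ext s
  rw [Set.mem_singleton_iff]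
  constructor
  · intro hs
    have := swap_mem_of_diff hO' hO hs
    rw [h, Set.mem_singleton_iff] at this
    rw [← this, Prod.swap_swap]
  · rintro rfl
    exact swap_mem_of_diff hO hO' (by rw [h]; rfl)

theorem isMaxIn_of_diff (hO : IsNode N O) (hO' : IsNode N O') (h : O \ O' = {m}) :
    IsMaxIn O m := by
  have hm : m ∈ O \ O' := by rw [h]; rfl
  refine ⟨hm.1, fun r hr hmr => ?_⟩
  have : r ∈ O \ O' := ⟨hr, fun h' => hm.2 (hO'.down m (hO.sub hm.1) r h' hmr)⟩
  rwa [h] at this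

/-- Compare with a fixed `s₀` in the difference. Members above `s₀` are finite in number by the
condition on `O`, and those below `s₀` become, after reversal, members of `O'` above `s₀.swap`. A
member below `s₀.swap` would belong to `O'`. -/
theorem finite_diff (hN : IsTreeSet N) (hO : IsNode N O) (hO' : IsNode N O') :
    (O \ O').Finite := by
  rcases (O \ O').eq_empty_or_nonempty with h | ⟨s₀, h₀⟩
  · rw [h]
    exact Set.finite_empty
  have h₀' := swap_mem_of_diff hO hO' h₀
  refine ((hO.fin s₀ (hO.sub h₀.1)).union
    ((hO'.fin s₀.swap (hO'.sub h₀'.1)).image Prod.swap)).subset fun s hs => ?_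
  rcases hN.node_cases hO hs.1 h₀.1 with h | h | h
  · exact Or.inr ⟨s.swap, ⟨(swap_mem_of_diff hO hO' hs).1, h.swap⟩, Prod.swap_swap s⟩
  · exact Or.inl ⟨hs.1, h⟩
  · exact absurd (hO'.down s (hO.sub hs.1) _ h₀'.1 h) hs.2

/-- Every finite set that no separation separates lies in the bag of some node. -/
theorem exists_node_of_finite (hN : IsTreeSet N) (hO : IsNode N O) {U : Set V} (hU : U.Finite)
    (hUN : ∀ s ∈ N, U ⊆ s.1 ∨ U ⊆ s.2) :
    ∃ O', IsNode N O' ∧ (∀ s ∈ O', U ⊆ s.2) ∧ ∀ s ∈ O, U ⊆ s.2 → s ∈ O' := by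
  have hU1 : ∀ s ∈ N, ¬ U ⊆ s.2 → U ⊆ s.1 := fun s hs h => (hUN s hs).resolve_right h
  have hF : {s ∈ O | ¬ U ⊆ s.2}.Finite := by
    -- Relative to one such `s₀`, members above it are controlled by the finiteness of the node, and
    -- members below it that have `u` strictly on the left by the finiteness of `N`. A member below
    -- `s₀.swap` would force `u ∈ s₀.2`.
    have : ∀ u ∈ U, {s ∈ O | u ∉ s.2}.Finite := by
      intro u _
      rcases Set.eq_empty_or_nonempty {s ∈ O | u ∉ s.2} with h | ⟨s₀, h₀, hu₀⟩
      · rw [h]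
        exact Set.finite_empty
      refine ((hO.fin s₀ (hO.sub h₀)).union (hN.fin s₀ (hO.sub h₀) u)).subset ?_
      rintro s ⟨hs, hu⟩
      rcases hN.node_cases hO hs h₀ with h | h | h
      · exact Or.inr ⟨hO.sub hs, h, hu⟩
      · exact Or.inl ⟨hs, h⟩
      · exact absurd (h.1 ((hN.cover s (hO.sub hs) u).resolve_right hu)) hu₀
    refine (hU.biUnion this).subset ?_
    rintro s ⟨hs, hsU⟩
    obtain ⟨u, hu, hus⟩ := Set.not_subset.1 hsU
    exact Set.mem_biUnion hu ⟨hs, hus⟩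
  refine ⟨_, hN.isNode_flip (F := {s ∈ O | ¬ U ⊆ s.2}) hO hF (fun s hs => hs.1) ?_ ?_, ?_, ?_⟩
  · rintro s ⟨hs, hsU⟩ r hr h
    exact ⟨hr, fun hrU => hsU (hrU.trans h.2)⟩
  · rintro s ⟨hs, hsU⟩ r ⟨hr, hrU⟩ h
    exact hrU ((hU1 s (hO.sub hs) hsU).trans h.1)
  · rintro s ⟨hs, h | h⟩
    · by_contra hsU
      exact h.2 ⟨h.1, hsU⟩
    · exact (hUN s hs).resolve_left h.2
  · exact fun s hs hsU => ⟨hO.sub hs, Or.inl ⟨hs, fun h => h.2 hsU⟩⟩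

end IsTreeSet

/-- The graph on the nodes of `N` in which two nodes are adjacent if they differ by the
orientation of exactly one separation. -/
def nodeGraph (N : Set (Set V × Set V)) : SimpleGraph {O // IsNode N O} where
  Adj O O' := ∃ m, O.1 \ O'.1 = {m}
  symm := ⟨by
    rintro O O' ⟨m, hm⟩
    exact ⟨m.swap, IsTreeSet.diff_swap O.2 O'.2 hm⟩⟩
  loopless := ⟨by
    rintro O ⟨m, hm⟩
    rw [Set.sdiff_self] at hm
    exact Set.singleton_ne_empty m hm.symm⟩

/-- The vertices on the right side of all separations of an orientation. -/
def nodeBag {N : Set (Set V × Set V)} (O : {O // IsNode N O}) : Set V := {v | ∀ s ∈ O.1, v ∈ s.2}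

namespace IsTreeSet

variable {N : Set (Set V × Set V)} {s r m : Set V × Set V}

theorem node_ext (hN : IsTreeSet N) {O O' : {O // IsNode N O}} (h : IsMaxIn O.1 m)
    (h' : IsMaxIn O'.1 m) : O = O' :=
  Subtype.ext ((hN.subset_of_isMaxIn O.2 O'.2 h h').antisymm (hN.subset_of_isMaxIn O'.2 O.2 h' h))

/-- `hS` is a convexity condition. Reversing a maximal member of `O \ O'` moves `O` one step closer
to `O'` without leaving `S`. The same lemma serves for the whole tree, for one side of an edge, and
for the nodes whose bags contain a given vertex. -/
theorem connected_induce_nodeGraph (hN : IsTreeSet N) {S : Set {O // IsNode N O}}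
    (hne : S.Nonempty)
    (hS : ∀ O ∈ S, ∀ O' ∈ S, ∀ O₁ : {O // IsNode N O}, O₁.1 ⊆ O.1 ∪ O'.1 → O₁ ∈ S) :
    ((nodeGraph N).induce S).Connected := by
  have : Nonempty S := hne.to_subtype
  refine ⟨?_⟩
  have key : ∀ (n : ℕ) (O O' : S), (O.1.1 \ O'.1.1).ncard = n →
      ((nodeGraph N).induce S).Reachable O O' := by
    intro n
    induction n with
    | zero =>
      intro O O' h
      rw [Set.ncard_eq_zero (hN.finite_diff O.1.2 O'.1.2), Set.sdiff_eq_empty] at h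
      have : O = O' := by
        refine Subtype.ext (Subtype.ext (h.antisymm fun s hs => ?_))
        exact (O.1.2.total s (O'.1.2.sub hs)).resolve_right fun h' => O'.1.2.anti s hs (h h')
      rw [this]
    | succ n ih =>
      intro O O' h
      have hfin := hN.finite_diff O.1.2 O'.1.2
      have hne' : (O.1.1 \ O'.1.1).Nonempty := by
        rw [← Set.ncard_pos hfin, h]
        exact Nat.succ_pos n
      obtain ⟨m, hm, hmax⟩ := exists_sepLE_maximal hfin hne'
      -- Maximality in `O \ O'` is maximality in `O`, because `O \ O'` is closed upwards in `O`.
      have hmO : IsMaxIn O.1.1 m := ⟨hm.1, fun r hr hmr => hmax r ⟨hr, fun h' =>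
        hm.2 (O'.1.2.down m (O.1.2.sub hm.1) r h' hmr)⟩ hmr⟩
      obtain ⟨O₁, hO₁, hd, hO₁s⟩ := hN.exists_flip O.1.2 hmO
      have hmO' := (swap_mem_of_diff O.1.2 O'.1.2 hm).1
      have hmem : (⟨O₁, hO₁⟩ : {O // IsNode N O}) ∈ S := by
        refine hS _ O.2 _ O'.2 _ fun s hs => ?_
        rcases hO₁s s hs with rfl | h'
        · exact Or.inr hmO'
        · exact Or.inl h'
      have hadj : ((nodeGraph N).induce S).Adj O ⟨⟨O₁, hO₁⟩, hmem⟩ := ⟨m, hd⟩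
      refine hadj.reachable.trans (ih ⟨⟨O₁, hO₁⟩, hmem⟩ O' ?_)
      have : O₁ \ O'.1.1 = (O.1.1 \ O'.1.1) \ {m} := by
        ext s
        constructor
        · rintro ⟨h1, h2⟩
          rcases hO₁s s h1 with rfl | h'
          · exact absurd hmO' h2
          · refine ⟨⟨h', h2⟩, ?_⟩
            rintro rfl
            have : s ∈ O.1.1 \ O₁ := by rw [hd]; rfl
            exact this.2 h1
        · rintro ⟨⟨h1, h2⟩, h3⟩
          refine ⟨?_, h2⟩
          by_contra h4
          have : s ∈ O.1.1 \ O₁ := ⟨h1, h4⟩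
          rw [hd] at this
          exact h3 this
      change (O₁ \ O'.1.1).ncard = n
      rw [this, Set.ncard_sdiff_singleton_of_mem hm, h]
      rfl
  exact fun O O' => key _ O O' rfl

/-- Each separation is reversed along only one tree edge: `m` is maximal at one end and `m.swap` at
the other, and these determine both ends. -/
theorem eq_edge_of_adj (hN : IsTreeSet N) {O O' O₁ O₂ : {O // IsNode N O}}
    (h : O.1 \ O'.1 = {m}) (hadj : (nodeGraph N).Adj O₁ O₂) (h₁ : m ∈ O₁.1) (h₂ : m ∉ O₂.1) :
    O₁ = O ∧ O₂ = O' := by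
  obtain ⟨m', hm'⟩ := hadj
  have : m ∈ O₁.1 \ O₂.1 := ⟨h₁, h₂⟩
  rw [hm'] at this
  obtain rfl := Set.mem_singleton_iff.1 this
  exact ⟨hN.node_ext (isMaxIn_of_diff O₁.2 O₂.2 hm') (isMaxIn_of_diff O.2 O'.2 h),
    hN.node_ext (isMaxIn_of_diff O₂.2 O₁.2 (diff_swap O₁.2 O₂.2 hm'))
      (isMaxIn_of_diff O'.2 O.2 (diff_swap O.2 O'.2 h))⟩

theorem mem_of_reachable (hN : IsTreeSet N) {O O' O₁ : {O // IsNode N O}}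
    (h : O.1 \ O'.1 = {m}) (hr : ((nodeGraph N).deleteEdges {s(O, O')}).Reachable O O₁) :
    m ∈ O₁.1 := by
  have key : ∀ (P Q) (_ : ((nodeGraph N).deleteEdges {s(O, O')}).Walk P Q), m ∈ P.1 → m ∈ Q.1 := by
    intro P Q w
    induction w with
    | nil => exact id
    | @cons a b c hab _ ih =>
      intro hP
      rw [deleteEdges_adj] at hab
      refine ih ?_
      by_contra hb
      obtain ⟨rfl, rfl⟩ := hN.eq_edge_of_adj h hab.1 hP hb
      exact hab.2 rfl
  obtain ⟨w⟩ := hr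
  have hm : m ∈ O.1 \ O'.1 := by rw [h]; rfl
  exact key _ _ w hm.1

/-- The nodes containing `m` form a convex set, which is connected and does not use the edge `OO'`
since `m ∉ O'`. With `mem_of_reachable` this identifies one component of the tree minus that edge.
-/
theorem reachable_of_mem (hN : IsTreeSet N) {O O' O₁ : {O // IsNode N O}}
    (h : O.1 \ O'.1 = {m}) (hm₁ : m ∈ O₁.1) :
    ((nodeGraph N).deleteEdges {s(O, O')}).Reachable O O₁ := by
  have hm : m ∈ O.1 \ O'.1 := by rw [h]; rfl
  have hc : ((nodeGraph N).induce {P | m ∈ P.1}).Connected := by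
    refine hN.connected_induce_nodeGraph ⟨O, hm.1⟩ fun P hP Q hQ R hR => ?_
    refine (R.2.total m (O.2.sub hm.1)).resolve_right fun h' => ?_
    exact (hR h').elim (P.2.anti m hP) (Q.2.anti m hQ)
  let f : (nodeGraph N).induce {P | m ∈ P.1} →g (nodeGraph N).deleteEdges {s(O, O')} :=
    ⟨Subtype.val, fun {a b} hab => by
      rw [deleteEdges_adj]
      refine ⟨hab, fun he => ?_⟩
      rcases Sym2.eq_iff.1 (Set.mem_singleton_iff.1 he) with ⟨_, h2⟩ | ⟨h2, _⟩
      · exact hm.2 (h2 ▸ b.2)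
      · exact hm.2 (h2 ▸ a.2)⟩
  exact (hc.preconnected ⟨O, hm.1⟩ ⟨O₁, hm₁⟩).map f

theorem isTree_nodeGraph (hN : IsTreeSet N) : (nodeGraph N).IsTree := by
  obtain ⟨O, hO⟩ := hN.exists_node
  have hne : Nonempty {O // IsNode N O} := ⟨⟨O, hO⟩⟩
  refine ⟨⟨fun P Q => ?_⟩, ?_⟩
  · have := hN.connected_induce_nodeGraph (S := Set.univ) ⟨⟨O, hO⟩, trivial⟩
      fun _ _ _ _ _ _ => trivial
    exact (this.preconnected ⟨P, trivial⟩ ⟨Q, trivial⟩).map ⟨Subtype.val, fun h => h⟩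
  · rw [isAcyclic_iff_forall_adj_isBridge]
    rintro P Q ⟨m, hm⟩
    rw [isBridge_iff]
    intro hr
    have hmP : m ∈ P.1 \ Q.1 := by rw [hm]; rfl
    exact hmP.2 (hN.mem_of_reachable hm hr)

theorem edgeSide_eq (hN : IsTreeSet N) {O O' : {O // IsNode N O}} (h : O.1 \ O'.1 = {m}) :
    edgeSide (nodeGraph N) nodeBag O O' = m.2 := by
  have hm : m ∈ O.1 \ O'.1 := by rw [h]; rfl
  ext v
  simp only [edgeSide, Set.mem_iUnion, Set.mem_ofPred_eq, exists_prop]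
  constructor
  · rintro ⟨P, hP, hv⟩
    exact hv m (hN.mem_of_reachable h hP)
  · intro hv
    -- Turning `O` towards `v` keeps every member that already has `v` on its right, in particular
    -- `m`; so the node found lies on the side of `O`.
    obtain ⟨P, hP, h1, h2⟩ := hN.exists_node_of_finite O.2 (Set.finite_singleton v)
      fun s hs => by simpa using hN.cover s hs v
    exact ⟨⟨P, hP⟩, hN.reachable_of_mem h (h2 m hm.1 (by simpa using hv)),
      fun s hs => by simpa using h1 s hs⟩

theorem inducedSep_eq (hN : IsTreeSet N) {d : (nodeGraph N).Dart} (h : d.fst.1 \ d.snd.1 = {m}) :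
    inducedSep (nodeGraph N) nodeBag d = m.swap := by
  rw [inducedSep, hN.edgeSide_eq h, hN.edgeSide_eq (diff_swap d.fst.2 d.snd.2 h)]
  rfl

theorem induces (hN : IsTreeSet N) : Induces N (nodeGraph N) nodeBag := by
  refine ⟨fun d _ => ?_, fun d _ d' _ hdd => ?_, fun s hs => ?_⟩
  · obtain ⟨m, hm⟩ := d.adj
    rw [hN.inducedSep_eq hm]
    have : m ∈ d.fst.1 \ d.snd.1 := by rw [hm]; rfl
    exact hN.swap_mem m (d.fst.2.sub this.1)
  · obtain ⟨m, hm⟩ := d.adj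
    obtain ⟨m', hm'⟩ := d'.adj
    rw [hN.inducedSep_eq hm, hN.inducedSep_eq hm'] at hdd
    obtain rfl := Prod.swap_injective hdd
    refine Dart.ext _ _ (Prod.ext ?_ ?_)
    · exact hN.node_ext (isMaxIn_of_diff d.fst.2 d.snd.2 hm)
        (isMaxIn_of_diff d'.fst.2 d'.snd.2 hm')
    · exact hN.node_ext
        (isMaxIn_of_diff d.snd.2 d.fst.2 (diff_swap d.fst.2 d.snd.2 hm))
        (isMaxIn_of_diff d'.snd.2 d'.fst.2 (diff_swap d'.fst.2 d'.snd.2 hm'))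
  · have hO := hN.isNode_of_mem (hN.swap_mem s hs)
    obtain ⟨O', hO', hd, -⟩ := hN.exists_flip hO (hN.isMaxIn_of_mem (hN.swap_mem s hs))
    refine ⟨⟨(⟨_, hO⟩, ⟨O', hO'⟩), ⟨_, hd⟩⟩, trivial, ?_⟩
    rw [hN.inducedSep_eq (m := s.swap) hd, Prod.swap_swap]

theorem isTreeDecomposition (hN : IsTreeSet N) {G : SimpleGraph V}
    (hadj : ∀ s ∈ N, ∀ v w, G.Adj v w → v ∈ s.1 ∧ w ∈ s.1 ∨ v ∈ s.2 ∧ w ∈ s.2) :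
    IsTreeDecomposition G (nodeGraph N) nodeBag := by
  obtain ⟨O, hO⟩ := hN.exists_node
  have hv : ∀ v : V, ∃ t : {O // IsNode N O}, v ∈ nodeBag t := by
    intro v
    obtain ⟨P, hP, h1, -⟩ := hN.exists_node_of_finite hO (Set.finite_singleton v)
      fun s hs => by simpa using hN.cover s hs v
    exact ⟨⟨P, hP⟩, fun s hs => by simpa using h1 s hs⟩
  refine ⟨hN.isTree_nodeGraph, hv, fun v w hvw => ?_, fun v => ?_⟩
  · obtain ⟨P, hP, h1, -⟩ := hN.exists_node_of_finite hO (U := {v, w}) (Set.toFinite _)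
      fun s hs => by simpa [Set.insert_subset_iff] using hadj s hs v w hvw
    exact ⟨⟨P, hP⟩, fun s hs => h1 s hs (by simp), fun s hs => h1 s hs (by simp)⟩
  · refine hN.connected_induce_nodeGraph (hv v) fun P hP Q hQ R hR s hs => ?_
    exact (hR hs).elim (hP s) (hQ s)

/-- Every other member of `O` lies below `m` or `m.swap`, hence has the separator of `m` on its
right; `O'` differs from `O` only in the orientation of `m`. -/
theorem nodeBag_inter (hN : IsTreeSet N) {O O' : {O // IsNode N O}} (h : O.1 \ O'.1 = {m}) :
    nodeBag O ∩ nodeBag O' = m.1 ∩ m.2 := by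
  have hm : m ∈ O.1 \ O'.1 := by rw [h]; rfl
  have hm' := swap_mem_of_diff O.2 O'.2 hm
  have hmax := isMaxIn_of_diff O.2 O'.2 h
  have hO : m.1 ∩ m.2 ⊆ nodeBag O := by
    rintro v ⟨hv1, hv2⟩ s hs
    rcases hN.node_cases O.2 hs hm.1 with h1 | h1 | h1
    · exact h1.2 hv2
    · rwa [hmax.2 s hs h1]
    · exact h1.2 hv1
  ext v
  constructor
  · rintro ⟨h1, h2⟩
    exact ⟨h2 _ hm'.1, h1 _ hm.1⟩
  · intro hv
    refine ⟨hO hv, fun s hs => ?_⟩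
    by_cases hsO : s ∈ O.1
    · exact hO hv s hsO
    · have : s ∈ O'.1 \ O.1 := ⟨hs, hsO⟩
      rw [diff_swap O.2 O'.2 h] at this
      rw [Set.mem_singleton_iff.1 this]
      exact hv.1

end IsTreeSet

theorem isTreeSet_totallyNested {G : SimpleGraph V} (hG : IsKConnected G 2) :
    IsTreeSet (totallyNested2Seps G) where
  swap_mem _ hs := swap_mem_totallyNested hs
  nested _ hs r hr := hs.2 r hr.1
  cover _ hs := by
    obtain ⟨x, y, h⟩ := exists_is2Sep_of_mem hs
    exact h.cover
  left _ hs := by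
    obtain ⟨x, y, h⟩ := exists_is2Sep_of_mem hs
    exact h.left
  fin _ hm v := finite_totallyNested_below hG hm v

end

section

/-! ### Recognising cycles and single edges -/

section Recognise

variable {W : Type u} {H : SimpleGraph W}

theorem isCycleGraph_of_isCycle {x : W} (C : H.Walk x x) (hC : C.IsCycle)
    (hE : ∀ a b, H.Adj a b → s(a, b) ∈ C.edges) (hV : ∀ a, ∃ b, H.Adj a b) : IsCycleGraph H := by
  obtain ⟨m, hm⟩ : ∃ m, C.length = m + 3 := ⟨C.length - 3, by have := hC.three_le_length; omega⟩
  -- At the last index, addition in `Fin` wraps around to zero, which is correct because the closed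
  -- walk ends where it starts.
  have hsucc : ∀ i : Fin (m + 3), C.getVert (i + 1 : Fin (m + 3)).val = C.getVert (i.val + 1) := by
    intro i
    rw [Fin.val_add_one]
    split_ifs with h
    · have : i.val + 1 = C.length := by rw [h, hm]; simp
      rw [this, C.getVert_length, C.getVert_zero]
    · rfl
  have hinj : Function.Injective fun i : Fin (m + 3) => C.getVert i.val := by
    intro i j hij
    exact Fin.ext (hC.getVert_injOn' (by simp; omega) (by simp; omega) hij)
  have hedge : ∀ a b, H.Adj a b → ∃ i : Fin (m + 3),
      s(C.getVert i.val, C.getVert (i + 1 : Fin (m + 3)).val) = s(a, b) := by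
    intro a b hab
    obtain ⟨i, hi, h⟩ := C.mk_mem_edges_iff_exists.1 (hE a b hab)
    exact ⟨⟨i, by omega⟩, by rw [hsucc]; exact h⟩
  have hsurj : Function.Surjective fun i : Fin (m + 3) => C.getVert i.val := by
    intro a
    obtain ⟨b, hab⟩ := hV a
    obtain ⟨i, hi⟩ := hedge a b hab
    rcases Sym2.eq_iff.1 hi with h | h
    · exact ⟨i, h.1⟩
    · exact ⟨i + 1, h.2⟩
  have hadj : ∀ i : Fin (m + 3), H.Adj (C.getVert i.val) (C.getVert (i + 1 : Fin (m + 3)).val) := by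
    intro i
    rw [hsucc]
    exact C.adj_getVert_succ (by omega)
  refine ⟨m, ⟨⟨Equiv.ofBijective _ ⟨hinj, hsurj⟩, ?_⟩⟩⟩
  intro i j
  change H.Adj (C.getVert i.val) (C.getVert j.val) ↔ _
  rw [cycleGraph_adj, sub_eq_iff_eq_add', sub_eq_iff_eq_add']
  constructor
  · intro h
    obtain ⟨k, hk⟩ := hedge _ _ h
    rcases Sym2.eq_iff.1 hk with h' | h'
    · right
      rw [← hinj h'.1, ← hinj h'.2]
    · left
      rw [← hinj h'.1, ← hinj h'.2]
  · rintro (rfl | rfl)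
    · exact (hadj j).symm
    · exact hadj i

theorem isCycleGraph_of_card_eq_three (hH : IsKConnected H 2) (h3 : ENat.card W = 3) :
    IsCycleGraph H := by
  have hfin : Finite W := by
    rw [← ENat.card_lt_top, h3]
    exact ENat.natCast_lt_top 3
  have hc : Nat.card W = 3 := by
    have h := ENat.card_eq_coe_natCard W
    rw [h3] at h
    exact_mod_cast h.symm
  let e : W ≃ Fin 3 := (Nat.equivFinOfCardPos (by omega)).trans (finCongr hc)
  refine ⟨0, ⟨⟨e.symm, ?_⟩⟩⟩
  intro i j
  change H.Adj _ _ ↔ (cycleGraph 3).Adj i j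
  rw [cycleGraph_three_eq_top, top_adj]
  constructor
  · rintro h rfl
    exact h.ne rfl
  · intro hij
    obtain ⟨c, hci, hcj⟩ := hH.exists_notMem_pair (e.symm i) (e.symm j)
    obtain ⟨z, hzc, hz⟩ := hH.exists_adj_ne hci.symm
    have : z = e.symm j := by
      rw [Equiv.eq_symm_apply]
      have h1 : e z ≠ i := fun h => hz.ne (by rw [← h, e.symm_apply_apply])
      have h2 : e c ≠ i := fun h => hci (by rw [← h, e.symm_apply_apply])
      have h3 : e c ≠ j := fun h => hcj (by rw [← h, e.symm_apply_apply])
      have h4 : e z ≠ e c := fun h => hzc (e.injective h)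
      omega
    rwa [← this]

theorem IsCycleGraph.exists_ne (h : IsCycleGraph H) (x y : W) : ∃ a, a ≠ x ∧ a ≠ y := by
  obtain ⟨m, ⟨φ⟩⟩ := h
  by_contra! hcon
  have hcon' : ∀ a, a = x ∨ a = y := fun a => or_iff_not_imp_left.2 (hcon a)
  have e01 : φ ⟨0, by omega⟩ ≠ φ ⟨1, by omega⟩ := fun h => by simpa using φ.injective h
  have e02 : φ ⟨0, by omega⟩ ≠ φ ⟨2, by omega⟩ := fun h => by simpa using φ.injective h
  have e12 : φ ⟨1, by omega⟩ ≠ φ ⟨2, by omega⟩ := fun h => by simpa using φ.injective h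
  rcases hcon' (φ ⟨0, by omega⟩) with h0 | h0 <;> rcases hcon' (φ ⟨1, by omega⟩) with h1 | h1 <;>
    rcases hcon' (φ ⟨2, by omega⟩) with h2 | h2 <;>
    first
    | exact e01 (h0.trans h1.symm)
    | exact e02 (h0.trans h2.symm)
    | exact e12 (h1.trans h2.symm)

theorem isK2_of_pair {x y : W} (hxy : H.Adj x y) (h : ∀ a, a = x ∨ a = y) : IsK2 H := by
  let f : Fin 2 → W := ![x, y]
  have hf : Function.Bijective f := by
    constructor
    · intro i j hij
      have := hxy.ne
      fin_cases i <;> fin_cases j <;> simp_all [f]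
    · intro a
      rcases h a with rfl | rfl
      · exact ⟨0, rfl⟩
      · exact ⟨1, rfl⟩
  refine ⟨⟨Equiv.ofBijective f hf, ?_⟩⟩
  intro i j
  have := hxy.symm
  fin_cases i <;> fin_cases j <;> simp [f, *]

end Recognise

/-! ### Torsos -/

variable {G : SimpleGraph V}

theorem Is2Sep.exists_adj_left (hG : IsKConnected G 2) {p : Set V × Set V} {x y : V}
    (h : Is2Sep G p x y) : ∃ z, z ∉ p.2 ∧ G.Adj x z := by
  by_contra! hcon
  obtain ⟨a, ha⟩ := h.left
  have := subset_of_adj_closed (X := {x}) (h.connected_insert hG) (by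
    rintro v - rfl w hw hvw
    rcases hw with rfl | hw
    · rfl
    · exact absurd hvw (hcon w hw)) (Or.inl rfl) rfl (Or.inr ha)
  rw [Set.mem_singleton_iff.1 this] at ha
  exact ha h.x_mem.2

/-- The nodes of the tree of totally-nested 2-separations. -/
abbrev TNode (G : SimpleGraph V) := {O // IsNode (totallyNested2Seps G) O}

/-- The torso at a node. -/
abbrev nodeTorso (O : TNode G) : SimpleGraph (nodeBag O) :=
  torso G (nodeGraph (totallyNested2Seps G)) nodeBag O

variable {O : TNode G} {p q m m' : Set V × Set V} {x y u v : V}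

/-- The adhesion sets at `O` are the separators of its maximal members `m`. As the bag lies in
`m.2`, membership in `m.1` is enough. -/
theorem nodeTorso_adj_iff (hG : IsKConnected G 2) {a b : nodeBag O} : (nodeTorso O).Adj a b ↔
    a ≠ b ∧ (G.Adj a b ∨ ∃ m, IsMaxIn O.1 m ∧ (a : V) ∈ m.1 ∧ (b : V) ∈ m.1) := by
  have hN := isTreeSet_totallyNested hG
  refine and_congr_right fun _ => or_congr_right ?_
  constructor
  · rintro ⟨O', ⟨m, hm⟩, ha, hb⟩
    have hm' : O.1 \ O'.1 = {m} := hm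
    rw [hN.nodeBag_inter hm'] at ha hb
    exact ⟨m, IsTreeSet.isMaxIn_of_diff O.2 O'.2 hm', ha.1, hb.1⟩
  · rintro ⟨m, hm, ha, hb⟩
    obtain ⟨O', hO', hd, -⟩ := hN.exists_flip O.2 hm
    refine ⟨⟨O', hO'⟩, ⟨m, hd⟩, ?_⟩
    rw [hN.nodeBag_inter (O' := ⟨O', hO'⟩) hd]
    exact ⟨⟨ha, a.2 m hm.1⟩, ⟨hb, b.2 m hm.1⟩⟩

theorem subset_of_isMaxIn_ne (hG : IsKConnected G 2) (hm : IsMaxIn O.1 m) (hm' : IsMaxIn O.1 m')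
    (hne : m ≠ m') : m.1 ⊆ m'.2 := by
  rcases (isTreeSet_totallyNested hG).node_cases O.2 hm.1 hm'.1 with h | h | h
  · exact absurd (hm.2 m' hm'.1 h).symm hne
  · exact absurd (hm'.2 m hm.1 h) hne
  · exact h.1

theorem eq_of_notMem (hG : IsKConnected G 2) (hm : IsMaxIn O.1 m) (hm' : IsMaxIn O.1 m')
    (hv : v ∉ m.2) (hv' : v ∉ m'.2) : m = m' := by
  by_contra hne
  obtain ⟨x, y, h⟩ := exists_is2Sep_of_mem (O.2.sub hm.1)
  exact hv' (subset_of_isMaxIn_ne hG hm hm' hne ((h.cover v).resolve_right hv))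

/-- With `eq_of_notMem`: the strict left sides of the maximal members partition the complement of
the bag. -/
theorem exists_isMaxIn_of_notMem_nodeBag (hv : v ∉ nodeBag O) : ∃ m, IsMaxIn O.1 m ∧ v ∉ m.2 := by
  have : ∃ s ∈ O.1, v ∉ s.2 := by
    by_contra! h
    exact hv h
  obtain ⟨s, hs, hvs⟩ := this
  obtain ⟨m, hm, hsm⟩ := IsTreeSet.exists_isMaxIn O.2 hs
  exact ⟨m, hm, fun h => hvs (hsm.2 h)⟩

theorem mem_nodeBag_of_separator (hG : IsKConnected G 2) (hm : IsMaxIn O.1 m)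
    (hv : v ∈ m.1 ∧ v ∈ m.2) : v ∈ nodeBag O := by
  by_contra h
  obtain ⟨m', hm', hv'⟩ := exists_isMaxIn_of_notMem_nodeBag h
  by_cases hne : m = m'
  · subst hne
    exact hv' hv.2
  · exact hv' (subset_of_isMaxIn_ne hG hm hm' hne hv.1)

/-- The strict left side of each maximal member `m` is contracted onto one separator vertex `f m`.
The other separator vertex has a neighbour in that side, which realises the virtual edge. -/
theorem isMinor_nodeTorso (hG : IsKConnected G 2) (O : TNode G) : IsMinor (nodeTorso O) G := by
  have : ∀ m, ∃ x, IsMaxIn O.1 m → ∃ y, Is2Sep G m x y := by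
    intro m
    by_cases hm : IsMaxIn O.1 m
    · obtain ⟨x, y, h⟩ := exists_is2Sep_of_mem (O.2.sub hm.1)
      exact ⟨x, fun _ => ⟨y, h⟩⟩
    · obtain ⟨z⟩ := (hG.2 ∅ (by simp)).nonempty
      exact ⟨z, fun h => absurd h hm⟩
  choose f hf using this
  refine ⟨fun w => insert (w : V) {v | ∃ m, IsMaxIn O.1 m ∧ f m = w ∧ v ∉ m.2}, ?_, ?_, ?_⟩
  · intro w
    refine connected_induce_of_closed (a := (w : V)) (Or.inl rfl) fun X _ hw hcl => ?_
    rintro v (rfl | ⟨m, hm, hmw, hv⟩)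
    · exact hw
    · obtain ⟨y, hy⟩ := hf m hm
      rw [hmw] at hy
      refine subset_of_adj_closed (hy.connected_insert hG) ?_ (Or.inl rfl) hw (Or.inr hv)
      intro a _ haX b hb hab
      exact hcl a haX b (hb.imp id fun hb => ⟨m, hm, hmw, hb⟩) hab
  · intro w w' hne
    rw [Set.disjoint_left]
    rintro v (rfl | ⟨m, hm, hmw, hv⟩) (h | ⟨m', hm', hmw', hv'⟩)
    · exact hne (Subtype.ext h)
    · exact hv' (w.2 m' hm'.1)
    · subst h
      exact hv (w'.2 m hm.1)
    · obtain rfl := eq_of_notMem hG hm hm' hv hv'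
      exact hne (Subtype.ext (hmw.symm.trans hmw'))
  · intro w w' hadj
    obtain ⟨hne, h | ⟨m, hm, h1, h2⟩⟩ := (nodeTorso_adj_iff hG).1 hadj
    · exact ⟨w, Or.inl rfl, w', Or.inl rfl, h⟩
    · obtain ⟨y, hy⟩ := hf m hm
      have hne' : (w : V) ≠ w' := fun h => hne (Subtype.ext h)
      obtain ⟨z, hz, hyz⟩ := hy.comm.exists_adj_left hG
      rcases (hy.mem_iff w).1 ⟨h1, w.2 m hm.1⟩ with hw | hw
      · rcases (hy.mem_iff w').1 ⟨h2, w'.2 m hm.1⟩ with hw' | hw'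
        · exact absurd (hw.trans hw'.symm) hne'
        · exact ⟨z, Or.inr ⟨m, hm, hw.symm, hz⟩, w', Or.inl rfl, by rw [hw']; exact hyz.symm⟩
      · rcases (hy.mem_iff w').1 ⟨h2, w'.2 m hm.1⟩ with hw' | hw'
        · exact ⟨w, Or.inl rfl, z, Or.inr ⟨m, hm, hw'.symm, hz⟩, by rw [hw]; exact hyz⟩
        · exact absurd (hw.trans hw'.symm) hne'

/-- A cut of the torso lifts to a cut of the graph. -/
theorem exists_lift_of_cut (hG : IsKConnected G 2) {P Q : Set (nodeBag O)}
    (hPQ : ∀ a, a ∈ P ∨ a ∈ Q) (hno : ∀ a b, a ∉ Q → b ∉ P → ¬ (nodeTorso O).Adj a b) :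
    ∃ A B : Set V, (∀ v, v ∈ A ∨ v ∈ B) ∧ (∀ v, v ∈ A → v ∈ B → v ∈ nodeBag O) ∧
      (∀ a : nodeBag O, ((a : V) ∈ A ↔ a ∈ P) ∧ ((a : V) ∈ B ↔ a ∈ Q)) ∧
      ∀ v w, v ∉ B → w ∉ A → ¬ G.Adj v w := by
  -- An adhesion set is a clique of the torso, so it lies entirely in `P` or entirely in `Q`.
  -- Everything hanging behind it is put on the same side; `g m` records the choice of `P`.
  set g : Set V × Set V → Prop := fun m => ∀ a : nodeBag O, (a : V) ∈ m.1 → a ∈ P with hg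
  have hg' : ∀ m, IsMaxIn O.1 m → ¬ g m → ∀ a : nodeBag O, (a : V) ∈ m.1 → a ∈ Q := by
    intro m hm hgm a ha
    simp only [hg] at hgm
    push Not at hgm
    obtain ⟨b, hb, hbP⟩ := hgm
    by_contra haQ
    refine hno a b haQ hbP ((nodeTorso_adj_iff hG).2 ⟨?_, Or.inr ⟨m, hm, ha, hb⟩⟩)
    rintro rfl
    exact (hPQ a).elim hbP haQ
  have hbag : ∀ (a : nodeBag O) m, IsMaxIn O.1 m → (a : V) ∈ m.2 := fun a m hm => a.2 m hm.1
  have hside : ∀ m, IsMaxIn O.1 m → ∀ v w, v ∉ m.2 → G.Adj v w → w ∈ m.1 := by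
    intro m hm v w hv hvw
    obtain ⟨x, y, h⟩ := exists_is2Sep_of_mem (O.2.sub hm.1)
    by_contra hw
    exact h.not_adj v w hv hw hvw
  have hPm : ∀ (a : nodeBag O) , (a : V) ∈ {v | (∃ h : v ∈ nodeBag O, (⟨v, h⟩ : nodeBag O) ∈ P) ∨
      ∃ m, IsMaxIn O.1 m ∧ v ∉ m.2 ∧ g m} ↔ a ∈ P := by
    intro a
    constructor
    · rintro (⟨_, h⟩ | ⟨m, hm, h, _⟩)
      · exact h
      · exact absurd (hbag a m hm) h
    · exact fun h => Or.inl ⟨a.2, h⟩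
  have hQm : ∀ (a : nodeBag O) , (a : V) ∈ {v | (∃ h : v ∈ nodeBag O, (⟨v, h⟩ : nodeBag O) ∈ Q) ∨
      ∃ m, IsMaxIn O.1 m ∧ v ∉ m.2 ∧ ¬ g m} ↔ a ∈ Q := by
    intro a
    constructor
    · rintro (⟨_, h⟩ | ⟨m, hm, h, _⟩)
      · exact h
      · exact absurd (hbag a m hm) h
    · exact fun h => Or.inl ⟨a.2, h⟩
  refine ⟨_, _, fun v => ?_, fun v hvA hvB => ?_, fun a => ⟨hPm a, hQm a⟩, ?_⟩
  · by_cases hv : v ∈ nodeBag O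
    · exact (hPQ ⟨v, hv⟩).imp (fun h => Or.inl ⟨hv, h⟩) fun h => Or.inl ⟨hv, h⟩
    · obtain ⟨m, hm, hvm⟩ := exists_isMaxIn_of_notMem_nodeBag hv
      by_cases h : g m
      · exact Or.inl (Or.inr ⟨m, hm, hvm, h⟩)
      · exact Or.inr (Or.inr ⟨m, hm, hvm, h⟩)
  · rcases hvA with ⟨h, -⟩ | ⟨m, hm, hvm, hgm⟩
    · exact h
    · rcases hvB with ⟨h, -⟩ | ⟨m', hm', hvm', hgm'⟩
      · exact h
      · obtain rfl := eq_of_notMem hG hm hm' hvm hvm'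
        exact absurd hgm hgm'
  · intro v w hv hw hvw
    by_cases hvb : v ∈ nodeBag O
    · have hvQ : (⟨v, hvb⟩ : nodeBag O) ∉ Q := fun h => hv ((hQm ⟨v, hvb⟩).2 h)
      by_cases hwb : w ∈ nodeBag O
      · have hwP : (⟨w, hwb⟩ : nodeBag O) ∉ P := fun h => hw ((hPm ⟨w, hwb⟩).2 h)
        exact hno _ _ hvQ hwP ((nodeTorso_adj_iff hG).2
          ⟨fun h => hvw.ne (congrArg Subtype.val h), Or.inl hvw⟩)
      · obtain ⟨m, hm, hwm⟩ := exists_isMaxIn_of_notMem_nodeBag hwb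
        have hgm : ¬ g m := fun h => hw (Or.inr ⟨m, hm, hwm, h⟩)
        exact hvQ (hg' m hm hgm _ (hside m hm w v hwm hvw.symm))
    · obtain ⟨m, hm, hvm⟩ := exists_isMaxIn_of_notMem_nodeBag hvb
      have hgm : g m := by
        by_contra h
        exact hv (Or.inr ⟨m, hm, hvm, h⟩)
      by_cases hwm : w ∈ m.2
      · have hwb := mem_nodeBag_of_separator hG hm ⟨hside m hm v w hvm hvw, hwm⟩
        exact hw (Or.inl ⟨hwb, hgm _ (hside m hm v w hvm hvw)⟩)
      · exact hw (Or.inr ⟨m, hm, hwm, hgm⟩)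

theorem exists_cut_of_not_connected_nodeTorso (hG : IsKConnected G 2) {S : Set (nodeBag O)}
    (hS : (Sᶜ).Nonempty) (h : ¬ ((nodeTorso O).induce Sᶜ).Connected) :
    ∃ A B : Set V, (∀ v, v ∈ A ∨ v ∈ B) ∧ (∀ v, (v ∈ A ∧ v ∈ B) ↔ v ∈ Subtype.val '' S) ∧
      (∃ v ∈ nodeBag O, v ∉ B) ∧ (∃ v ∈ nodeBag O, v ∉ A) ∧
      ∀ v w, v ∉ B → w ∉ A → ¬ G.Adj v w := by
  obtain ⟨X, hXS, ⟨a, ha⟩, ⟨b, hb, hbX⟩, hno⟩ := exists_cut_of_not_connected hS h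
  obtain ⟨A, B, h1, h2, h3, h4⟩ := exists_lift_of_cut hG (O := O) (P := X ∪ S) (Q := Xᶜ) (by
    intro c
    by_cases hc : c ∈ X
    · exact Or.inl (Or.inl hc)
    · exact Or.inr hc) (by
    intro c d hc hd
    rw [Set.mem_compl_iff, not_not] at hc
    rw [Set.mem_union, not_or] at hd
    exact hno c hc d ⟨hd.2, hd.1⟩)
  refine ⟨A, B, h1, fun v => ?_, ⟨a, a.2, ?_⟩, ⟨b, b.2, ?_⟩, h4⟩
  · constructor
    · rintro ⟨hA, hB⟩
      have hv := h2 v hA hB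
      have hvP := (h3 ⟨v, hv⟩).1.1 hA
      have hvQ := (h3 ⟨v, hv⟩).2.1 hB
      exact ⟨⟨v, hv⟩, hvP.resolve_left hvQ, rfl⟩
    · rintro ⟨c, hc, rfl⟩
      exact ⟨(h3 c).1.2 (Or.inr hc), (h3 c).2.2 fun hcX => hXS hcX hc⟩
  · intro haB
    exact (h3 a).2.1 haB ha
  · intro hbA
    exact ((h3 b).1.1 hbA).elim hbX hb

theorem compl_nonempty_of_encard_lt {W : Type u} {S : Set W} (h : S.encard < ENat.card W) :
    (Sᶜ).Nonempty := by
  rw [Set.nonempty_compl]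
  rintro rfl
  rw [Set.encard_univ] at h
  exact lt_irrefl _ h

theorem isKConnected_two_nodeTorso (hG : IsKConnected G 2) (hc : 2 < ENat.card (nodeBag O)) :
    IsKConnected (nodeTorso O) 2 := by
  refine ⟨hc, fun S hS => ?_⟩
  by_contra h
  obtain ⟨A, B, h1, h2, ⟨a, -, ha⟩, ⟨b, -, hb⟩, h5⟩ := exists_cut_of_not_connected_nodeTorso hG
    (compl_nonempty_of_encard_lt (hS.trans hc)) h
  have hconn := hG.2 (Subtype.val '' S) (by
    rwa [Function.Injective.encard_image Subtype.val_injective])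
  have := subset_of_adj_closed (X := Bᶜ) hconn (by
    intro v _ hvB w hw hvw hwB
    refine h5 v w hvB (fun hwA => hw ((h2 w).1 ⟨hwA, hwB⟩)) hvw) (a := a)
    (fun h => ha ((h2 a).2 h).2) ha
  exact this (fun h => hb ((h2 b).2 h).1) ((h1 b).resolve_left hb)

end

section

variable {G : SimpleGraph V} {O : TNode G} {p q m m' : Set V × Set V} {x y u v : V}

/-! ### Torsos that are cycles -/

/-- `p` is a 2-separation of `G` whose separator is contained in the bag at `O` and that has
vertices of the bag strictly on both sides. -/
structure Splits (O : TNode G) (p : Set V × Set V) (x y : V) : Prop where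
  sep : Is2Sep G p x y
  x_mem : x ∈ nodeBag O
  y_mem : y ∈ nodeBag O
  left : ∃ a ∈ nodeBag O, a ∉ p.2
  right : ∃ a ∈ nodeBag O, a ∉ p.1

theorem Splits.swap (h : Splits O p x y) : Splits O p.swap x y :=
  ⟨h.sep.swap, h.x_mem, h.y_mem, h.right, h.left⟩

theorem Splits.comm (h : Splits O p x y) : Splits O p y x :=
  ⟨h.sep.comm, h.y_mem, h.x_mem, h.left, h.right⟩

theorem nodeBag_subset_or (O : TNode G) (hp : p ∈ totallyNested2Seps G) :
    (p ∈ O.1 ∧ nodeBag O ⊆ p.2) ∨ (p.swap ∈ O.1 ∧ nodeBag O ⊆ p.1) :=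
  (O.2.total p hp).imp (fun h => ⟨h, fun _ hv => hv p h⟩) fun h => ⟨h, fun _ hv => hv p.swap h⟩

theorem Is2Sep.inter (hp : Is2Sep G p x y) (hq : Is2Sep G q x y) (h : ∃ v, v ∉ p.2 ∧ v ∉ q.2) :
    Is2Sep G (p.1 ∩ q.1, p.2 ∪ q.2) x y := by
  have A := hp.mem_iff
  have B := hq.mem_iff
  have A' := hp.cover
  have B' := hq.cover
  obtain ⟨a, ha, ha'⟩ := h
  obtain ⟨b, hb⟩ := hp.right
  refine ⟨fun v => ?_, fun v => ?_, hp.ne, ⟨a, ?_⟩, ⟨b, fun h => hb h.1⟩, ?_⟩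
  · simp only [Set.mem_inter_iff, Set.mem_union]
    grind
  · simp only [Set.mem_inter_iff, Set.mem_union]
    grind
  · simp [ha, ha']
  · intro v w hv hw hvw
    simp only [Set.mem_inter_iff, Set.mem_union, not_or, not_and_or] at hv hw
    rcases hw with hw | hw
    · exact hp.not_adj v w hv.1 hw hvw
    · exact hq.not_adj v w hv.2 hw hvw

theorem Is2Sep.exists_notMem_of_cross (hp : Is2Sep G p x y) (hq : Is2Sep G q x y)
    (h : ¬ Nested p q) : ∃ v, v ∉ p.2 ∧ v ∉ q.2 := by
  by_contra! hcon
  refine h (Or.inr (Or.inl (Is2Sep.nested_of_subset_compl hq.swap hp (fun v hv hvq => ?_)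
    hq.x_mem.2 hq.y_mem.2)))
  rcases (hq.mem_iff v).1 ⟨hvq, hcon v hv⟩ with rfl | rfl
  · exact hv hp.x_mem.2
  · exact hv hp.y_mem.2

/-- A 2-separation that splits a bag is crossed by one whose separator is a different pair of
vertices of the bag. -/
theorem Splits.exists_cross (hG : IsKConnected G 2) (h : Splits O p x y) :
    ∃ q u v, Is2Sep G q u v ∧ u ∈ nodeBag O ∧ v ∈ nodeBag O ∧ u ∉ p.2 ∧ v ∉ p.1 ∧
      x ∉ q.2 ∧ y ∉ q.1 := by
  obtain ⟨a, haO, ha⟩ := h.left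
  obtain ⟨b, hbO, hb⟩ := h.right
  have hpN : p ∉ totallyNested2Seps G := fun hp =>
    (nodeBag_subset_or O hp).elim (fun h => ha (h.2 haO)) fun h => hb (h.2 hbO)
  have hq : ∃ q, IsKSep G 2 q ∧ ¬ Nested p q := by
    by_contra! hcon
    exact hpN ⟨h.sep.isKSep, hcon⟩
  obtain ⟨q, hq, hc⟩ := hq
  obtain ⟨u, v, hq⟩ := isKSep_two_iff.1 hq
  have rename : ∃ q u v, Is2Sep G q u v ∧ u ∉ p.2 ∧ v ∉ p.1 ∧ x ∉ q.2 ∧ y ∉ q.1 := by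
    rcases h.sep.cross_cases hG hq hc with hq' | ⟨h1, h2⟩
    · exfalso
      obtain ⟨s, hs, has, hK, hsp⟩ := h.sep.exists_component ha
      have hsN : s ∈ totallyNested2Seps G := by
        refine hs.mem_totallyNested_of_component hG hK fun v _ => ?_
        rcases hq'.cover v with hv | hv
        · exact ⟨_, h.sep.swap.inter hq'.swap
            (h.sep.swap.exists_notMem_of_cross hq'.swap fun h => hc h.swap_left.swap_right),
            Or.inr hv, fun w hw => Or.inl (hsp.1 hw)⟩
        · exact ⟨_, h.sep.swap.inter hq'
            (h.sep.swap.exists_notMem_of_cross hq' fun h => hc h.swap_left),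
            Or.inr hv, fun w hw => Or.inl (hsp.1 hw)⟩
      exact (nodeBag_subset_or O hsN).elim (fun h => has (h.2 haO))
        fun h => hb (hsp.1 (h.2 hbO))
    · rcases h1 with ⟨hu, hv⟩ | ⟨hu, hv⟩ <;> rcases h2 with ⟨hx, hy⟩ | ⟨hx, hy⟩
      · exact ⟨q.swap, v, u, hq.comm.swap, hv, hu, hx, hy⟩
      · exact ⟨q, v, u, hq.comm, hv, hu, hx, hy⟩
      · exact ⟨q.swap, u, v, hq.swap, hu, hv, hx, hy⟩
      · exact ⟨q, u, v, hq, hu, hv, hx, hy⟩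
  obtain ⟨q, u, v, hq, hu, hv, hx, hy⟩ := rename
  -- A member `m` of the node with `w` strictly on its left would, by nestedness with `q`, have
  -- `m.2` inside one side of `q`. But `m.2` contains `x` and `y`, which `q` separates strictly.
  have hbag : ∀ w, w ∈ q.1 ∧ w ∈ q.2 → w ∈ nodeBag O := by
    intro w hw m hm
    by_contra hwm
    rcases nested_of_mem (O.2.sub hm) hq with h' | h' | h' | h'
    · exact hwm (h'.2 hw.2)
    · exact hwm (h'.2 hw.1)
    · exact hy (h'.1 (h.y_mem m hm))
    · exact hx (h'.1 (h.x_mem m hm))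
  exact ⟨q, u, v, hq, hbag u hq.x_mem, hbag v hq.y_mem, hu, hv, hx, hy⟩

/-- Edges of a torso do not cross 2-separations. -/
theorem not_nodeTorso_adj_of_sides (hG : IsKConnected G 2) (hq : Is2Sep G q u v)
    {a b : nodeBag O} (ha : (a : V) ∉ q.2) (hb : (b : V) ∉ q.1) : ¬ (nodeTorso O).Adj a b := by
  intro hab
  obtain ⟨-, h | ⟨m, hm, h1, h2⟩⟩ := (nodeTorso_adj_iff hG).1 hab
  · exact hq.not_adj _ _ ha hb h
  · rcases nested_of_mem (O.2.sub hm.1) hq with h' | h' | h' | h'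
    · exact hb (h'.1 h2)
    · exact ha (h'.1 h1)
    · exact hb (h'.1 (b.2 m hm.1))
    · exact ha (h'.1 (a.2 m hm.1))

theorem sides_of_nodeTorso_adj (hG : IsKConnected G 2) (hq : Is2Sep G q u v) {a b : nodeBag O}
    (hab : (nodeTorso O).Adj a b) :
    ((a : V) ∈ q.1 ∧ (b : V) ∈ q.1) ∨ ((a : V) ∈ q.2 ∧ (b : V) ∈ q.2) := by
  have h1 := hq.cover a
  have h2 := hq.cover b
  have h3 : ¬ ((a : V) ∉ q.2 ∧ (b : V) ∉ q.1) := fun h =>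
    not_nodeTorso_adj_of_sides hG hq h.1 h.2 hab
  have h4 : ¬ ((b : V) ∉ q.2 ∧ (a : V) ∉ q.1) := fun h =>
    not_nodeTorso_adj_of_sides hG hq h.1 h.2 hab.symm
  tauto

theorem exists_walk_of_connected_induce {W : Type u} {H : SimpleGraph W} {K : Set W}
    (hK : (H.induce K).Connected) {a b : W} (ha : a ∈ K) (hb : b ∈ K) :
    ∃ P : H.Walk a b, ∀ w ∈ P.support, w ∈ K := by
  have key : ∀ (u v : K) (_ : (H.induce K).Walk u v),
      ∃ P : H.Walk u v, ∀ w ∈ P.support, w ∈ K := by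
    intro u v P
    induction P with
    | @nil u => exact ⟨Walk.nil, by simp⟩
    | @cons u c v huc P ih =>
      obtain ⟨Q, hQ⟩ := ih
      have huc' : H.Adj u c := huc
      refine ⟨Walk.cons huc' Q, ?_⟩
      simp only [Walk.support_cons, List.mem_cons]
      rintro w (rfl | hw)
      exacts [u.2, hQ w hw]
  obtain ⟨P⟩ := hK.preconnected ⟨a, ha⟩ ⟨b, hb⟩
  exact key _ _ P

/-- A walk in a torso across a 2-separation has an initial segment on one side that ends in
the separator. -/
theorem exists_initial_walk (hG : IsKConnected G 2) (hq : Is2Sep G q u v)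
    {c d : nodeBag O} (P : (nodeTorso O).Walk c d) (hc : (c : V) ∉ q.2) (hd : (d : V) ∉ q.1) :
    ∃ (z : nodeBag O) (W : (nodeTorso O).Walk c z), ((z : V) ∈ q.1 ∧ (z : V) ∈ q.2) ∧
      (∀ w ∈ W.support, (w : V) ∈ q.1) ∧ (∀ w ∈ W.support, w ∈ P.support) ∧
      (∀ e ∈ W.edges, e ∈ P.edges) ∧ W.length < P.length := by
  induction P with
  | nil => exact absurd (hq.cover _) (by tauto)
  | @cons a b d hab P ih =>
    have ha1 := (hq.cover a).resolve_right hc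
    have hb1 : (b : V) ∈ q.1 := by
      by_contra hb
      exact not_nodeTorso_adj_of_sides hG hq hc hb hab
    by_cases hb : (b : V) ∈ q.2
    · refine ⟨b, Walk.cons hab Walk.nil, ⟨hb1, hb⟩, ?_, ?_, ?_, ?_⟩
      · simp [ha1, hb1]
      · simp
      · simp
      · have : 0 < P.length := by
          rw [Nat.pos_iff_ne_zero]
          intro h0
          exact hd (Walk.eq_of_length_eq_zero h0 ▸ hb1)
        simpa using this
    · obtain ⟨z, W, h1, h2, h3, h4, h5⟩ := ih hb hd
      refine ⟨z, Walk.cons hab W, h1, ?_, ?_, ?_, ?_⟩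
      · simp only [Walk.support_cons, List.mem_cons]
        rintro w (rfl | hw)
        exacts [ha1, h2 w hw]
      · simp only [Walk.support_cons, List.mem_cons]
        exact fun w hw => hw.imp id (h3 w)
      · simp only [Walk.edges_cons, List.mem_cons]
        exact fun w hw => hw.imp id (h4 w)
      · simpa using h5

/-- One side of a bag split by a 2-separation is a path. -/
theorem Splits.mem_edges (hG : IsKConnected G 2) : ∀ (n : ℕ) (p : Set V × Set V)
    (x y : nodeBag O) (_ : Splits O p x y) (P : (nodeTorso O).Walk x y) (_ : P.length ≤ n)
    (_ : ∀ w ∈ P.support, (w : V) ∈ p.1) (a b : nodeBag O) (_ : (nodeTorso O).Adj a b)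
    (_ : (a : V) ∈ p.1) (_ : (b : V) ∈ p.1), s(a, b) ∈ P.edges := by
  intro n
  induction n using Nat.strong_induction_on with
  | _ n ih =>
  -- Edges on the `q.1` side of the crossing separation; the `q.2` side follows by reversing the
  -- walk. The walk must pass through `u`, since `v` is not in `p.1`, and its initial segment up to
  -- `u` is strictly shorter.
  have core : ∀ (p q : Set V × Set V) (x y : nodeBag O) (u v : V), Splits O p x y →
      Is2Sep G q u v → u ∈ nodeBag O → u ∉ p.2 → v ∉ p.1 → (x : V) ∉ q.2 → (y : V) ∉ q.1 →
      ∀ P : (nodeTorso O).Walk x y, P.length ≤ n → (∀ w ∈ P.support, (w : V) ∈ p.1) →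
      ∀ a b : nodeBag O, (nodeTorso O).Adj a b → (a : V) ∈ p.1 → (b : V) ∈ p.1 →
      (a : V) ∈ q.1 → (b : V) ∈ q.1 → s(a, b) ∈ P.edges := by
    intro p q x y u v hp hq huO hu hv hx hy P hPn hPp a b hab ha hb haq hbq
    obtain ⟨z, W, hz, hW1, hW2, hW3, hW4⟩ := exists_initial_walk hG hq P hx hy
    have hzu : (z : V) = u := by
      rcases (hq.mem_iff z).1 hz with h | h
      · exact h
      · exact absurd (hPp z (hW2 z W.end_mem_support)) (h ▸ hv)
    subst hzu
    refine hW3 _ ?_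
    -- If the corner contains a bag vertex, the corner separation with separator `{x, u}` splits the
    -- bag and induction applies. Otherwise `x` and `u` are the only bag vertices there, and the
    -- segment must use the edge between them.
    by_cases hex : ∃ w ∈ nodeBag O, w ∉ p.2 ∪ q.2
    · have A := hp.sep.mem_iff
      have B := hq.mem_iff
      have A' := hp.sep.cover
      have B' := hq.cover
      have hxp := hp.sep.x_mem
      have hr : Splits O (p.1 ∩ q.1, p.2 ∪ q.2) x z := by
        obtain ⟨w, hwO, hw⟩ := hex
        refine ⟨⟨fun w => ?_, fun w => ?_, ?_, ⟨w, hw⟩, ⟨y, fun h => hy h.2⟩, ?_⟩,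
          x.2, z.2, ⟨w, hwO, hw⟩, ⟨y, y.2, fun h => hy h.2⟩⟩
        · simp only [Set.mem_inter_iff, Set.mem_union]
          grind
        · have hzp := (A' z).resolve_right hu
          have hxq := (B' x).resolve_right hx
          simp only [Set.mem_inter_iff, Set.mem_union]
          constructor
          · rintro ⟨⟨h1, h2⟩, h3 | h3⟩
            · rcases (A w).1 ⟨h1, h3⟩ with rfl | rfl
              · exact Or.inl rfl
              · exact absurd h2 hy
            · rcases (B w).1 ⟨h2, h3⟩ with rfl | rfl
              · exact Or.inr rfl
              · exact absurd h1 hv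
          · rintro (rfl | rfl)
            · exact ⟨⟨hxp.1, hxq⟩, Or.inl hxp.2⟩
            · exact ⟨⟨hzp, hz.1⟩, Or.inr hz.2⟩
        · intro h
          exact hx (h ▸ hz.2)
        · intro c d hc hd hcd
          simp only [Set.mem_inter_iff, Set.mem_union, not_or, not_and_or] at hc hd
          rcases hd with hd | hd
          · exact hp.sep.not_adj c d hc.1 hd hcd
          · exact hq.not_adj c d hc.2 hd hcd
      exact ih W.length (lt_of_lt_of_le hW4 hPn) _ x z hr W le_rfl
        (fun w hw => ⟨hPp w (hW2 w hw), hW1 w hw⟩) a b hab ⟨ha, haq⟩ ⟨hb, hbq⟩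
    · push Not at hex
      have hxz : ∀ w : nodeBag O, (w : V) ∈ p.1 → (w : V) ∈ q.1 → w = x ∨ w = z := by
        intro w h1 h2
        rcases hex w w.2 with h3 | h3
        · rcases (hp.sep.mem_iff w).1 ⟨h1, h3⟩ with h4 | h4
          · exact Or.inl (Subtype.ext h4)
          · exact absurd h2 (h4 ▸ hy)
        · rcases (hq.mem_iff w).1 ⟨h2, h3⟩ with h4 | h4
          · exact Or.inr (Subtype.ext h4)
          · exact absurd h1 (h4 ▸ hv)
      have hne : x ≠ z := fun h => hx (h ▸ hz.2)
      have hmem : s(x, z) ∈ W.edges := by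
        cases W with
        | nil => exact absurd rfl hne
        | @cons _ d _ hd W' =>
          have hdW : d ∈ (Walk.cons hd W').support := by simp
          have : d = z := (hxz d (hPp d (hW2 d hdW)) (hW1 d hdW)).resolve_left hd.ne'
          subst this
          simp
      rcases hxz a ha haq with rfl | rfl <;> rcases hxz b hb hbq with rfl | rfl
      · exact absurd rfl hab.ne
      · exact hmem
      · rw [Sym2.eq_swap]
        exact hmem
      · exact absurd rfl hab.ne
  intro p x y hp P hPn hPp a b hab ha hb
  obtain ⟨q, u, v, hq, huO, hvO, hu, hv, hx, hy⟩ := hp.exists_cross hG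
  have hsides := sides_of_nodeTorso_adj hG hq hab
  rcases hsides with h | h
  · exact core p q x y u v hp hq huO hu hv hx hy P hPn hPp a b hab ha hb h.1 h.2
  · have := core p q.swap y x u v hp.comm hq.swap huO hu hv hy hx P.reverse
      (by rwa [Walk.length_reverse]) (fun w hw => hPp w (by simpa using hw)) a b hab ha hb h.1 h.2
    simpa using this

/-- `p` restricts to a 2-separation of the 2-connected torso, so its strict left side there is
connected with `x` as well as with `y`; two walks through `a` are joined and shortened to a path. -/
theorem Splits.exists_path (hG : IsKConnected G 2) (hc : 2 < ENat.card (nodeBag O))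
    {x y : nodeBag O} (h : Splits O p x y) : ∃ P : (nodeTorso O).Walk x y, P.IsPath ∧
      ∀ w ∈ P.support, (w : V) ∈ p.1 := by
  classical
  have hH := isKConnected_two_nodeTorso hG hc
  obtain ⟨a, haO, ha⟩ := h.left
  have hs : Is2Sep (nodeTorso O) (Subtype.val ⁻¹' p.1, Subtype.val ⁻¹' p.2) x y := by
    refine ⟨fun v => h.sep.cover v, fun v => ?_, fun e => h.sep.ne (congrArg Subtype.val e),
      ⟨⟨a, haO⟩, ha⟩, ?_, fun c d hc hd => not_nodeTorso_adj_of_sides hG h.sep hc hd⟩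
    · rw [Subtype.ext_iff, Subtype.ext_iff]
      exact h.sep.mem_iff v
    · obtain ⟨b, hbO, hb⟩ := h.right
      exact ⟨⟨b, hbO⟩, hb⟩
  have walk : ∀ x y : nodeBag O, Is2Sep (nodeTorso O)
      (Subtype.val ⁻¹' p.1, Subtype.val ⁻¹' p.2) x y →
      ∃ P : (nodeTorso O).Walk x ⟨a, haO⟩, ∀ w ∈ P.support, (w : V) ∈ p.1 := by
    intro x y hs
    obtain ⟨P, hP⟩ := exists_walk_of_connected_induce (hs.connected_insert hH) (a := x)
      (b := ⟨a, haO⟩) (Or.inl rfl) (Or.inr ha)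
    refine ⟨P, fun w hw => ?_⟩
    rcases hP w hw with rfl | h'
    · exact hs.x_mem.1
    · exact (h.sep.cover _).resolve_right h'
  obtain ⟨P, hP⟩ := walk x y hs
  obtain ⟨Q, hQ⟩ := walk y x hs.comm
  refine ⟨(P.append Q.reverse).bypass, Walk.bypass_isPath _, fun w hw => ?_⟩
  have := Walk.support_bypass_subset_support _ hw
  rw [Walk.mem_support_append_iff, Walk.support_reverse, List.mem_reverse] at this
  exact this.elim (hP w) (hQ w)

/-- The paths on the two sides share only their ends, and by `Splits.mem_edges` they contain all
edges. Since `x` and `y` are nonadjacent, the closed walk formed is a genuine cycle. -/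
theorem Splits.isCycleGraph (hG : IsKConnected G 2) (hc : 2 < ENat.card (nodeBag O))
    {x y : nodeBag O} (h : Splits O p x y) : IsCycleGraph (nodeTorso O) := by
  obtain ⟨P, hP, hPp⟩ := h.exists_path hG hc
  obtain ⟨Q, hQ, hQp⟩ := h.swap.comm.exists_path hG hc
  have hxy : ¬ (nodeTorso O).Adj x y := by
    obtain ⟨q, u, v, hq, -, -, -, -, hx, hy⟩ := h.exists_cross hG
    exact not_nodeTorso_adj_of_sides hG hq hx hy
  have hne : x ≠ y := fun e => h.sep.ne (congrArg Subtype.val e)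
  have hlen : 1 < P.length := by
    have h0 : P.length ≠ 0 := fun h0 => hne (Walk.eq_of_length_eq_zero h0)
    have h1 : P.length ≠ 1 := fun h1 => hxy (Walk.adj_of_length_eq_one h1)
    omega
  have hdisj : P.support.tail.Disjoint Q.support.tail := by
    intro w hwP hwQ
    rcases (h.sep.mem_iff w).1 ⟨hPp w (List.mem_of_mem_tail hwP),
      hQp w (List.mem_of_mem_tail hwQ)⟩ with hw | hw
    · obtain rfl := Subtype.ext hw
      have := hP.support_nodup
      rw [← Walk.cons_tail_support] at this
      exact (List.nodup_cons.1 this).1 hwP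
    · obtain rfl := Subtype.ext hw
      have := hQ.support_nodup
      rw [← Walk.cons_tail_support] at this
      exact (List.nodup_cons.1 this).1 hwQ
  refine isCycleGraph_of_isCycle (P.append Q) (hP.isCycle_append hQ hdisj (Or.inl hlen)) ?_ ?_
  · intro a b hab
    rw [Walk.edges_append, List.mem_append]
    have hsides := sides_of_nodeTorso_adj hG h.sep hab
    rcases hsides with h' | h'
    · exact Or.inl (Splits.mem_edges hG _ p x y h P le_rfl hPp a b hab h'.1 h'.2)
    · exact Or.inr (Splits.mem_edges hG _ p.swap y x h.swap.comm Q le_rfl hQp a b hab h'.1 h'.2)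
  · intro a
    obtain ⟨b, hb⟩ : ∃ b : nodeBag O, a ≠ b := by
      by_cases hax : a = x
      · exact ⟨y, hax ▸ hne⟩
      · exact ⟨x, hax⟩
    obtain ⟨z, -, hz⟩ := (isKConnected_two_nodeTorso hG hc).exists_adj_ne hb
    exact ⟨z, hz⟩

/-- A bag with at most two vertices is not all of `V`, so it is the separator of a maximal member. A
2-connected torso on three vertices is a triangle. On more vertices, a pair that disconnects the
torso lifts to a 2-separation that splits the bag. -/
theorem nodeTorso_cases (hG : IsKConnected G 2) (O : TNode G) :
    IsKConnected (nodeTorso O) 3 ∨ IsCycleGraph (nodeTorso O) ∨ IsK2 (nodeTorso O) := by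
  rcases le_or_gt (ENat.card (nodeBag O)) 2 with h2 | h2
  · right; right
    have hne : ∃ v, v ∉ nodeBag O := by
      by_contra! h
      have huniv : nodeBag O = Set.univ := Set.eq_univ_of_forall h
      have : ENat.card (nodeBag O) = ENat.card V := by
        rw [huniv]
        exact ENat.card_congr (Equiv.Set.univ V)
      exact absurd hG.1 (not_lt.2 (this ▸ h2))
    obtain ⟨v, hv⟩ := hne
    obtain ⟨m, hm, -⟩ := exists_isMaxIn_of_notMem_nodeBag hv
    obtain ⟨x, y, h⟩ := exists_is2Sep_of_mem (O.2.sub hm.1)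
    have hx := mem_nodeBag_of_separator hG hm h.x_mem
    have hy := mem_nodeBag_of_separator hG hm h.y_mem
    refine isK2_of_pair (x := ⟨x, hx⟩) (y := ⟨y, hy⟩) ((nodeTorso_adj_iff hG).2
      ⟨fun e => h.ne (congrArg Subtype.val e), Or.inr ⟨m, hm, h.x_mem.1, h.y_mem.1⟩⟩) fun a => ?_
    by_contra! hcon
    have h3 : ({a, ⟨x, hx⟩, ⟨y, hy⟩} : Set (nodeBag O)).encard = 3 :=
      Set.encard_eq_three.2 ⟨_, _, _, hcon.1, hcon.2,
        fun e => h.ne (congrArg Subtype.val e), rfl⟩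
    have h4 := Set.encard_le_encard (Set.subset_univ ({a, ⟨x, hx⟩, ⟨y, hy⟩} : Set (nodeBag O)))
    rw [h3, Set.encard_univ] at h4
    exact absurd (h4.trans h2) (by decide)
  rcases le_or_gt (ENat.card (nodeBag O)) 3 with h3 | h3
  · right; left
    exact isCycleGraph_of_card_eq_three (isKConnected_two_nodeTorso hG h2)
      (le_antisymm h3 (Order.add_one_le_of_lt h2))
  · by_cases hk : IsKConnected (nodeTorso O) 3
    · exact Or.inl hk
    right; left
    have hS : ∃ S : Set (nodeBag O), S.encard < 3 ∧ ¬ ((nodeTorso O).induce Sᶜ).Connected := by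
      by_contra! hcon
      exact hk ⟨h3, hcon⟩
    obtain ⟨S, hS3, hS⟩ := hS
    have hS2 : S.encard = 2 := by
      refine le_antisymm (Order.le_of_lt_add_one hS3) (not_lt.1 fun hlt => hS ?_)
      exact (isKConnected_two_nodeTorso hG h2).2 S hlt
    obtain ⟨x, y, hxy, rfl⟩ := Set.encard_eq_two.1 hS2
    obtain ⟨A, B, h4, h5, h6, h7, h8⟩ := exists_cut_of_not_connected_nodeTorso hG
      (compl_nonempty_of_encard_lt (hS3.trans h3)) hS
    have hsp : Splits O (A, B) x y := by
      refine ⟨⟨h4, fun v => (h5 v).trans ?_, fun e => hxy (Subtype.ext e), ?_, ?_, h8⟩,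
        x.2, y.2, h6, h7⟩
      · rw [Set.image_pair]
        rfl
      · obtain ⟨v, -, hv⟩ := h6
        exact ⟨v, hv⟩
      · obtain ⟨v, -, hv⟩ := h7
        exact ⟨v, hv⟩
    exact hsp.isCycleGraph hG h2

/-- If a bag contains a vertex outside a pair of vertices, then this pair is the separator of at
most one maximal separation of the node. -/
theorem isMaxIn_separator_unique (hG : IsKConnected G 2) (hm : IsMaxIn O.1 m)
    (hm' : IsMaxIn O.1 m') (h : Is2Sep G m x y) (h' : Is2Sep G m' x y) {a : V}
    (haO : a ∈ nodeBag O) (hax : a ≠ x) (hay : a ≠ y) : m = m' := by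
  by_contra hne
  have ham : ∀ n, IsMaxIn O.1 n → Is2Sep G n x y → a ∉ n.1 := fun n hn h h1 =>
    ((h.mem_iff a).1 ⟨h1, haO n hn.1⟩).elim hax hay
  obtain ⟨s, hs, has, hK, hsm⟩ := h.swap.exists_component (ham m hm h)
  have hKm' : s.2ᶜ ⊆ m'.1ᶜ := by
    rcases h'.subset_side hK (fun hx => hx hs.x_mem.2) (fun hy => hy hs.y_mem.2) with h1 | h1
    · exact absurd (haO m' hm'.1) (h1 has)
    · exact h1
  have hsm' : SepLE s m'.swap := Is2Sep.nested_of_subset_compl h'.swap hs hKm' h'.x_mem.2 h'.y_mem.2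
  -- Since `m` and `m'` point away from each other, every vertex lies on the right of one of them,
  -- and the strict left side of that one is the further part required. The bag then puts `s.swap`
  -- in `O`, above both `m` and `m'`, so both are equal to it.
  have hsN : s ∈ totallyNested2Seps G := by
    refine hs.mem_totallyNested_of_component hG hK fun v _ => ?_
    by_cases hv : v ∈ m.2
    · exact ⟨m, h, hv, hsm.1⟩
    · exact ⟨m', h', subset_of_isMaxIn_ne hG hm hm' hne ((h.cover v).resolve_right hv), hsm'.1⟩
  rcases nodeBag_subset_or O hsN with h1 | h1
  · exact has (h1.2 haO)
  · exact hne ((hm.2 _ h1.1 hsm.swap).symm.trans (hm'.2 _ h1.1 hsm'.swap))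

end

section

variable {G : SimpleGraph V} {p q : Set V × Set V} {u v a b a' b' c d c' d' : V}

/-! ### Mixed 2-separations -/

/-- The element `i` of the separator of `p` is the vertex `a = b` or the edge `ab`, with `a` on
the left and `b` on the right. -/
def Represents (G : SimpleGraph V) (p : Set V × Set V) (i : V ⊕ Sym2 V) (a b : V) : Prop :=
  (i = Sum.inl a ∧ a = b ∧ a ∈ p.1 ∧ a ∈ p.2) ∨
    (i = Sum.inr s(a, b) ∧ a ∉ p.2 ∧ b ∉ p.1 ∧ G.Adj a b)

theorem mem_separator_iff (hcov : ∀ v, v ∈ p.1 ∨ v ∈ p.2) {i : V ⊕ Sym2 V} :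
    i ∈ separator G p ↔ ∃ a b, Represents G p i a b := by
  constructor
  · rintro (⟨v, hv, rfl⟩ | ⟨e, ⟨x, hx, y, hy, hxy, rfl⟩, rfl⟩)
    · exact ⟨v, v, Or.inl ⟨rfl, rfl, hv.1, hv.2⟩⟩
    · exact ⟨x, y, Or.inr ⟨rfl, hx.2, hy.2, hxy⟩⟩
  · rintro ⟨a, b, ⟨rfl, rfl, h1, h2⟩ | ⟨rfl, h1, h2, h3⟩⟩
    · exact Or.inl ⟨a, ⟨h1, h2⟩, rfl⟩
    · exact Or.inr ⟨_, ⟨a, ⟨(hcov a).resolve_right h1, h1⟩, b, ⟨(hcov b).resolve_left h2, h2⟩,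
        h3, rfl⟩, rfl⟩

/-- `p` is a mixed 2-separation whose separator consists of the vertices or edges given by the
pairs `(a, b)` and `(a', b')`. -/
structure Rep (G : SimpleGraph V) (p : Set V × Set V) (a b a' b' : V) : Prop where
  cover : ∀ v, v ∈ p.1 ∨ v ∈ p.2
  left : ∃ v, v ∉ p.2
  right : ∃ v, v ∉ p.1
  pair : (a = b ∧ a ∈ p.1 ∧ a ∈ p.2) ∨ (a ∉ p.2 ∧ b ∉ p.1 ∧ G.Adj a b)
  pair' : (a' = b' ∧ a' ∈ p.1 ∧ a' ∈ p.2) ∨ (a' ∉ p.2 ∧ b' ∉ p.1 ∧ G.Adj a' b')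
  ne : ¬ (a = a' ∧ b = b')
  inter : ∀ v, v ∈ p.1 → v ∈ p.2 → (v = a ∧ v = b) ∨ (v = a' ∧ v = b')
  adj : ∀ v w, v ∉ p.2 → w ∉ p.1 → G.Adj v w → (v = a ∧ w = b) ∨ (v = a' ∧ w = b')

theorem Represents.pair {i : V ⊕ Sym2 V} (h : Represents G p i a b) :
    (a = b ∧ a ∈ p.1 ∧ a ∈ p.2) ∨ (a ∉ p.2 ∧ b ∉ p.1 ∧ G.Adj a b) :=
  h.imp (fun h => h.2) fun h => h.2

theorem Represents.eq_of_inl {i : V ⊕ Sym2 V} (h : Represents G p i a b) (hv : i = Sum.inl v) :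
    v = a ∧ v = b := by
  rcases h with ⟨h, rfl, -⟩ | ⟨h, -⟩
  · have := Sum.inl_injective (hv.symm.trans h)
    exact ⟨this, this⟩
  · simp [hv] at h

theorem Represents.eq_of_inr (hcov : ∀ v, v ∈ p.1 ∨ v ∈ p.2) {i : V ⊕ Sym2 V}
    (h : Represents G p i a b) (hv : i = Sum.inr s(u, v)) (hu : u ∉ p.2) : u = a ∧ v = b := by
  rcases h with ⟨h, -⟩ | ⟨h, h1, h2, -⟩
  · simp [hv] at h
  · have := Sum.inr_injective (hv.symm.trans h)
    rcases Sym2.eq_iff.1 this with h' | ⟨rfl, rfl⟩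
    · exact h'
    · exact absurd ((hcov u).resolve_right hu) h2

theorem Represents.rep {i j : V ⊕ Sym2 V} (hp : IsMixedSep p) (hij : i ≠ j)
    (hS : separator G p = {i, j}) (hi : Represents G p i a b) (hj : Represents G p j a' b') :
    Rep G p a b a' b' := by
  have hcov : ∀ v, v ∈ p.1 ∨ v ∈ p.2 := fun v => (Set.ext_iff.1 hp.1 v).2 trivial
  have hmem : ∀ k, k ∈ separator G p → k = i ∨ k = j := fun k hk => by rwa [hS] at hk
  refine ⟨hcov, hp.2.1.imp fun v hv => hv.2, hp.2.2.imp fun v hv => hv.2, hi.pair, hj.pair, ?_,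
    fun v h1 h2 => ?_, fun v w h1 h2 h3 => ?_⟩
  · rintro ⟨rfl, rfl⟩
    rcases hi with ⟨h1, h2, h3, h4⟩ | ⟨h1, h2, h3, h4⟩ <;>
      rcases hj with ⟨g1, g2, g3, g4⟩ | ⟨g1, g2, g3, g4⟩
    · exact hij (h1.trans g1.symm)
    · exact g2 h4
    · exact h2 g4
    · exact hij (h1.trans g1.symm)
  · exact (hmem _ ((mem_separator_iff hcov).2 ⟨v, v, Or.inl ⟨rfl, rfl, h1, h2⟩⟩)).imp
      (fun h => hi.eq_of_inl h.symm) fun h => hj.eq_of_inl h.symm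
  · exact (hmem _ ((mem_separator_iff hcov).2 ⟨v, w, Or.inr ⟨rfl, h1, h2, h3⟩⟩)).imp
      (fun h => hi.eq_of_inr hcov h.symm h1) fun h => hj.eq_of_inr hcov h.symm h1

namespace Rep

theorem swap (h : Rep G p a b a' b') : Rep G p.swap b a b' a' where
  cover v := (h.cover v).symm
  left := h.right
  right := h.left
  pair := h.pair.imp (fun ⟨h1, h2, h3⟩ => ⟨h1.symm, h1 ▸ h3, h1 ▸ h2⟩)
    fun ⟨h1, h2, h3⟩ => ⟨h2, h1, h3.symm⟩
  pair' := h.pair'.imp (fun ⟨h1, h2, h3⟩ => ⟨h1.symm, h1 ▸ h3, h1 ▸ h2⟩)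
    fun ⟨h1, h2, h3⟩ => ⟨h2, h1, h3.symm⟩
  ne := fun ⟨h1, h2⟩ => h.ne ⟨h2, h1⟩
  inter v h1 h2 := (h.inter v h2 h1).imp And.symm And.symm
  adj v w h1 h2 h3 := (h.adj w v h2 h1 h3.symm).imp And.symm And.symm

theorem comm (h : Rep G p a b a' b') : Rep G p a' b' a b where
  cover := h.cover
  left := h.left
  right := h.right
  pair := h.pair'
  pair' := h.pair
  ne := fun ⟨h1, h2⟩ => h.ne ⟨h1.symm, h2.symm⟩
  inter v h1 h2 := (h.inter v h1 h2).symm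
  adj v w h1 h2 h3 := (h.adj v w h1 h2 h3).symm

theorem mem_left (h : Rep G p a b a' b') : a ∈ p.1 := by
  have := h.cover a
  have := h.pair
  tauto

theorem mem_right (h : Rep G p a b a' b') : b ∈ p.2 := h.swap.mem_left

theorem eq_or_adj (h : Rep G p a b a' b') : a = b ∨ G.Adj a b :=
  h.pair.imp (fun h => h.1) fun h => h.2.2

/-- Deleting one end from each element of the separator disconnects the graph unless this deletes
an entire side. -/
theorem subset_pair_of_connected (h : Rep G p a b a' b') (hu : u = a ∨ u = b)
    (hv : v = a' ∨ v = b') (hc : (G.induce ({u, v}ᶜ : Set V)).Connected) :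
    (∀ w, w ∉ p.2 → w = u ∨ w = v) ∨ ∀ w, w ∉ p.1 → w = u ∨ w = v := by
  by_contra! hcon
  obtain ⟨⟨w, hw, hwu, hwv⟩, ⟨z, hz, hzu, hzv⟩⟩ := hcon
  have := subset_of_adj_closed (X := p.2ᶜ) hc (by
    intro s hs hs2 t ht hst ht2
    simp only [Set.mem_compl_iff, Set.mem_insert_iff, Set.mem_singleton_iff, not_or] at hs ht
    by_cases ht1 : t ∈ p.1
    · rcases h.inter t ht1 ht2 with ⟨h1, h2⟩ | ⟨h1, h2⟩
      · rcases hu with rfl | rfl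
        exacts [ht.1 h1, ht.1 h2]
      · rcases hv with rfl | rfl
        exacts [ht.2 h1, ht.2 h2]
    · rcases h.adj s t hs2 ht1 hst with ⟨h1, h2⟩ | ⟨h1, h2⟩
      · rcases hu with rfl | rfl
        exacts [hs.1 h1, ht.1 h2]
      · rcases hv with rfl | rfl
        exacts [hs.2 h1, ht.2 h2]) (a := w) (by simp [hwu, hwv]) hw
  exact this (by simp [hzu, hzv] : z ∈ ({u, v}ᶜ : Set V)) ((h.cover z).resolve_left hz)

/-- If the strict left side is inside `{u, v}` and contains `u`, say, then `u = a` and `b` is its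
only possible neighbour, against minimum degree two. -/
theorem not_subset_pair (hG : IsKConnected G 2) (h : Rep G p a b a' b') (hu : u = a ∨ u = b)
    (hv : v = a' ∨ v = b') (hne : u ≠ v) (hadj : ¬ G.Adj u v) :
    ¬ ∀ w, w ∉ p.2 → w = u ∨ w = v := by
  have core : ∀ {a b a' b' u v : V}, Rep G p a b a' b' → (u = a ∨ u = b) → (v = a' ∨ v = b') →
      u ≠ v → ¬ G.Adj u v → (∀ w, w ∉ p.2 → w = u ∨ w = v) → u ∈ p.2 := by
    intro a b a' b' u v h hu hv hne hadj hsub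
    by_contra hu2
    have hub : u ≠ b := by
      rintro rfl
      exact hu2 h.mem_right
    obtain rfl := hu.resolve_right hub
    obtain ⟨z, hzb, huz⟩ := hG.exists_adj_ne hub
    have hzv : z ≠ v := by
      rintro rfl
      exact hadj huz
    have hz2 : z ∈ p.2 := by
      by_contra hz2
      exact (hsub z hz2).elim huz.ne' hzv
    by_cases hz1 : z ∈ p.1
    · rcases h.inter z hz1 hz2 with h' | ⟨h1, h2⟩
      · exact hzb h'.2
      · exact hv.elim (fun h => hzv (h1.trans h.symm)) fun h => hzv (h2.trans h.symm)
    · rcases h.adj u z hu2 hz1 huz with h' | ⟨h1, h2⟩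
      · exact hzb h'.2
      · exact hv.elim (fun h => hne (h1.trans h.symm)) fun h => hzv (h2.trans h.symm)
  intro hsub
  obtain ⟨w, hw⟩ := h.left
  rcases hsub w hw with rfl | rfl
  · exact hw (core h hu hv hne hadj hsub)
  · exact hw (core h.comm hv hu hne.symm (fun h => hadj h.symm) fun w hw => (hsub w hw).symm)

/-- Two nonadjacent vertices taken from the two elements of the separator of a mixed
2-separation form the separator of a 2-separation. -/
theorem exists_is2Sep (hG : IsKConnected G 2) (h : Rep G p a b a' b') (hu : u = a ∨ u = b)
    (hv : v = a' ∨ v = b') (hne : u ≠ v) (hadj : ¬ G.Adj u v) : ∃ s, Is2Sep G s u v := by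
  refine exists_is2Sep_of_not_connected hG hne fun hc => ?_
  rcases h.subset_pair_of_connected hu hv hc with h' | h'
  · exact h.not_subset_pair hG hu hv hne hadj h'
  · exact h.swap.not_subset_pair hG hu.symm hv.symm hne hadj h'

/-- Deleting `a`, `a'` shows that they exhaust the strict left side; deleting `b`, `b'` does the
same on the right. More than three vertices make all four distinct, and then deleting `a` and `b'`
disconnects `a'` from `b`. -/
theorem not_isKConnected_three (h : Rep G p a b a' b') : ¬ IsKConnected G 3 := by
  intro hG
  have hconn : ∀ u v : V, (G.induce ({u, v}ᶜ : Set V)).Connected := by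
    intro u v
    refine hG.2 _ (lt_of_le_of_lt (Set.encard_insert_le _ _) ?_)
    rw [Set.encard_singleton]
    decide
  have hcard : ∀ x y z : V, ¬ ∀ w, w = x ∨ w = y ∨ w = z := by
    intro x y z hall
    have h1 : (Set.univ : Set V) ⊆ {x, y, z} := fun w _ => hall w
    have h2 : ({x, y, z} : Set V).encard ≤ 3 := by
      refine (Set.encard_insert_le _ _).trans ?_
      have : ({y, z} : Set V).encard ≤ 2 := by
        refine (Set.encard_insert_le _ _).trans ?_
        rw [Set.encard_singleton]
        decide
      exact (add_le_add_left this 1).trans (by decide)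
    have h3 := (Set.encard_le_encard h1).trans h2
    rw [Set.encard_univ] at h3
    exact absurd hG.1 (not_lt.2 h3)
  have hl : ∀ w, w ∉ p.2 → w = a ∨ w = a' := by
    refine (h.subset_pair_of_connected (Or.inl rfl) (Or.inl rfl) (hconn a a')).resolve_right ?_
    intro h'
    obtain ⟨w, hw⟩ := h.right
    rcases h' w hw with rfl | rfl
    exacts [hw h.mem_left, hw h.comm.mem_left]
  have hr : ∀ w, w ∉ p.1 → w = b ∨ w = b' := by
    refine (h.subset_pair_of_connected (Or.inr rfl) (Or.inr rfl) (hconn b b')).resolve_left ?_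
    intro h'
    obtain ⟨w, hw⟩ := h.left
    rcases h' w hw with rfl | rfl
    exacts [hw h.mem_right, hw h.comm.mem_right]
  have hall : ∀ w, w = a ∨ w = b ∨ w = a' ∨ w = b' := by
    intro w
    by_cases h1 : w ∈ p.1
    · by_cases h2 : w ∈ p.2
      · have := h.inter w h1 h2
        tauto
      · have := hl w h2
        tauto
    · have := hr w h1
      tauto
  have hab : a ≠ b := by
    rintro rfl
    exact hcard a a' b' fun w => by have := hall w; tauto
  have hab' : a' ≠ b' := by
    rintro rfl
    exact hcard a b a' fun w => by have := hall w; tauto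
  have haa : a ≠ a' := by
    rintro rfl
    exact hcard a b b' fun w => by have := hall w; tauto
  have hbb : b ≠ b' := by
    rintro rfl
    exact hcard a b a' fun w => by have := hall w; tauto
  have h1 := h.pair.resolve_left fun h => hab h.1
  have h2 := h.pair'.resolve_left fun h => hab' h.1
  rcases h.subset_pair_of_connected (Or.inl rfl) (Or.inr rfl) (hconn a b') with h' | h'
  · exact (h' a' h2.1).elim haa.symm hab'
  · exact (h' b h1.2.1).elim hab.symm hbb

end Rep

/-! ### Crossing mixed 2-separations with singleton links -/

/-- Two mixed 2-separations whose four links are the vertices or edges given by the pairs `(a, b)`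
and `(a', b')` (in the separator of `p`) and `(c, d)` and `(c', d')` (in the separator of `q`). -/
structure Quad (G : SimpleGraph V) (p q : Set V × Set V) (a b a' b' c d c' d' : V) : Prop where
  rp : Rep G p a b a' b'
  rq : Rep G q c d c' d'
  link₁ : a ∈ q.1 ∧ b ∈ q.1 ∧ (a ∉ q.2 ∨ b ∉ q.2)
  link₂ : a' ∈ q.2 ∧ b' ∈ q.2 ∧ (a' ∉ q.1 ∨ b' ∉ q.1)
  link₃ : c ∈ p.1 ∧ d ∈ p.1 ∧ (c ∉ p.2 ∨ d ∉ p.2)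
  link₄ : c' ∈ p.2 ∧ d' ∈ p.2 ∧ (c' ∉ p.1 ∨ d' ∉ p.1)
  centre : ∀ v, v ∈ p.1 → v ∈ p.2 → v ∈ q.1 → v ∉ q.2

namespace Quad

theorem swap_left (h : Quad G p q a b a' b' c d c' d') : Quad G p.swap q b a b' a' c' d' c d where
  rp := h.rp.swap
  rq := h.rq.comm
  link₁ := ⟨h.link₁.2.1, h.link₁.1, h.link₁.2.2.symm⟩
  link₂ := ⟨h.link₂.2.1, h.link₂.1, h.link₂.2.2.symm⟩
  link₃ := h.link₄
  link₄ := h.link₃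
  centre v h1 h2 := h.centre v h2 h1

theorem flip (h : Quad G p q a b a' b' c d c' d') : Quad G q p c d c' d' a b a' b' where
  rp := h.rq
  rq := h.rp
  link₁ := h.link₃
  link₂ := h.link₄
  link₃ := h.link₁
  link₄ := h.link₂
  centre v h1 h2 h3 h4 := h.centre v h3 h4 h1 h2

theorem swap_right (h : Quad G p q a b a' b' c d c' d') : Quad G p q.swap a' b' a b d c d' c' :=
  h.flip.swap_left.flip

/-- The neighbourhood of a corner. -/
theorem corner_adj (h : Quad G p q a b a' b' c d c' d') {w z : V} (hwp : w ∉ p.2) (hwq : w ∉ q.2)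
    (hz : z ∈ p.2 ∨ z ∈ q.2) (hwz : G.Adj w z) :
    (w = a ∧ z = b) ∨ (w = c ∧ z = d) ∨ (z = a ∧ z = b) ∨ (z = c ∧ z = d) := by
  by_cases hzp : z ∈ p.1
  · by_cases hzq : z ∈ q.1
    · rcases hz with hz | hz
      · rcases h.rp.inter z hzp hz with h' | ⟨h', -⟩
        · exact Or.inr (Or.inr (Or.inl h'))
        · exact absurd (h' ▸ h.link₂.1) (h.centre z hzp hz hzq)
      · rcases h.rq.inter z hzq hz with h' | ⟨h', -⟩
        · exact Or.inr (Or.inr (Or.inr h'))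
        · exact absurd hz (h.centre z hzp (h' ▸ h.link₄.1) hzq)
    · rcases h.rq.adj w z hwq hzq hwz with h' | ⟨h', -⟩
      · exact Or.inr (Or.inl h')
      · exact absurd (h' ▸ h.link₄.1) hwp
  · rcases h.rp.adj w z hwp hzp hwz with h' | ⟨h', -⟩
    · exact Or.inl h'
    · exact absurd (h' ▸ h.link₂.1) hwq

theorem notMem_corner (hG : IsKConnected G 2) (h : Quad G p q a b a' b' c d c' d')
    (hu : u = a ∨ u = b) (hv : v = c ∨ v = d) (hne : u ≠ v) (hadj : ¬ G.Adj u v)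
    (hAC : ∀ w, w ∉ p.2 → w ∉ q.2 → w = u ∨ w = v) : u ∈ p.2 ∨ u ∈ q.2 := by
  by_contra! hcon
  obtain ⟨hup, huq⟩ := hcon
  have hub : u ≠ b := by
    rintro rfl
    exact hup h.rp.mem_right
  obtain rfl := hu.resolve_right hub
  obtain ⟨z, hzb, huz⟩ := hG.exists_adj_ne hub
  have hzv : z ≠ v := by
    rintro rfl
    exact hadj huz
  have hz : z ∈ p.2 ∨ z ∈ q.2 := by
    by_contra! hz
    exact (hAC z hz.1 hz.2).elim huz.ne' hzv
  rcases h.corner_adj hup huq hz huz with h' | ⟨h1, h2⟩ | h' | ⟨h1, h2⟩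
  · exact hzb h'.2
  · exact hv.elim (fun h => hne (h1.trans h.symm)) fun h => hzv (h2.trans h.symm)
  · exact hzb h'.2
  · exact hv.elim (fun h => hzv (h1.trans h.symm)) fun h => hzv (h2.trans h.symm)

/-- If the link were an edge `ab`, then `a`, not being in the empty corner, would have to be the
vertex `c = d`, so `v = a` and `u = b` would be adjacent. -/
theorem eq_of_corner_empty (h : Quad G p q a b a' b' c d c' d') (hu : u = a ∨ u = b)
    (hv : v = c ∨ v = d) (hne : u ≠ v) (hadj : ¬ G.Adj u v)
    (hAC : ∀ w, w ∉ p.2 → w ∈ q.2) : a = b := by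
  by_contra hab
  obtain ⟨h1, h2, h3⟩ := h.rp.pair.resolve_left fun h => hab h.1
  rcases h.rq.inter a h.link₁.1 (hAC a h1) with ⟨h4, h5⟩ | ⟨h4, -⟩
  · have hva : v = a := hv.elim (fun h => h.trans h4.symm) fun h => h.trans h5.symm
    have hub : u = b := hu.resolve_left fun h => hne (h.trans hva.symm)
    rw [hva, hub] at hadj
    exact hadj h3.symm
  · exact h1 (h4 ▸ h.link₄.1)

/-- Deleting `u` and `v`, taken from the two links at a corner, cuts off that corner. The work lies
in the cases where nothing is left of the corner or of its complement. -/
theorem exists_is2Sep_corner (hG : IsKConnected G 2) (h : Quad G p q a b a' b' c d c' d')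
    (hu : u = a ∨ u = b) (hv : v = c ∨ v = d) (hne : u ≠ v) (hadj : ¬ G.Adj u v) :
    ∃ s, Is2Sep G s u v := by
  refine exists_is2Sep_of_not_connected hG hne fun hc => ?_
  have hadj' : ¬ G.Adj v u := fun h => hadj h.symm
  by_cases hAC : ∀ w, w ∉ p.2 → w ∉ q.2 → w = u ∨ w = v
  · have h1 := h.notMem_corner hG hu hv hne hadj hAC
    have h2 := h.flip.notMem_corner hG hv hu hne.symm hadj' fun w h1 h2 => (hAC w h2 h1).symm
    have hAC' : ∀ w, w ∉ p.2 → w ∈ q.2 := by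
      intro w hw
      by_contra hw2
      rcases hAC w hw hw2 with rfl | rfl
      · exact h1.elim hw hw2
      · exact h2.elim hw2 hw
    have hab := h.eq_of_corner_empty hu hv hne hadj hAC'
    have hcd := h.flip.eq_of_corner_empty hv hu hne.symm hadj' fun w hw => by
      by_contra hw2
      exact hw (hAC' w hw2)
    subst hab hcd
    obtain rfl : u = a := hu.elim id id
    obtain rfl : v = c := hv.elim id id
    have huq : u ∉ q.2 := h.link₁.2.2.elim id id
    have hvp : v ∉ p.2 := h.link₃.2.2.elim id id
    have hud : u ≠ d' := by
      rintro rfl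
      exact huq h.rq.comm.mem_right
    have hvd : v ≠ d' := by
      rintro rfl
      exact hvp h.link₄.2.1
    -- With the corner empty and both links vertices, `v` has no neighbour strictly left of `q`. So
    -- `d'` alone separates `u` from `v`, against 2-connectedness.
    have := subset_of_adj_closed (X := q.2ᶜ) (hG.connected_compl_singleton d') (by
      intro z _ hz z' hz' hzz' hzq
      have hzv : z' = v := by
        by_cases hz1 : z' ∈ q.1
        · exact (h.rq.inter z' hz1 hzq).elim (fun h => h.1) fun h => absurd h.2 hz'
        · rcases h.rq.adj z z' hz hz1 hzz' with h' | h'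
          · exact h'.2
          · exact absurd h'.2 hz'
      subst hzv
      by_cases hz1 : z ∈ p.1
      · have hz2 : z ∈ p.2 := by
          by_contra hz2
          exact hz (hAC' z hz2)
        rcases h.rp.inter z hz1 hz2 with h' | h'
        · exact hadj (h'.1 ▸ hzz')
        · exact hz (h'.1 ▸ h.link₂.1)
      · rcases h.rp.adj z' z hvp hz1 hzz'.symm with h' | h'
        · exact hne h'.1.symm
        · exact hz (h'.2 ▸ h.link₂.2.1)) (a := u) hud huq
    exact this (show v ∈ ({d'}ᶜ : Set V) from hvd)
      (h.rq.pair.elim (fun h => h.2.2) fun h => absurd rfl h.2.2.ne)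
  · push Not at hAC
    obtain ⟨w, hwp, hwq, hwu, hwv⟩ := hAC
    have hsub := subset_of_adj_closed (X := p.2ᶜ ∩ q.2ᶜ) hc (by
      intro s hs hsX t ht hst
      by_contra htX
      have htX' : t ∈ p.2 ∨ t ∈ q.2 := by
        by_contra! hcon
        exact htX hcon
      simp only [Set.mem_compl_iff, Set.mem_insert_iff, Set.mem_singleton_iff, not_or] at hs ht
      rcases h.corner_adj hsX.1 hsX.2 htX' hst with h' | h' | h' | h'
      · exact hu.elim (fun h => hs.1 (h'.1.trans h.symm)) fun h => ht.1 (h'.2.trans h.symm)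
      · exact hv.elim (fun h => hs.2 (h'.1.trans h.symm)) fun h => ht.2 (h'.2.trans h.symm)
      · exact hu.elim (fun h => ht.1 (h'.1.trans h.symm)) fun h => ht.1 (h'.2.trans h.symm)
      · exact hv.elim (fun h => ht.2 (h'.1.trans h.symm)) fun h => ht.2 (h'.2.trans h.symm))
      (a := w) (by simp [hwu, hwv]) ⟨hwp, hwq⟩
    have hout : ∀ z, z ∈ p.2 ∨ z ∈ q.2 → z = u ∨ z = v := by
      intro z hz
      by_contra! hcon
      have := hsub (show z ∈ ({u, v}ᶜ : Set V) by simp [hcon.1, hcon.2])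
      exact hz.elim this.1 this.2
    have hvp : v ∈ p.1 := hv.elim (fun h' => h' ▸ h.link₃.1) fun h' => h' ▸ h.link₃.2.1
    have hup : u ∉ p.1 := by
      rcases h.link₄.2.2 with h' | h'
      · exact (hout c' (Or.inl h.link₄.1)).elim (fun e => e ▸ h') fun e => absurd (e ▸ hvp) h'
      · exact (hout d' (Or.inl h.link₄.2.1)).elim (fun e => e ▸ h') fun e => absurd (e ▸ hvp) h'
    have hua : u ≠ a := by
      rintro rfl
      exact hup h.rp.mem_left
    obtain ⟨z, hza, huz⟩ := hG.exists_adj_ne hua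
    have hz : z ∉ p.2 ∧ z ∉ q.2 := by
      by_contra! hcon
      refine (hout z ?_).elim huz.ne' fun e => hadj (e ▸ huz)
      by_cases hz2 : z ∈ p.2
      · exact Or.inl hz2
      · exact Or.inr (hcon hz2)
    rcases h.corner_adj hz.1 hz.2 (Or.inl ((h.rp.cover u).resolve_left hup)) huz.symm with
      h' | h' | h' | h'
    · exact hza h'.1
    · exact hup (h'.2 ▸ h.link₃.2.1)
    · exact hua h'.1
    · exact hup (h'.1 ▸ h.link₃.1)

/-- The vertices that are in, or incident with an edge in, one of the two separators. -/
def verts (a b a' b' c d c' d' : V) : Set V :=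
  {w | (w = a ∨ w = b) ∨ (w = a' ∨ w = b') ∨ (w = c ∨ w = d) ∨ (w = c' ∨ w = d')}

/-- Two ends of the same link are equal or adjacent. Ends of opposite links belong to one separator,
handled by `Rep.exists_is2Sep`; ends of the remaining pairs of links meet at a corner, and symmetry
reduces all corners to one. -/
theorem exists_is2Sep (hG : IsKConnected G 2) (h : Quad G p q a b a' b' c d c' d')
    (hu : u ∈ verts a b a' b' c d c' d') (hv : v ∈ verts a b a' b' c d c' d') (hne : u ≠ v)
    (hadj : ¬ G.Adj u v) : ∃ s, Is2Sep G s u v := by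
  have hadj' : ¬ G.Adj v u := fun h => hadj h.symm
  have same : ∀ {x y : V}, (x = y ∨ G.Adj x y) → (u = x ∨ u = y) → (v = x ∨ v = y) → False := by
    rintro x y hxy (rfl | rfl) (rfl | rfl)
    · exact hne rfl
    · exact hxy.elim hne hadj
    · exact hxy.elim (fun h => hne h.symm) hadj'
    · exact hne rfl
  have symm : (∃ s, Is2Sep G s v u) → ∃ s, Is2Sep G s u v := fun ⟨s, hs⟩ => ⟨s, hs.comm⟩
  rcases hu with hu | hu | hu | hu <;> rcases hv with hv | hv | hv | hv
  · exact (same h.rp.eq_or_adj hu hv).elim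
  · exact h.rp.exists_is2Sep hG hu hv hne hadj
  · exact h.exists_is2Sep_corner hG hu hv hne hadj
  · exact h.swap_left.exists_is2Sep_corner hG hu.symm hv hne hadj
  · exact h.rp.comm.exists_is2Sep hG hu hv hne hadj
  · exact (same h.rp.comm.eq_or_adj hu hv).elim
  · exact h.swap_right.exists_is2Sep_corner hG hu hv.symm hne hadj
  · exact h.swap_right.swap_left.exists_is2Sep_corner hG hu.symm hv.symm hne hadj
  · exact symm (h.exists_is2Sep_corner hG hv hu hne.symm hadj')
  · exact symm (h.swap_right.exists_is2Sep_corner hG hv hu.symm hne.symm hadj')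
  · exact (same h.rq.eq_or_adj hu hv).elim
  · exact h.rq.exists_is2Sep hG hu hv hne hadj
  · exact symm (h.swap_left.exists_is2Sep_corner hG hv.symm hu hne.symm hadj')
  · exact symm (h.swap_right.swap_left.exists_is2Sep_corner hG hv.symm hu.symm hne.symm hadj')
  · exact h.rq.comm.exists_is2Sep hG hu hv hne hadj
  · exact (same h.rq.comm.eq_or_adj hu hv).elim

/-- A totally-nested separation that strictly separates two of these vertices would be crossed by
the 2-separation having them as its separator. -/
theorem verts_subset_or (hG : IsKConnected G 2) (h : Quad G p q a b a' b' c d c' d')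
    {s : Set V × Set V} (hs : s ∈ totallyNested2Seps G) :
    verts a b a' b' c d c' d' ⊆ s.1 ∨ verts a b a' b' c d c' d' ⊆ s.2 := by
  by_contra! hcon
  obtain ⟨u, hu, hus⟩ := Set.not_subset.1 hcon.1
  obtain ⟨v, hv, hvs⟩ := Set.not_subset.1 hcon.2
  obtain ⟨x, y, hxy⟩ := exists_is2Sep_of_mem hs
  have hne : u ≠ v := by
    rintro rfl
    exact (hxy.cover u).elim hus hvs
  obtain ⟨r, hr⟩ := h.exists_is2Sep hG hu hv hne fun hadj => hxy.not_adj v u hvs hus hadj.symm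
  have hru := hr.x_mem
  have hrv := hr.y_mem
  rcases nested_of_mem hs hr with h' | h' | h' | h'
  · exact hvs (h'.2 hrv.2)
  · exact hvs (h'.2 hrv.1)
  · exact hus (h'.2 hru.2)
  · exact hus (h'.2 hru.1)

/-- The links of `q` supply a vertex strictly left and one strictly right of `p`. If there were no
others, both elements of the separator of `p` would be the edge between these two. -/
theorem not_verts_subset_pair (h : Quad G p q a b a' b' c d c' d') (x y : V) :
    ¬ ∀ w ∈ verts a b a' b' c d c' d', w = x ∨ w = y := by
  intro hall
  have main : ∀ x y : V, x ∉ p.2 → y ∉ p.1 → ¬ ∀ w ∈ verts a b a' b' c d c' d', w = x ∨ w = y := by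
    intro x y hx hy hall
    have ha := (hall a (by simp [verts])).resolve_right fun e => hy (e ▸ h.rp.mem_left)
    have ha' := (hall a' (by simp [verts])).resolve_right fun e => hy (e ▸ h.rp.comm.mem_left)
    have hb := (hall b (by simp [verts])).resolve_left fun e => hx (e ▸ h.rp.mem_right)
    have hb' := (hall b' (by simp [verts])).resolve_left fun e => hx (e ▸ h.rp.comm.mem_right)
    exact h.rp.ne ⟨ha.trans ha'.symm, hb.trans hb'.symm⟩
  have hl : ∃ w ∈ verts a b a' b' c d c' d', w ∉ p.2 :=
    h.link₃.2.2.elim (fun h => ⟨c, by simp [verts], h⟩) fun h => ⟨d, by simp [verts], h⟩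
  have hr : ∃ w ∈ verts a b a' b' c d c' d', w ∉ p.1 :=
    h.link₄.2.2.elim (fun h => ⟨c', by simp [verts], h⟩) fun h => ⟨d', by simp [verts], h⟩
  obtain ⟨w, hw, hw2⟩ := hl
  obtain ⟨z, hz, hz1⟩ := hr
  have hwz : w ≠ z := by
    rintro rfl
    exact (h.rp.cover w).elim hz1 hw2
  rcases hall w hw with rfl | rfl <;> rcases hall z hz with rfl | rfl
  · exact hwz rfl
  · exact main _ _ hw2 hz1 hall
  · exact main _ _ hw2 hz1 fun v hv => (hall v hv).symm
  · exact hwz rfl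

end Quad

end

section

variable {G : SimpleGraph V} {p q : Set V × Set V} {u v a b a' b' c d c' d' : V}

/-! ### Reading the ends of the four links off the separators -/

theorem Represents.ends {p₁ p₂ : Set V × Set V} {i : V ⊕ Sym2 V} (h : Represents G p₁ i a b)
    (h' : Represents G p₂ i a' b') : (a' = a ∨ a' = b) ∧ (b' = a ∨ b' = b) := by
  rcases h with ⟨h1, rfl, -⟩ | ⟨h1, -⟩ <;> rcases h' with ⟨h2, rfl, -⟩ | ⟨h2, -⟩
  · have := Sum.inl_injective (h1.symm.trans h2)
    simp [this]
  · simp [h1] at h2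
  · simp [h1] at h2
  · rcases Sym2.eq_iff.1 (Sum.inr_injective (h1.symm.trans h2)) with ⟨rfl, rfl⟩ | ⟨rfl, rfl⟩ <;> simp

/-- An edge in the link has one end in a corner for `q.1`; being non-diagonal, it cannot have its
other end strictly on the other side of `q`. -/
theorem exists_represents_of_mem_link (hq : ∀ v, v ∈ q.1 ∨ v ∈ q.2) {i : V ⊕ Sym2 V}
    (hi : i ∈ link G p q) :
    ∃ a b, Represents G p i a b ∧ a ∈ q.1 ∧ b ∈ q.1 ∧ (a ∉ q.2 ∨ b ∉ q.2) := by
  rcases hi with ⟨v, hv, rfl⟩ | ⟨e, ⟨⟨x, hx, y, hy, hxy, rfl⟩, hdiag, w, hw, hwc⟩, rfl⟩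
  · have := (hq v).resolve_right hv.2
    exact ⟨v, v, Or.inl ⟨rfl, rfl, hv.1.1, hv.1.2⟩, this, this, Or.inl hv.2⟩
  · refine ⟨x, y, Or.inr ⟨rfl, hx.2, hy.2, hxy⟩, ?_⟩
    have hwq : w ∈ q.1 \ q.2 := hwc.elim (fun h => h.2) fun h => h.2
    rcases Sym2.mem_iff.1 hw with rfl | rfl
    · refine ⟨hwq.1, ?_, Or.inl hwq.2⟩
      by_contra hyq
      exact hdiag (Or.inl ⟨w, ⟨hx, hwq⟩, y, ⟨hy, (hq y).resolve_left hyq, hyq⟩, hxy, rfl⟩)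
    · refine ⟨?_, hwq.1, Or.inr hwq.2⟩
      by_contra hxq
      exact hdiag (Or.inr ⟨x, ⟨hx, (hq x).resolve_left hxq, hxq⟩, w, ⟨hy, hwq⟩, hxy, rfl⟩)

theorem eq_pair_of_encard_eq_two {α : Type u} {S : Set α} (hS : S.encard = 2) {i j : α}
    (hi : i ∈ S) (hj : j ∈ S) (hij : i ≠ j) : S = {i, j} := by
  obtain ⟨x, y, hxy, rfl⟩ := Set.encard_eq_two.1 hS
  rcases hi with rfl | hi <;> rcases hj with rfl | hj
  · exact absurd rfl hij
  · rw [Set.mem_singleton_iff.1 hj]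
  · rw [Set.mem_singleton_iff.1 hi, Set.pair_comm]
  · exact absurd (hi.trans hj.symm) hij

theorem exists_represents_links (hp : IsMixedKSep G 2 p) (hq : ∀ v, v ∈ q.1 ∨ v ∈ q.2)
    (h1 : (link G p q).encard = 1) (h2 : (link G p q.swap).encard = 1) :
    ∃ i j a b a' b', i ≠ j ∧ separator G p = {i, j} ∧ Represents G p i a b ∧
      Represents G p j a' b' ∧ (a ∈ q.1 ∧ b ∈ q.1 ∧ (a ∉ q.2 ∨ b ∉ q.2)) ∧
      (a' ∈ q.2 ∧ b' ∈ q.2 ∧ (a' ∉ q.1 ∨ b' ∉ q.1)) := by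
  have hcov : ∀ v, v ∈ p.1 ∨ v ∈ p.2 := fun v => (Set.ext_iff.1 hp.1.1 v).2 trivial
  obtain ⟨i, hi⟩ := Set.encard_eq_one.1 h1
  obtain ⟨j, hj⟩ := Set.encard_eq_one.1 h2
  obtain ⟨a, b, hab, h3⟩ := exists_represents_of_mem_link hq (hi ▸ rfl : i ∈ link G p q)
  obtain ⟨a', b', hab', h4⟩ := exists_represents_of_mem_link (fun v => (hq v).symm)
    (hj ▸ rfl : j ∈ link G p q.swap)
  have hij : i ≠ j := by
    rintro rfl
    obtain ⟨h5, h6⟩ := hab.ends hab'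
    rcases h4.2.2 with h7 | h7
    · exact h7 (h5.elim (fun e => e ▸ h3.1) fun e => e ▸ h3.2.1)
    · exact h7 (h6.elim (fun e => e ▸ h3.1) fun e => e ▸ h3.2.1)
  exact ⟨i, j, a, b, a', b', hij, eq_pair_of_encard_eq_two hp.2
    ((mem_separator_iff hcov).2 ⟨a, b, hab⟩) ((mem_separator_iff hcov).2 ⟨a', b', hab'⟩) hij,
    hab, hab', h3, h4⟩

theorem CrossWithSingletonLinks.exists_quad (hp : IsMixedKSep G 2 p) (hq : IsMixedKSep G 2 q)
    (h : CrossWithSingletonLinks G p q) : ∃ i j i' j' a b a' b' c d c' d',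
      Quad G p q a b a' b' c d c' d' ∧ separator G p = {i, j} ∧ separator G q = {i', j'} ∧
      Represents G p i a b ∧ Represents G p j a' b' ∧ Represents G q i' c d ∧
      Represents G q j' c' d' := by
  have hpc : ∀ v, v ∈ p.1 ∨ v ∈ p.2 := fun v => (Set.ext_iff.1 hp.1.1 v).2 trivial
  have hqc : ∀ v, v ∈ q.1 ∨ v ∈ q.2 := fun v => (Set.ext_iff.1 hq.1.1 v).2 trivial
  obtain ⟨-, h1, h2, h3, h4, h5⟩ := h
  obtain ⟨i, j, a, b, a', b', hij, hS, hi, hj, l1, l2⟩ := exists_represents_links hp hqc h1 h2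
  obtain ⟨i', j', c, d, c', d', hij', hS', hi', hj', l3, l4⟩ := exists_represents_links hq hpc h3 h4
  refine ⟨i, j, i', j', a, b, a', b', c, d, c', d', ⟨hi.rep hp.1 hij hS hj,
    hi'.rep hq.1 hij' hS' hj', l1, l2, l3, l4, fun v v1 v2 v3 v4 => ?_⟩, hS, hS', hi, hj, hi', hj'⟩
  have : Sum.inl v ∈ centre G p q := Or.inl ⟨v, ⟨⟨v1, v2⟩, v3, v4⟩, rfl⟩
  rw [h5] at this
  exact this

/-! ### Restricting mixed 2-separations to torsos -/

theorem Is2Sep.connected_insert_of_mem (hG : IsKConnected G 2) {m : Set V × Set V} {x y : V}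
    (h : Is2Sep G m x y) (hv : v ∈ m.1 ∧ v ∈ m.2) : (G.induce (insert v m.2ᶜ)).Connected := by
  rcases (h.mem_iff v).1 hv with rfl | rfl
  · exact h.connected_insert hG
  · exact h.comm.connected_insert hG

/-- Leaving the strict left side of `p` means reaching one of `a`, `a'`, `b`, `b'`. These all lie in
`m.2`, so the connected set formed by `v` and the strict left side of `m` cannot leave. -/
theorem Rep.subset_of_mem (hG : IsKConnected G 2) (h : Rep G p a b a' b') {m : Set V × Set V}
    {x y : V} (hm : Is2Sep G m x y) (ha : a ∈ m.2) (ha' : a' ∈ m.2) (hb : b ∈ m.2) (hb' : b' ∈ m.2)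
    (hv : v ∈ m.1 ∧ v ∈ m.2) (hvp : v ∉ p.2) : m.2ᶜ ⊆ p.2ᶜ := by
  refine (Set.subset_insert v _).trans
    (subset_of_adj_closed (hm.connected_insert_of_mem hG hv) ?_ (Or.inl rfl) hvp)
  intro s hs hsp t ht hst htp
  have htm : t ∉ m.2 := by
    rcases ht with rfl | ht
    · exact absurd htp hvp
    · exact ht
  by_cases ht1 : t ∈ p.1
  · rcases h.inter t ht1 htp with ⟨rfl, -⟩ | ⟨rfl, -⟩
    exacts [htm ha, htm ha']
  · rcases h.adj s t hsp ht1 hst with ⟨-, rfl⟩ | ⟨-, rfl⟩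
    exacts [htm hb, htm hb']

variable {O : TNode G}

/-- For a virtual edge across `p`, the strict left side of the corresponding `m` would lie strictly
on both sides of `p`. -/
theorem Rep.adj_of_nodeTorso_adj (hG : IsKConnected G 2) (h : Rep G p a b a' b')
    (ha : a ∈ nodeBag O) (ha' : a' ∈ nodeBag O) (hb : b ∈ nodeBag O) (hb' : b' ∈ nodeBag O)
    {x y : nodeBag O} (hxy : (nodeTorso O).Adj x y) (hx : (x : V) ∉ p.2) (hy : (y : V) ∉ p.1) :
    G.Adj x y := by
  obtain ⟨-, h' | ⟨m, hm, h1, h2⟩⟩ := (nodeTorso_adj_iff hG).1 hxy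
  · exact h'
  · obtain ⟨x₀, y₀, hm2⟩ := exists_is2Sep_of_mem (O.2.sub hm.1)
    have e1 := h.subset_of_mem hG hm2 (ha m hm.1) (ha' m hm.1) (hb m hm.1) (hb' m hm.1)
      ⟨h1, x.2 m hm.1⟩ hx
    have e2 := h.swap.subset_of_mem hG hm2 (hb m hm.1) (hb' m hm.1) (ha m hm.1) (ha' m hm.1)
      ⟨h2, y.2 m hm.1⟩ hy
    obtain ⟨z, hz⟩ := hm2.left
    exact ((h.cover z).elim (e2 hz) (e1 hz)).elim

theorem Rep.restrict (hG : IsKConnected G 2) (h : Rep G p a b a' b')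
    (ha : a ∈ nodeBag O) (ha' : a' ∈ nodeBag O) (hb : b ∈ nodeBag O) (hb' : b' ∈ nodeBag O)
    (hl : ∃ v ∈ nodeBag O, v ∉ p.2) (hr : ∃ v ∈ nodeBag O, v ∉ p.1) :
    Rep (nodeTorso O) (Subtype.val ⁻¹' p.1, Subtype.val ⁻¹' p.2) ⟨a, ha⟩ ⟨b, hb⟩ ⟨a', ha'⟩
      ⟨b', hb'⟩ := by
  have hpair : ∀ {x y : V} (hx : x ∈ nodeBag O) (hy : y ∈ nodeBag O),
      ((x = y ∧ x ∈ p.1 ∧ x ∈ p.2) ∨ (x ∉ p.2 ∧ y ∉ p.1 ∧ G.Adj x y)) →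
      (((⟨x, hx⟩ : nodeBag O) = ⟨y, hy⟩ ∧ x ∈ p.1 ∧ x ∈ p.2) ∨
        (x ∉ p.2 ∧ y ∉ p.1 ∧ (nodeTorso O).Adj ⟨x, hx⟩ ⟨y, hy⟩)) := by
    intro x y hx hy h'
    refine h'.imp (fun h => ⟨Subtype.ext h.1, h.2⟩) fun h => ⟨h.1, h.2.1, ?_⟩
    exact (nodeTorso_adj_iff hG).2 ⟨fun e => h.2.2.ne (congrArg Subtype.val e), Or.inl h.2.2⟩
  obtain ⟨l, hlO, hl⟩ := hl
  obtain ⟨r, hrO, hr⟩ := hr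
  refine ⟨fun v => h.cover v, ⟨⟨l, hlO⟩, hl⟩, ⟨⟨r, hrO⟩, hr⟩, hpair ha hb h.pair, hpair ha' hb' h.pair',
    fun e => h.ne ⟨congrArg Subtype.val e.1, congrArg Subtype.val e.2⟩, fun v h1 h2 => ?_,
    fun v w hv hw hvw => ?_⟩
  · exact (h.inter v h1 h2).imp (fun e => ⟨Subtype.ext e.1, Subtype.ext e.2⟩)
      fun e => ⟨Subtype.ext e.1, Subtype.ext e.2⟩
  · exact (h.adj v w hv hw (h.adj_of_nodeTorso_adj hG ha ha' hb hb' hvw hv hw)).imp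
      (fun e => ⟨Subtype.ext e.1, Subtype.ext e.2⟩) fun e => ⟨Subtype.ext e.1, Subtype.ext e.2⟩

/-! ### The cyclic sequence of vertices and edges of a cycle -/

section CycleItem

variable {m : ℕ} {f : Fin (m + 3) → V}

theorem cycleItem_even (f : Fin (m + 3) → V) (r : ℕ) :
    cycleItem f (2 * r) = Sum.inl (f (Fin.ofNat (m + 3) r)) := by
  simp [cycleItem]

theorem cycleItem_odd (f : Fin (m + 3) → V) (r : ℕ) : cycleItem f (2 * r + 1) =
    Sum.inr s(f (Fin.ofNat (m + 3) r), f (Fin.ofNat (m + 3) (r + 1))) := by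
  have h : (2 * r + 1) / 2 = r := by omega
  simp [cycleItem, h]

theorem ofNat_add_period (r : ℕ) : Fin.ofNat (m + 3) (r + (m + 3)) = Fin.ofNat (m + 3) r := by
  apply Fin.ext
  simp

theorem cycleItem_add_period (f : Fin (m + 3) → V) (k : ℕ) :
    cycleItem f (k + 2 * (m + 3)) = cycleItem f k := by
  rcases Nat.even_or_odd' k with ⟨r, rfl | rfl⟩
  · rw [← mul_add, cycleItem_even, cycleItem_even, ofNat_add_period]
  · have h : 2 * r + 1 + 2 * (m + 3) = 2 * (r + (m + 3)) + 1 := by ring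
    have h' : r + (m + 3) + 1 = r + 1 + (m + 3) := by ring
    rw [h, cycleItem_odd, cycleItem_odd, ofNat_add_period, h', ofNat_add_period]

theorem cycleItem_inj (hf : Function.Injective f) {k l : ℕ} (hk : k < 2 * (m + 3))
    (hl : l < 2 * (m + 3)) (h : cycleItem f k = cycleItem f l) : k = l := by
  have hmod : ∀ r s : ℕ, f (Fin.ofNat (m + 3) r) = f (Fin.ofNat (m + 3) s) →
      r % (m + 3) = s % (m + 3) := fun r s h => by
    simpa using congrArg Fin.val (hf h)
  rcases Nat.even_or_odd' k with ⟨r, rfl | rfl⟩ <;> rcases Nat.even_or_odd' l with ⟨s, rfl | rfl⟩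
  · rw [cycleItem_even, cycleItem_even] at h
    have := hmod r s (Sum.inl_injective h)
    rw [Nat.mod_eq_of_lt (by omega), Nat.mod_eq_of_lt (by omega)] at this
    rw [this]
  · rw [cycleItem_even, cycleItem_odd] at h
    simp at h
  · rw [cycleItem_even, cycleItem_odd] at h
    simp at h
  · rw [cycleItem_odd, cycleItem_odd] at h
    have hr : r % (m + 3) = r := Nat.mod_eq_of_lt (by omega)
    have hs : s % (m + 3) = s := Nat.mod_eq_of_lt (by omega)
    rcases Sym2.eq_iff.1 (Sum.inr_injective h) with ⟨h1, -⟩ | ⟨h1, h2⟩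
    · have := hmod r s h1
      rw [hr, hs] at this
      rw [this]
    -- Matching the two edges in reverse order would give `r ≡ s + 1` and `s ≡ r + 1` modulo `m +
    -- 3`, impossible for a cycle of length at least three.
    · exfalso
      have e1 := hmod _ _ h1
      have e2 := hmod _ _ h2
      rw [hr] at e1
      rw [hs] at e2
      by_cases hs' : s + 1 < m + 3
      · rw [Nat.mod_eq_of_lt hs'] at e1
        by_cases hr' : r + 1 < m + 3
        · rw [Nat.mod_eq_of_lt hr'] at e2
          omega
        · have : r + 1 = m + 3 := by omega
          rw [this, Nat.mod_self] at e2
          omega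
      · have : s + 1 = m + 3 := by omega
        rw [this, Nat.mod_self] at e1
        rw [e1, Nat.mod_eq_of_lt (by omega)] at e2
        omega

/-- The `k`-th vertex or edge of the cycle has a vertex outside `B`. -/
def ItemMeetsCompl (f : Fin (m + 3) → V) (B : Set V) (k : ℕ) : Prop :=
  f (Fin.ofNat (m + 3) (k / 2)) ∉ B ∨ f (Fin.ofNat (m + 3) ((k + 1) / 2)) ∉ B

theorem itemMeetsCompl_even {B : Set V} {r : ℕ} :
    ItemMeetsCompl f B (2 * r) ↔ f (Fin.ofNat (m + 3) r) ∉ B := by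
  have h1 : 2 * r / 2 = r := by omega
  have h2 : (2 * r + 1) / 2 = r := by omega
  rw [ItemMeetsCompl, h1, h2, or_self]

theorem itemMeetsCompl_odd {B : Set V} {r : ℕ} : ItemMeetsCompl f B (2 * r + 1) ↔
    f (Fin.ofNat (m + 3) r) ∉ B ∨ f (Fin.ofNat (m + 3) (r + 1)) ∉ B := by
  have h1 : (2 * r + 1) / 2 = r := by omega
  have h2 : (2 * r + 1 + 1) / 2 = r + 1 := by omega
  rw [ItemMeetsCompl, h1, h2]

theorem itemMeetsCompl_add_period {B : Set V} {k : ℕ} :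
    ItemMeetsCompl f B (k + 2 * (m + 3)) ↔ ItemMeetsCompl f B k := by
  have h1 : (k + 2 * (m + 3)) / 2 = k / 2 + (m + 3) := by omega
  have h2 : (k + 2 * (m + 3) + 1) / 2 = (k + 1) / 2 + (m + 3) := by omega
  rw [ItemMeetsCompl, ItemMeetsCompl, h1, h2, ofNat_add_period, ofNat_add_period]

/-- Consecutive vertices of the cycle that lie strictly on different sides of `p` are adjacent
in `G`. -/
def CrossesInG (G : SimpleGraph V) (f : Fin (m + 3) → V) (p : Set V × Set V) : Prop :=
  ∀ r, (f (Fin.ofNat (m + 3) r) ∉ p.2 → f (Fin.ofNat (m + 3) (r + 1)) ∉ p.1 →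
      G.Adj (f (Fin.ofNat (m + 3) r)) (f (Fin.ofNat (m + 3) (r + 1)))) ∧
    (f (Fin.ofNat (m + 3) r) ∉ p.1 → f (Fin.ofNat (m + 3) (r + 1)) ∉ p.2 →
      G.Adj (f (Fin.ofNat (m + 3) r)) (f (Fin.ofNat (m + 3) (r + 1))))

theorem separator_swap : separator G p.swap = separator G p := by
  have : edgesBetween G (p.2 \ p.1) (p.1 \ p.2) = edgesBetween G (p.1 \ p.2) (p.2 \ p.1) := by
    ext e
    constructor
    · rintro ⟨x, hx, y, hy, hxy, rfl⟩
      exact ⟨y, hy, x, hx, hxy.symm, Sym2.eq_swap⟩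
    · rintro ⟨x, hx, y, hy, hxy, rfl⟩
      exact ⟨y, hy, x, hx, hxy.symm, Sym2.eq_swap⟩
  simp only [separator, Prod.fst_swap, Prod.snd_swap, this, Set.inter_comm]

theorem not_itemMeetsCompl_both (hcov : ∀ v, v ∈ p.1 ∨ v ∈ p.2) (hf : CrossesInG G f p) {k : ℕ}
    (hk : cycleItem f k ∉ separator G p) (h1 : ItemMeetsCompl f p.2 k) :
    ¬ ItemMeetsCompl f p.1 k := by
  intro h2
  rcases Nat.even_or_odd' k with ⟨r, rfl | rfl⟩
  · rw [itemMeetsCompl_even] at h1 h2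
    exact (hcov _).elim h2 h1
  · rw [itemMeetsCompl_odd] at h1 h2
    rw [cycleItem_odd, mem_separator_iff hcov] at hk
    have c1 := hcov (f (Fin.ofNat (m + 3) r))
    have c2 := hcov (f (Fin.ofNat (m + 3) (r + 1)))
    rcases h1 with h1 | h1 <;> rcases h2 with h2 | h2
    · exact c1.elim h2 h1
    · exact hk ⟨_, _, Or.inr ⟨rfl, h1, h2, (hf r).1 h1 h2⟩⟩
    · exact hk ⟨_, _, Or.inr ⟨by rw [Sym2.eq_swap], h1, h2, ((hf r).2 h2 h1).symm⟩⟩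
    · exact c2.elim h2 h1

/-- A vertex belongs to the next edge. An edge outside the separator has both ends in `p.1`, so its
second end, also outside the separator, cannot lie in `p.2`. -/
theorem itemMeetsCompl_succ (hcov : ∀ v, v ∈ p.1 ∨ v ∈ p.2) (hf : CrossesInG G f p) {k : ℕ}
    (hk : cycleItem f k ∉ separator G p) (hk' : cycleItem f (k + 1) ∉ separator G p)
    (h : ItemMeetsCompl f p.2 k) : ItemMeetsCompl f p.2 (k + 1) := by
  rcases Nat.even_or_odd' k with ⟨r, rfl | rfl⟩
  · exact itemMeetsCompl_odd.2 (Or.inl (itemMeetsCompl_even.1 h))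
  · have hno := not_itemMeetsCompl_both hcov hf hk h
    rw [itemMeetsCompl_odd] at hno
    push Not at hno
    have h2 : 2 * r + 1 + 1 = 2 * (r + 1) := by ring
    rw [h2, mem_separator_iff hcov, cycleItem_even] at hk'
    rw [h2, itemMeetsCompl_even]
    exact fun h3 => hk' ⟨_, _, Or.inl ⟨rfl, rfl, hno.2, h3⟩⟩

theorem itemMeetsCompl_of_le (hcov : ∀ v, v ∈ p.1 ∨ v ∈ p.2) (hf : CrossesInG G f p) {s t : ℕ}
    (hst : s ≤ t) (hno : ∀ k, s ≤ k → k ≤ t → cycleItem f k ∉ separator G p)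
    (h : ItemMeetsCompl f p.2 s) : ItemMeetsCompl f p.2 t := by
  induction t, hst using Nat.le_induction with
  | base => exact h
  | succ t hst ih =>
    exact itemMeetsCompl_succ hcov hf (hno t hst (Nat.le_succ t)) (hno (t + 1) (by omega) le_rfl)
      (ih fun k h1 h2 => hno k h1 (by omega))

theorem CrossesInG.swap (hf : CrossesInG G f p) : CrossesInG G f p.swap :=
  fun r => ⟨(hf r).2, (hf r).1⟩

/-- No segment of the cycle that avoids the separator meets both sides strictly. -/
theorem false_of_segment (hcov : ∀ v, v ∈ p.1 ∨ v ∈ p.2) (hf : CrossesInG G f p) {l r s t : ℕ}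
    (hno : ∀ k, l < k → k < r → cycleItem f k ∉ separator G p) (hs : l < s ∧ s < r)
    (ht : l < t ∧ t < r) (h : ItemMeetsCompl f p.2 s) (h' : ItemMeetsCompl f p.1 t) : False := by
  rcases le_total s t with hst | hst
  · exact not_itemMeetsCompl_both hcov hf (hno t ht.1 ht.2) (itemMeetsCompl_of_le hcov hf hst
      (fun k h1 h2 => hno k (by omega) (by omega)) h) h'
  · refine not_itemMeetsCompl_both hcov hf (hno s hs.1 hs.2) h ?_
    refine itemMeetsCompl_of_le (p := p.swap) (fun v => (hcov v).symm) hf.swap hst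
      (fun k h1 h2 => ?_) h'
    rw [separator_swap]
    exact hno k (by omega) (by omega)

theorem false_of_outside (hcov : ∀ v, v ∈ p.1 ∨ v ∈ p.2) (hf : CrossesInG G f p)
    (hinj : Function.Injective f) {i k s t : ℕ} (hik : i < k) (hk : k < 2 * (m + 3))
    (hsep : separator G p = {cycleItem f i, cycleItem f k})
    (hs : s < 2 * (m + 3)) (ht : t < 2 * (m + 3)) (hs' : s < i ∨ k < s) (ht' : t < i ∨ k < t)
    (h : ItemMeetsCompl f p.2 s) (h' : ItemMeetsCompl f p.1 t) : False := by
  have hno : ∀ l, k < l → l < i + 2 * (m + 3) → cycleItem f l ∉ separator G p := by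
    intro l hl1 hl2
    rw [hsep]
    by_cases hl : l < 2 * (m + 3)
    · rintro (h | h)
      · have := cycleItem_inj hinj hl (by omega) h
        omega
      · have := cycleItem_inj hinj hl hk h
        omega
    · obtain ⟨l', rfl⟩ : ∃ l', l = l' + 2 * (m + 3) := ⟨l - 2 * (m + 3), by omega⟩
      rw [cycleItem_add_period]
      rintro (h | h)
      · have := cycleItem_inj hinj (by omega) (by omega) h
        omega
      · have := cycleItem_inj hinj (by omega) hk h
        omega
  -- Positions before `i` are moved up by one period, so that the outer segment becomes the interval
  -- from `k` to `i + 2 * (m + 3)`.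
  have shift : ∀ {B : Set V} {s : ℕ}, s < 2 * (m + 3) → (s < i ∨ k < s) → ItemMeetsCompl f B s →
      ∃ s', (k < s' ∧ s' < i + 2 * (m + 3)) ∧ ItemMeetsCompl f B s' := by
    intro B s hs hs' h
    rcases hs' with hs' | hs'
    · exact ⟨s + 2 * (m + 3), ⟨by omega, by omega⟩, itemMeetsCompl_add_period.2 h⟩
    · exact ⟨s, ⟨hs', by omega⟩, h⟩
  obtain ⟨s', e1, e2⟩ := shift hs hs' h
  obtain ⟨t', e3, e4⟩ := shift ht ht' h'
  exact false_of_segment hcov hf hno e1 e3 e2 e4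

theorem false_of_inside (hcov : ∀ v, v ∈ p.1 ∨ v ∈ p.2) (hf : CrossesInG G f p)
    (hinj : Function.Injective f) {i k s t : ℕ} (hk : k < 2 * (m + 3))
    (hsep : separator G p = {cycleItem f i, cycleItem f k})
    (hs : i < s ∧ s < k) (ht : i < t ∧ t < k)
    (h : ItemMeetsCompl f p.2 s) (h' : ItemMeetsCompl f p.1 t) : False := by
  refine false_of_segment hcov hf (fun l hl1 hl2 => ?_) hs ht h h'
  rw [hsep]
  rintro (h | h)
  · have := cycleItem_inj hinj (by omega) (by omega) h
    omega
  · have := cycleItem_inj hinj (by omega) hk h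
    omega

/-- The positions `i` and `k` cut the cyclic sequence into two segments, neither of which meets both
strict sides of `p`. So `s` and `t` lie in different segments. -/
theorem exists_alternation (hcov : ∀ v, v ∈ p.1 ∨ v ∈ p.2) (hf : CrossesInG G f p)
    (hinj : Function.Injective f) {i k s t : ℕ} (hik : i < k) (hk : k < 2 * (m + 3))
    (hsep : separator G p = {cycleItem f i, cycleItem f k}) {Y : Set (V ⊕ Sym2 V)}
    (hY : Y = {cycleItem f s, cycleItem f t})
    (hs : s < 2 * (m + 3)) (ht : t < 2 * (m + 3)) (hs' : cycleItem f s ∉ separator G p)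
    (ht' : cycleItem f t ∉ separator G p)
    (h : ItemMeetsCompl f p.2 s) (h' : ItemMeetsCompl f p.1 t) :
    ∃ i j k l : ℕ, i < j ∧ j < k ∧ k < l ∧ l < 2 * (m + 3) ∧
      (({cycleItem f i, cycleItem f k} = separator G p ∧ {cycleItem f j, cycleItem f l} = Y) ∨
        ({cycleItem f i, cycleItem f k} = Y ∧ {cycleItem f j, cycleItem f l} = separator G p)) := by
  have hne : ∀ r, cycleItem f r ∉ separator G p → r ≠ i ∧ r ≠ k := by
    intro r hr
    rw [hsep] at hr
    constructor
    · rintro rfl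
      exact hr (Or.inl rfl)
    · rintro rfl
      exact hr (Or.inr rfl)
  obtain ⟨s1, s2⟩ := hne s hs'
  obtain ⟨t1, t2⟩ := hne t ht'
  have main : ∀ s t : ℕ, s < 2 * (m + 3) → t < 2 * (m + 3) → Y = {cycleItem f s, cycleItem f t} →
      (i < s ∧ s < k) → (t < i ∨ k < t) → ∃ i j k l : ℕ, i < j ∧ j < k ∧ k < l ∧
      l < 2 * (m + 3) ∧
      (({cycleItem f i, cycleItem f k} = separator G p ∧ {cycleItem f j, cycleItem f l} = Y) ∨
        ({cycleItem f i, cycleItem f k} = Y ∧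
          {cycleItem f j, cycleItem f l} = separator G p)) := by
    intro s t hs ht hY hs' ht'
    rcases ht' with ht' | ht'
    · exact ⟨t, i, s, k, ht', hs'.1, hs'.2, hk, Or.inr ⟨by rw [hY, Set.pair_comm], hsep.symm⟩⟩
    · exact ⟨i, s, k, t, hs'.1, hs'.2, ht', ht, Or.inl ⟨hsep.symm, hY.symm⟩⟩
  by_cases hsi : i < s ∧ s < k <;> by_cases hti : i < t ∧ t < k
  · exact (false_of_inside hcov hf hinj hk hsep hsi hti h h').elim
  · exact main s t hs ht hY hsi (by omega)
  · exact main t s ht hs (by rw [hY, Set.pair_comm]) hti (by omega)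
  · exact (false_of_outside hcov hf hinj hik hk hsep hs ht (by omega) (by omega) h h').elim

end CycleItem

end

section

variable {G : SimpleGraph V} {p q : Set V × Set V} {u v a b a' b' c d c' d' : V}
  {O : TNode G}

/-! ### Property (1) -/

theorem ofNat_val_add_one {m : ℕ} (r : Fin (m + 3)) : Fin.ofNat (m + 3) (r.val + 1) = r + 1 := by
  apply Fin.ext
  simp [Fin.val_add]

theorem ofNat_val_self {m : ℕ} (r : Fin (m + 3)) : Fin.ofNat (m + 3) r.val = r := by
  apply Fin.ext
  simp

theorem Represents.exists_cycleItem (hG : IsKConnected G 2) {m : ℕ}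
    (φ : cycleGraph (m + 3) ≃g nodeTorso O) {i : V ⊕ Sym2 V} (h : Represents G p i a b)
    (ha : a ∈ nodeBag O) (hb : b ∈ nodeBag O) :
    ∃ k < 2 * (m + 3), cycleItem (fun r => (φ r : V)) k = i ∧
      ∀ B : Set V, (a ∉ B ∨ b ∉ B) → ItemMeetsCompl (fun r => (φ r : V)) B k := by
  obtain ⟨r, hr⟩ := φ.surjective ⟨a, ha⟩
  obtain ⟨s, hs⟩ := φ.surjective ⟨b, hb⟩
  have hr' : (φ r : V) = a := congrArg Subtype.val hr
  have hs' : (φ s : V) = b := congrArg Subtype.val hs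
  rcases h with ⟨rfl, rfl, -⟩ | ⟨rfl, -, -, hab⟩
  · refine ⟨2 * r.val, by omega, ?_, fun B hB => ?_⟩
    · rw [cycleItem_even, ofNat_val_self, hr']
    · rw [itemMeetsCompl_even, ofNat_val_self, hr']
      exact hB.elim id id
  · have hadj : (cycleGraph (m + 3)).Adj r s := by
      rw [← φ.map_adj_iff, hr, hs]
      exact (nodeTorso_adj_iff hG).2 ⟨fun e => hab.ne (congrArg Subtype.val e), Or.inl hab⟩
    rw [cycleGraph_adj, sub_eq_iff_eq_add', sub_eq_iff_eq_add'] at hadj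
    rcases hadj with rfl | rfl
    · refine ⟨2 * s.val + 1, by omega, ?_, fun B hB => ?_⟩
      · rw [cycleItem_odd, ofNat_val_self, ofNat_val_add_one, hs', hr', Sym2.eq_swap]
      · rw [itemMeetsCompl_odd, ofNat_val_self, ofNat_val_add_one, hs', hr']
        exact hB.symm
    · refine ⟨2 * r.val + 1, by omega, ?_, fun B hB => ?_⟩
      · rw [cycleItem_odd, ofNat_val_self, ofNat_val_add_one, hs', hr']
      · rw [itemMeetsCompl_odd, ofNat_val_self, ofNat_val_add_one, hs', hr']
        exact hB

theorem Represents.notMem_separator (hcov : ∀ v, v ∈ p.1 ∨ v ∈ p.2) {i : V ⊕ Sym2 V}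
    (h : Represents G q i c d) (hc : c ∈ p.1) (hd : d ∈ p.1) (hcd : c ∉ p.2 ∨ d ∉ p.2) :
    i ∉ separator G p := by
  rw [mem_separator_iff hcov]
  rintro ⟨a, b, h'⟩
  obtain ⟨h1, h2⟩ := h'.ends h
  have hb : b = c ∨ b = d := (h.ends h').2
  rcases h'.pair with ⟨rfl, -, h4⟩ | ⟨-, h4, -⟩
  · exact hcd.elim (fun e => e (h1.elim (fun e => e ▸ h4) fun e => e ▸ h4))
      fun e => e (h2.elim (fun e => e ▸ h4) fun e => e ▸ h4)
  · exact hb.elim (fun e => h4 (e ▸ hc)) fun e => h4 (e ▸ hd)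

theorem mem_nodeBag_of_cycleItem {m : ℕ} {f : Fin (m + 3) → V} (hf : ∀ r, f r ∈ nodeBag O) {k : ℕ}
    (h : Represents G p (cycleItem f k) a b) : a ∈ nodeBag O ∧ b ∈ nodeBag O := by
  rcases Nat.even_or_odd' k with ⟨r, rfl | rfl⟩
  · rw [cycleItem_even] at h
    obtain ⟨h1, h2⟩ := h.eq_of_inl rfl
    exact ⟨h1 ▸ hf _, h2 ▸ hf _⟩
  · rw [cycleItem_odd] at h
    rcases h with ⟨h, -⟩ | ⟨h, -⟩
    · simp at h
    · rcases Sym2.eq_iff.1 (Sum.inr_injective h) with ⟨rfl, rfl⟩ | ⟨rfl, rfl⟩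
      · exact ⟨hf _, hf _⟩
      · exact ⟨hf _, hf _⟩

theorem mem_nodeBag_of_isCycleAlternating {X Y : Set (V ⊕ Sym2 V)}
    (h : IsCycleAlternating (nodeTorso O) X Y) {i : V ⊕ Sym2 V} (hi : i ∈ X ∪ Y)
    (hr : Represents G p i a b) : a ∈ nodeBag O ∧ b ∈ nodeBag O := by
  obtain ⟨m, φ, k₁, k₂, k₃, k₄, -, -, -, -, h⟩ := h
  have : ∃ k, i = cycleItem (fun r : Fin (m + 3) => (φ r : V)) k := by
    rcases h with ⟨rfl, rfl⟩ | ⟨rfl, rfl⟩ <;> rcases hi with (h | h) | (h | h) <;> exact ⟨_, h⟩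
  obtain ⟨k, rfl⟩ := this
  exact mem_nodeBag_of_cycleItem (fun r => (φ r).2) hr

/-- Distinct nodes orient some member differently, so the intersection of their bags lies in its
separator, which has only two vertices. -/
theorem Quad.eq_of_verts_subset (h : Quad G p q a b a' b' c d c' d')
    {O O' : TNode G} (hO : Quad.verts a b a' b' c d c' d' ⊆ nodeBag O)
    (hO' : Quad.verts a b a' b' c d c' d' ⊆ nodeBag O') : O = O' := by
  by_contra hne
  have : ∃ m, m ∈ O.1 ∧ m ∉ O'.1 := by
    by_contra! hsub
    refine hne (Subtype.ext (Set.Subset.antisymm hsub fun s hs => ?_))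
    exact (O.2.total s (O'.2.sub hs)).resolve_right fun h' => O'.2.anti s hs (hsub _ h')
  obtain ⟨m, hm, hm'⟩ := this
  obtain ⟨x, y, hxy⟩ := exists_is2Sep_of_mem (O.2.sub hm)
  have hms := (O'.2.total m (O.2.sub hm)).resolve_left hm'
  exact h.not_verts_subset_pair x y fun w hw =>
    (hxy.mem_iff w).1 ⟨hO' hw m.swap hms, hO hw m hm⟩

theorem Quad.isCycleGraph (hG : IsKConnected G 2) (h : Quad G p q a b a' b' c d c' d')
    (hO : Quad.verts a b a' b' c d c' d' ⊆ nodeBag O) : IsCycleGraph (nodeTorso O) := by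
  have ha : a ∈ nodeBag O := hO (by simp [Quad.verts])
  have hb : b ∈ nodeBag O := hO (by simp [Quad.verts])
  have ha' : a' ∈ nodeBag O := hO (by simp [Quad.verts])
  have hb' : b' ∈ nodeBag O := hO (by simp [Quad.verts])
  have hl : ∃ v ∈ nodeBag O, v ∉ p.2 := h.link₃.2.2.elim
    (fun h => ⟨c, hO (by simp [Quad.verts]), h⟩) fun h => ⟨d, hO (by simp [Quad.verts]), h⟩
  have hr : ∃ v ∈ nodeBag O, v ∉ p.1 := h.link₄.2.2.elim
    (fun h => ⟨c', hO (by simp [Quad.verts]), h⟩) fun h => ⟨d', hO (by simp [Quad.verts]), h⟩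
  rcases nodeTorso_cases hG O with h' | h' | ⟨⟨φ⟩⟩
  · exact absurd h' (h.rp.restrict hG ha ha' hb hb' hl hr).not_isKConnected_three
  · exact h'
  · refine (h.not_verts_subset_pair (φ 0) (φ 1) fun w hw => ?_).elim
    obtain ⟨r, hr⟩ := φ.surjective ⟨w, hO hw⟩
    have hr' : (φ r : V) = w := congrArg Subtype.val hr
    rw [← hr']
    fin_cases r
    · exact Or.inl rfl
    · exact Or.inr rfl

theorem Quad.isCycleAlternating (hG : IsKConnected G 2) (h : Quad G p q a b a' b' c d c' d')
    {i j i' j' : V ⊕ Sym2 V} (hij : i ≠ j) (hp : separator G p = {i, j})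
    (hq : separator G q = {i', j'})
    (hi : Represents G p i a b) (hj : Represents G p j a' b') (hi' : Represents G q i' c d)
    (hj' : Represents G q j' c' d') (hO : Quad.verts a b a' b' c d c' d' ⊆ nodeBag O) :
    IsCycleAlternating (nodeTorso O) (separator G p) (separator G q) := by
  obtain ⟨m, ⟨φ⟩⟩ := h.isCycleGraph hG hO
  have ha : a ∈ nodeBag O := hO (by simp [Quad.verts])
  have hb : b ∈ nodeBag O := hO (by simp [Quad.verts])
  have ha' : a' ∈ nodeBag O := hO (by simp [Quad.verts])
  have hb' : b' ∈ nodeBag O := hO (by simp [Quad.verts])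
  have hinj : Function.Injective fun r : Fin (m + 3) => (φ r : V) :=
    Subtype.val_injective.comp φ.injective
  have hcross : CrossesInG G (fun r : Fin (m + 3) => (φ r : V)) p := by
    intro r
    have hadj : (nodeTorso O).Adj (φ (Fin.ofNat (m + 3) r)) (φ (Fin.ofNat (m + 3) (r + 1))) := by
      rw [φ.map_adj_iff, cycleGraph_adj, sub_eq_iff_eq_add', sub_eq_iff_eq_add']
      right
      apply Fin.ext
      simp [Fin.val_add]
    exact ⟨fun h1 h2 => h.rp.adj_of_nodeTorso_adj hG ha ha' hb hb' hadj h1 h2,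
      fun h1 h2 => (h.rp.adj_of_nodeTorso_adj hG ha ha' hb hb' hadj.symm h2 h1).symm⟩
  obtain ⟨k₁, hk₁, e₁, -⟩ := hi.exists_cycleItem hG φ ha hb
  obtain ⟨k₂, hk₂, e₂, -⟩ := hj.exists_cycleItem hG φ ha' hb'
  obtain ⟨s, hs, e₃, m₃⟩ := hi'.exists_cycleItem hG φ (hO (by simp [Quad.verts]))
    (hO (by simp [Quad.verts]))
  obtain ⟨t, ht, e₄, m₄⟩ := hj'.exists_cycleItem hG φ (hO (by simp [Quad.verts]))
    (hO (by simp [Quad.verts]))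
  have hs' : cycleItem (fun r : Fin (m + 3) => (φ r : V)) s ∉ separator G p := by
    rw [e₃]
    exact hi'.notMem_separator h.rp.cover h.link₃.1 h.link₃.2.1 h.link₃.2.2
  have ht' : cycleItem (fun r : Fin (m + 3) => (φ r : V)) t ∉ separator G p := by
    rw [e₄, ← separator_swap]
    exact hj'.notMem_separator (p := p.swap) h.rp.swap.cover h.link₄.1 h.link₄.2.1 h.link₄.2.2
  have hY : separator G q = {cycleItem (fun r : Fin (m + 3) => (φ r : V)) s,
      cycleItem (fun r : Fin (m + 3) => (φ r : V)) t} := by rw [e₃, e₄, hq]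
  have hne : k₁ ≠ k₂ := by
    rintro rfl
    exact hij (e₁.symm.trans e₂)
  rcases lt_or_gt_of_ne hne with hlt | hlt
  · obtain ⟨i, j, k, l, h1, h2, h3, h4, h5⟩ := exists_alternation h.rp.cover hcross hinj hlt hk₂
      (by rw [e₁, e₂, hp]) hY hs ht hs' ht' (m₃ _ h.link₃.2.2) (m₄ _ h.link₄.2.2)
    exact ⟨m, φ, i, j, k, l, h1, h2, h3, h4, h5⟩
  · obtain ⟨i, j, k, l, h1, h2, h3, h4, h5⟩ := exists_alternation h.rp.cover hcross hinj hlt hk₁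
      (by rw [e₁, e₂, hp, Set.pair_comm]) hY hs ht hs' ht' (m₃ _ h.link₃.2.2) (m₄ _ h.link₄.2.2)
    exact ⟨m, φ, i, j, k, l, h1, h2, h3, h4, h5⟩

/-- Existence turns an arbitrary node towards the finite set of link ends. For uniqueness, any
alternating torso contains all four elements, hence all their ends. -/
theorem existsUnique_isCycleAlternating (hG : IsKConnected G 2) (hp : IsMixedKSep G 2 p)
    (hq : IsMixedKSep G 2 q) (h : CrossWithSingletonLinks G p q) :
    ∃! O : TNode G, IsCycleAlternating (nodeTorso O) (separator G p) (separator G q) := by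
  obtain ⟨i, j, i', j', a, b, a', b', c, d, c', d', h, hS, hS', hi, hj, hi', hj'⟩ :=
    h.exists_quad hp hq
  have hij : i ≠ j := by
    rintro rfl
    have h2 := hp.2
    rw [hS, Set.pair_eq_singleton, Set.encard_singleton] at h2
    exact absurd h2 (by decide)
  have hN := isTreeSet_totallyNested hG
  obtain ⟨O₀, hO₀⟩ := hN.exists_node
  have hfin : (Quad.verts a b a' b' c d c' d').Finite := by
    refine (Set.toFinite {a, b, a', b', c, d, c', d'}).subset fun w hw => ?_
    simp only [Quad.verts, Set.mem_ofPred_eq] at hw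
    simp only [Set.mem_insert_iff, Set.mem_singleton_iff]
    tauto
  obtain ⟨O, hO, hsub, -⟩ := hN.exists_node_of_finite hO₀ hfin fun s hs => h.verts_subset_or hG hs
  have hbag : Quad.verts a b a' b' c d c' d' ⊆ nodeBag (⟨O, hO⟩ : TNode G) :=
    fun w hw s hs => hsub s hs hw
  refine ⟨⟨O, hO⟩, h.isCycleAlternating hG hij hS hS' hi hj hi' hj' hbag, fun O' hO' => ?_⟩
  refine h.eq_of_verts_subset (fun w hw => ?_) hbag
  have m1 := mem_nodeBag_of_isCycleAlternating hO' (by rw [hS]; exact Or.inl (Or.inl rfl)) hi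
  have m2 := mem_nodeBag_of_isCycleAlternating hO' (by rw [hS]; exact Or.inl (Or.inr rfl)) hj
  have m3 := mem_nodeBag_of_isCycleAlternating hO' (by rw [hS']; exact Or.inr (Or.inl rfl)) hi'
  have m4 := mem_nodeBag_of_isCycleAlternating hO' (by rw [hS']; exact Or.inr (Or.inr rfl)) hj'
  rcases hw with (rfl | rfl) | (rfl | rfl) | (rfl | rfl) | (rfl | rfl)
  exacts [m1.1, m1.2, m2.1, m2.2, m3.1, m3.2, m4.1, m4.2]

/-! ### Property (2) -/

theorem nodeBag_inter_ne (hG : IsKConnected G 2) {O O₁ O₂ : TNode G}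
    (h : IsCycleGraph (nodeTorso O)) (h₁ : (nodeGraph (totallyNested2Seps G)).Adj O O₁)
    (h₂ : (nodeGraph (totallyNested2Seps G)).Adj O O₂) (hne : O₁ ≠ O₂) :
    nodeBag O ∩ nodeBag O₁ ≠ nodeBag O ∩ nodeBag O₂ := by
  have hN := isTreeSet_totallyNested hG
  obtain ⟨m₁, h₁⟩ := h₁
  obtain ⟨m₂, h₂⟩ := h₂
  intro heq
  have hm₁ := IsTreeSet.isMaxIn_of_diff O.2 O₁.2 h₁
  have hm₂ := IsTreeSet.isMaxIn_of_diff O.2 O₂.2 h₂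
  rw [hN.nodeBag_inter h₁, hN.nodeBag_inter h₂] at heq
  obtain ⟨x, y, hs₁⟩ := exists_is2Sep_of_mem (O.2.sub hm₁.1)
  obtain ⟨x', y', hs₂⟩ := exists_is2Sep_of_mem (O.2.sub hm₂.1)
  have hs₂' : Is2Sep G m₂ x y := ⟨hs₂.cover, fun v =>
    (Set.ext_iff.1 heq v).symm.trans (hs₁.mem_iff v), hs₁.ne, hs₂.left, hs₂.right, hs₂.not_adj⟩
  obtain ⟨a, hax, hay⟩ := h.exists_ne ⟨x, mem_nodeBag_of_separator hG hm₁ hs₁.x_mem⟩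
    ⟨y, mem_nodeBag_of_separator hG hm₁ hs₁.y_mem⟩
  obtain rfl := isMaxIn_separator_unique hG hm₁ hm₂ hs₁ hs₂' a.2
    (fun e => hax (Subtype.ext e)) fun e => hay (Subtype.ext e)
  exact hne (hN.node_ext (IsTreeSet.isMaxIn_of_diff O₁.2 O.2 (IsTreeSet.diff_swap O.2 O₁.2 h₁))
    (IsTreeSet.isMaxIn_of_diff O₂.2 O.2 (IsTreeSet.diff_swap O.2 O₂.2 h₂)))

theorem isTreeDecomposition_totallyNested (hG : IsKConnected G 2) :
    IsTreeDecomposition G (nodeGraph (totallyNested2Seps G)) nodeBag := by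
  refine (isTreeSet_totallyNested hG).isTreeDecomposition fun s hs v w hvw => ?_
  obtain ⟨x, y, h⟩ := exists_is2Sep_of_mem hs
  have h1 := h.cover v
  have h2 := h.cover w
  have h3 : ¬ (v ∉ s.2 ∧ w ∉ s.1) := fun h' => h.not_adj v w h'.1 h'.2 hvw
  have h4 : ¬ (w ∉ s.2 ∧ v ∉ s.1) := fun h' => h.not_adj w v h'.1 h'.2 hvw.symm
  tauto

end

end TwoSep

/-! ### The 2-Separation Theorem -/

theorem mainTheorem6 {V : Type u} (G : SimpleGraph V) (hG : TwoSep.IsKConnected G 2) :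
    ∃ (ι : Type u) (T : SimpleGraph ι) (bag : ι → Set V),
      TwoSep.IsTreeDecomposition G T bag ∧
      TwoSep.Induces (TwoSep.totallyNested2Seps G) T bag ∧
      (∀ t : ι,
        TwoSep.IsMinor (TwoSep.torso G T bag t) G ∧
        (TwoSep.IsKConnected (TwoSep.torso G T bag t) 3 ∨
          TwoSep.IsCycleGraph (TwoSep.torso G T bag t) ∨
          TwoSep.IsK2 (TwoSep.torso G T bag t))) ∧
      (∀ p q : Set V × Set V,
        TwoSep.IsMixedKSep G 2 p → TwoSep.IsMixedKSep G 2 q →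
        TwoSep.CrossWithSingletonLinks G p q →
        ∃! t : ι, TwoSep.IsCycleAlternating (TwoSep.torso G T bag t)
          (TwoSep.separator G p) (TwoSep.separator G q)) ∧
      (∀ t : ι, TwoSep.IsCycleGraph (TwoSep.torso G T bag t) →
        ∀ s s' : ι, T.Adj t s → T.Adj t s' → s ≠ s' → bag t ∩ bag s ≠ bag t ∩ bag s') :=
  ⟨TwoSep.TNode G, TwoSep.nodeGraph (TwoSep.totallyNested2Seps G), TwoSep.nodeBag,
    TwoSep.isTreeDecomposition_totallyNested hG,
    (TwoSep.isTreeSet_totallyNested hG).induces,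
    fun t => ⟨TwoSep.isMinor_nodeTorso hG t, TwoSep.nodeTorso_cases hG t⟩,
    fun _ _ hp hq h => TwoSep.existsUnique_isCycleAlternating hG hp hq h,
    fun _ ht _ _ h h' hne => TwoSep.nodeBag_inter_ne hG ht h h' hne⟩
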